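/- Let $\Bbbk$ be a field of characteristic $2$, let $\tau\in\Bbbk$ be such that $x^2+x+\tau$ is irreducible over $\Bbbk$, let $\mathbb F=\Bbbk[x]/(x^2+x+\tau)$, let $\xi\in\mathbb F$ be the class of $x$, and let $n\ge 2$. Every $Z\in M_n(\mathbb F)$ is uniquely $Z=A+\xi B$ with $A,B\in M_n(\Bbbk)$. Put $$\mathcal T_1=\{A+\xi B:\ A-B,\ A+\tau B(A-B)^{-1}B\in \mathrm{GL}_n(\Bbbk)\},\qquad \mathcal T_2=\{A+\xi B:\ B,\ AB^{-1}A-A+\tau B\in \mathrm{GL}_n(\Bbbk)\}.$$ A straight-line program is a finite sequence of instructions with inputs $A,B\in M_n(\Bbbk)$; each instruction produces a scalar matrix $cI_n$ ($c\in\Bbbk$), a scalar multiple $cX$ ($c\in\Bbbk$), a sum $X+Y$, a product $XY$ or an inverse $X^{-1}$, where $X,Y$ are inputs or earlier results. It inverts a set $\mathcal S\subseteq \mathrm{GL}_n(\mathbb F)$ if for every $Z=A+\xi B\in\mathcal S$ all matrices that it inverts are invertible and two designated results $C,D$ satisfy $Z^{-1}=C+\xi D$. Its cost is the total number of its multiplications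 $XY$ and inversions $X^{-1}$ (scalar multiples are not counted). Algorithm 2 is the following. If $Z=A+\xi B\in\mathcal T_1$, compute $$X_1=(A-B)^{-1},\quad X_2=X_1B,\quad X_3=A+\tau BX_2,\quad X_4=X_3^{-1},\quad X_5=X_2X_4,$$ and return $X_4-\xi X_5$. Otherwise, if $Z\in\mathcal T_2$, compute $$X_1=B^{-1},\quad X_2=X_1A,\quad X_3=AX_2-A+\tau B,\quad X_4=X_3^{-1},\quad X_5=(X_2-I_n)X_4,$$ and return $X_5-\xi X_4$. Theorem. 1. Every $Z\in\mathcal T_1\cup\mathcal T_2$ is invertible and Algorithm 2 returns $Z^{-1}$; moreover its first branch inverts all of $\mathcal T_1$ and its second branch inverts all of $\mathcal T_2$. Each branch uses exactly two inversions and three multiplications in $M_n(\Bbbk)$. 2. This is optimal: $5$ is the least cost of a straight-line program that inverts $\mathcal T_1$, and the least cost of one that inverts $\mathcal T_2$. Also, $5$ is the least worst-case cost of an algorithm that inverts every $Z\in\mathcal T_1\cup\mathcal T_2$ by running one straight-line program if $Z\in\mathcal T_1$ and another one otherwise. 3. The least number of additions (subtractions included) in a straight-line program that inverts $\mathcal T_1$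 is $2$, and the same holds for $\mathcal T_2$. The first branch of Algorithm 2 uses two additions. The second branch uses two additions, with still two inversions and three multiplications, if $X_2-I_n$ is computed only once and $X_3$ is evaluated as $A(X_2-I_n)+\tau B$. -/

import Mathlib

noncomputable section

namespace FrobeniusInversion

/-- The polynomial `x² + x + τ`. -/
def quadPoly {k : Type*} [Field k] (τ : k) : Polynomial k :=
  Polynomial.X ^ 2 + Polynomial.X + Polynomial.C τ

/-- The quotient ring `k[x]/(x² + x + τ)`. -/
abbrev QuadExt {k : Type*} [Field k] (τ : k) : Type _ := AdjoinRoot (quadPoly τ)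

/-- The class `ξ` of `x` in `k[x]/(x² + x + τ)`. -/
def xi {k : Type*} [Field k] (τ : k) : QuadExt τ := AdjoinRoot.root (quadPoly τ)

/-- The matrix `A + ξ B` over `k[x]/(x² + x + τ)`, for `A, B ∈ M_n(k)`. -/
def combine {k : Type*} [Field k] (τ : k) {n : ℕ} (A B : Matrix (Fin n) (Fin n) k) :
    Matrix (Fin n) (Fin n) (QuadExt τ) :=
  A.map (algebraMap k (QuadExt τ)) + xi τ • B.map (algebraMap k (QuadExt τ))

/-- `T₁`: the matrices `A + ξ B` with `A - B` and `A + τ B (A - B)⁻¹ B` invertible. -/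
def T₁ {k : Type*} [Field k] (τ : k) (n : ℕ) : Set (Matrix (Fin n) (Fin n) (QuadExt τ)) :=
  {Z | ∃ A B : Matrix (Fin n) (Fin n) k, Z = combine τ A B ∧
    IsUnit (A - B) ∧ IsUnit (A + τ • (B * (A - B)⁻¹ * B))}

/-- `T₂`: the matrices `A + ξ B` with `B` and `A B⁻¹ A - A + τ B` invertible. -/
def T₂ {k : Type*} [Field k] (τ : k) (n : ℕ) : Set (Matrix (Fin n) (Fin n) (QuadExt τ)) :=
  {Z | ∃ A B : Matrix (Fin n) (Fin n) k, Z = combine τ A B ∧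
    IsUnit B ∧ IsUnit (A * B⁻¹ * A - A + τ • B)}

/-- Instructions of a straight-line program over a `k`-algebra. Registers are numbered from `0`
and every instruction writes its result to the next free register. -/
inductive Instr (k : Type*) : Type _ where
  /-- the constant `c · 1` -/
  | const (c : k) : Instr k
  /-- multiplication of register `i` by the scalar `c` -/
  | smul (c : k) (i : ℕ) : Instr k
  /-- addition of registers `i` and `j` -/
  | add (i j : ℕ) : Instr k
  /-- multiplication of registers `i` and `j`, in this order -/
  | mul (i j : ℕ) : Instr k
  /-- inversion of register `i` -/
  | inv (i : ℕ) : Instr k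

/-- Does the instruction perform an addition? -/
def Instr.isAdd {k : Type*} : Instr k → Bool
  | .add _ _ => true
  | _ => false

/-- Does the instruction perform a multiplication? -/
def Instr.isMul {k : Type*} : Instr k → Bool
  | .mul _ _ => true
  | _ => false

/-- Does the instruction perform an inversion? -/
def Instr.isInv {k : Type*} : Instr k → Bool
  | .inv _ => true
  | _ => false

open Classical in
/-- The value of an instruction in `M_n(k)` when the registers hold `s`. It is undefined (`none`)
if a register that is read does not exist, or if the matrix to be inverted is singular. -/
def Instr.exec {k : Type*} [Field k] {n : ℕ} (s : List (Matrix (Fin n) (Fin n) k)) :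
    Instr k → Option (Matrix (Fin n) (Fin n) k)
  | .const c => some (c • 1)
  | .smul c i => (s[i]?).map fun X => c • X
  | .add i j => (s[i]?).bind fun X => (s[j]?).map fun Y => X + Y
  | .mul i j => (s[i]?).bind fun X => (s[j]?).map fun Y => X * Y
  | .inv i => (s[i]?).bind fun X => if IsUnit X then some X⁻¹ else none

/-- Execution of a list of instructions; the result is the final list of registers. -/
def runCode {k : Type*} [Field k] {n : ℕ} :
    List (Instr k) → List (Matrix (Fin n) (Fin n) k) → Option (List (Matrix (Fin n) (Fin n) k))
  | [], s => some s
  | op :: ops, s => (op.exec s).bind fun X => runCode ops (s ++ [X])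

/-- A straight-line program with two output registers. -/
structure SLP (k : Type*) : Type _ where
  code : List (Instr k)
  out₁ : ℕ
  out₂ : ℕ

namespace SLP

/-- The outputs of the program for the inputs `A` (register `0`) and `B` (register `1`). -/
def eval {k : Type*} [Field k] {n : ℕ} (Γ : SLP k) (A B : Matrix (Fin n) (Fin n) k) :
    Option (Matrix (Fin n) (Fin n) k × Matrix (Fin n) (Fin n) k) :=
  (runCode Γ.code [A, B]).bind fun s =>
    (s[Γ.out₁]?).bind fun C => (s[Γ.out₂]?).map fun D => (C, D)

/-- Number of additions. -/
def numAdd {k : Type*} (Γ : SLP k) : ℕ := Γ.code.countP Instr.isAdd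

/-- Number of multiplications; multiplications by scalars of `k` are not counted. -/
def numMul {k : Type*} (Γ : SLP k) : ℕ := Γ.code.countP Instr.isMul

/-- Number of inversions. -/
def numInv {k : Type*} (Γ : SLP k) : ℕ := Γ.code.countP Instr.isInv

/-- Total number of inversions and multiplications. -/
def cost {k : Type*} (Γ : SLP k) : ℕ := Γ.numInv + Γ.numMul

/-- The program inverts every `Z = A + ξ B` in `S`: on the inputs `A, B` it is defined and outputs
the `C, D` with `Z⁻¹ = C + ξ D`. -/
def InvertsOn {k : Type*} [Field k] (Γ : SLP k) (τ : k) {n : ℕ}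
    (S : Set (Matrix (Fin n) (Fin n) (QuadExt τ))) : Prop :=
  ∀ A B : Matrix (Fin n) (Fin n) k, combine τ A B ∈ S →
    IsUnit (combine τ A B) ∧
      ∃ C D, Γ.eval A B = some (C, D) ∧ combine τ C D = (combine τ A B)⁻¹

end SLP

/-- An algorithm that tests whether `Z ∈ T₁` and then runs one of two straight-line programs. -/
structure BranchingSLP (k : Type*) : Type _ where
  onT₁ : SLP k
  onT₂ : SLP k

namespace BranchingSLP

open Classical in
/-- If `Z = A + ξ B` lies in `T₁`, run the first program; else, if it lies in `T₂`, run the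
second one. -/
def eval {k : Type*} [Field k] {n : ℕ} (P : BranchingSLP k) (τ : k)
    (A B : Matrix (Fin n) (Fin n) k) :
    Option (Matrix (Fin n) (Fin n) k × Matrix (Fin n) (Fin n) k) :=
  if combine τ A B ∈ T₁ τ n then P.onT₁.eval A B
  else if combine τ A B ∈ T₂ τ n then P.onT₂.eval A B
  else none

/-- Number of inversions and multiplications in the worst case. -/
def cost {k : Type*} (P : BranchingSLP k) : ℕ := max P.onT₁.cost P.onT₂.cost

/-- The algorithm inverts every `Z = A + ξ B` in `T₁ ∪ T₂`. -/
def Inverts {k : Type*} [Field k] (P : BranchingSLP k) (τ : k) (n : ℕ) : Prop :=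
  ∀ A B : Matrix (Fin n) (Fin n) k, combine τ A B ∈ T₁ τ n ∪ T₂ τ n →
    IsUnit (combine τ A B) ∧
      ∃ C D, P.eval τ A B = some (C, D) ∧ combine τ C D = (combine τ A B)⁻¹

end BranchingSLP

/-- The branch for `T₁`: `X₁ = (A - B)⁻¹`, `X₂ = X₁ B`, `X₃ = A + τ B X₂`, `X₄ = X₃⁻¹`,
`X₅ = X₂ X₄`, output `X₄ - ξ X₅`. -/
def progT₁ {k : Type*} [Field k] (τ : k) : SLP k where
  code :=
    [ .smul (-1) 1, -- 2: `-B`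
      .add 0 2, -- 3: `A - B`
      .inv 3, -- 4: `X₁`
      .mul 4 1, -- 5: `X₂`
      .mul 1 5, -- 6: `B X₂`
      .smul τ 6, -- 7: `τ B X₂`
      .add 0 7, -- 8: `X₃`
      .inv 8, -- 9: `X₄`
      .mul 5 9, -- 10: `X₅`
      .smul (-1) 10 ] -- 11: `-X₅`
  out₁ := 9
  out₂ := 11

/-- The branch for `T₂`: `X₁ = B⁻¹`, `X₂ = X₁ A`, `X₃ = A X₂ - A + τ B`, `X₄ = X₃⁻¹`,
`X₅ = (X₂ - 1) X₄`, output `X₅ - ξ X₄`. -/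
def progT₂ {k : Type*} [Field k] (τ : k) : SLP k where
  code :=
    [ .inv 1, -- 2: `X₁`
      .mul 2 0, -- 3: `X₂`
      .mul 0 3, -- 4: `A X₂`
      .smul (-1) 0, -- 5: `-A`
      .add 4 5, -- 6: `A X₂ - A`
      .smul τ 1, -- 7: `τ B`
      .add 6 7, -- 8: `X₃`
      .inv 8, -- 9: `X₄`
      .const (-1), -- 10: `-1`
      .add 3 10, -- 11: `X₂ - 1`
      .mul 11 9, -- 12: `X₅`
      .smul (-1) 9 ] -- 13: `-X₄`
  out₁ := 12
  out₂ := 13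

/-- The same branch, with `X₂ - 1` computed once and `X₃` evaluated as `A (X₂ - 1) + τ B`. -/
def progT₂' {k : Type*} [Field k] (τ : k) : SLP k where
  code :=
    [ .inv 1, -- 2: `X₁`
      .mul 2 0, -- 3: `X₂`
      .const (-1), -- 4: `-1`
      .add 3 4, -- 5: `X₂ - 1`
      .mul 0 5, -- 6: `A (X₂ - 1)`
      .smul τ 1, -- 7: `τ B`
      .add 6 7, -- 8: `X₃`
      .inv 8, -- 9: `X₄`
      .mul 5 9, -- 10: `X₅`
      .smul (-1) 9 ] -- 11: `-X₄`
  out₁ := 10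
  out₂ := 11

/-- The second Frobenius inversion algorithm. -/
def frobeniusInversion {k : Type*} [Field k] (τ : k) : BranchingSLP k where
  onT₁ := progT₁ τ
  onT₂ := progT₂ τ

end FrobeniusInversion

end

noncomputable section

namespace FrobeniusInversion

/-! ### Arithmetic of `A + ξ B` and the two inversion formulas. -/

section Combine

variable {k : Type*} [Field k] {τ : k}

/-! Correctness is the identity `(A + ξB)(C + ξD) = (AC - τBD) + ξ(AD + BC - BD)` with explicit `C`
and `D`. For the lower bounds, a program that is correct on a family Ω of inputs is run once in the
ring of functions on Ω. Block diagonal inputs cut the size from `n` to 2, so that the functions take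
values in a subalgebra `S` of the 2 × 2 matrices (`SLP.InvertsOn.exists_runIn`).

Cost. Only products and inversions enlarge the span of the registers, each by at most one dimension,
starting from `span {1, A, B}`. If four of them yield both components of the inverse, then three of
them yield a nontrivial combination `αC + βD` over `k` (`Reach.exists_smul_add_smul_mem`).
Multiplication by `ξ⁻¹` turns the formulas of `T₁` into those of `T₂`, so one target suffices
(`SLP.exists_reach_three`).

If `k` has at least four elements, take `A = vx` and `B = x` with `v`, `x` in the field `K = k[ξ]`,
which has at least sixteen. The target becomes `(αv + β) / ((v² - v + τ)x)`, with poles at `v = θ =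
-ξ` and `v = 1 - θ`. All coefficients lie in `k` and `θ` does not, so few elements can be inverted,
and a linear form over `k` that vanishes at `θ` is zero. The four types of the first two operations
are then excluded one by one (`QuadRoot.fieldT_notMem_of_reach`). If `k` has two elements, `K` is
too small; seventeen pairs of 2 × 2 matrices and an exhaustive computation replace it
(`threeStepsAvoid_points`).

Additions. With at most one addition, of result `S`, all registers satisfy a property stable under
products, inverses and scalars. On `T₂`, if `S` is invertible everywhere, a register is invertible
everywhere or vanishes for `A = 0`, and the first output does neither. If `S` is singular somewhere,
a register depends on `B` alone, vanishes for `A = 0` or is singular there, and the second output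
does none of these. On `T₁`, the first output would be `c S ^ z` with `S = αA + βB`, and sample
points exclude both parities of `z`. -/

theorem xi_mul_xi (τ : k) : xi τ * xi τ = -xi τ - algebraMap k (QuadExt τ) τ := by
  have h : AdjoinRoot.mk (quadPoly τ) (Polynomial.X ^ 2 + Polynomial.X + Polynomial.C τ) = 0 :=
    AdjoinRoot.mk_self
  have h2 : xi τ ^ 2 + xi τ + algebraMap k (QuadExt τ) τ = 0 := by
    simpa [xi, AdjoinRoot.algebraMap_eq] using h
  linear_combination h2

theorem natDegree_quadPoly (τ : k) : (quadPoly τ).natDegree = 2 := by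
  unfold quadPoly
  compute_degree!

/-- The modulus has degree two, so a multiple of it of degree at most one is zero; irreducibility
plays no role. -/
theorem xi_coord_injective (τ : k) {x y x' y' : k}
    (h : algebraMap k (QuadExt τ) x + xi τ * algebraMap k (QuadExt τ) y =
      algebraMap k (QuadExt τ) x' + xi τ * algebraMap k (QuadExt τ) y') : x = x' ∧ y = y' := by
  let p : Polynomial k := Polynomial.C (x - x') + Polynomial.X * Polynomial.C (y - y')
  have hp : AdjoinRoot.mk (quadPoly τ) p = 0 := by
    have : AdjoinRoot.mk (quadPoly τ) p =
        (algebraMap k (QuadExt τ) x + xi τ * algebraMap k (QuadExt τ) y) -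
        (algebraMap k (QuadExt τ) x' + xi τ * algebraMap k (QuadExt τ) y') := by
      simp only [p, xi, AdjoinRoot.algebraMap_eq, map_add, map_mul, AdjoinRoot.mk_C,
        AdjoinRoot.mk_X, map_sub]
      ring
    rw [this, h, sub_self]
  have hdvd := AdjoinRoot.mk_eq_zero.1 hp
  have hdeg : p.natDegree < (quadPoly τ).natDegree := by
    rw [natDegree_quadPoly]
    have : p.natDegree ≤ 1 := by
      simp only [p]
      compute_degree
    omega
  have h0 : p = 0 := Polynomial.eq_zero_of_dvd_of_natDegree_lt hdvd hdeg
  have c0 := congrArg (fun q => Polynomial.coeff q 0) h0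
  have c1 := congrArg (fun q => Polynomial.coeff q 1) h0
  simp [p, Polynomial.coeff_C] at c0 c1
  exact ⟨sub_eq_zero.1 c0, sub_eq_zero.1 c1⟩

variable {n : ℕ}

theorem combine_injective {A B C D : Matrix (Fin n) (Fin n) k}
    (h : combine τ A B = combine τ C D) : A = C ∧ B = D := by
  have key : ∀ i j, A i j = C i j ∧ B i j = D i j := fun i j =>
    xi_coord_injective τ (by simpa [combine] using congrFun (congrFun h i) j)
  exact ⟨Matrix.ext fun i j => (key i j).1, Matrix.ext fun i j => (key i j).2⟩

theorem combine_mul (A B C D : Matrix (Fin n) (Fin n) k) :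
    combine τ A B * combine τ C D =
      combine τ (A * C - τ • (B * D)) (A * D + B * C - B * D) := by
  have hτ : ∀ M : Matrix (Fin n) (Fin n) k, (τ • M).map (algebraMap k (QuadExt τ)) =
      algebraMap k (QuadExt τ) τ • M.map (algebraMap k (QuadExt τ)) := by
    intro M; ext i j; simp
  simp only [combine, Matrix.map_sub _ (map_sub (algebraMap k (QuadExt τ))),
    Matrix.map_add _ (map_add (algebraMap k (QuadExt τ))), Matrix.map_mul, hτ]
  simp only [add_mul, mul_add, smul_mul_assoc, mul_smul_comm]
  match_scalars <;> first | ring1 | linear_combination xi_mul_xi τ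

theorem combine_one_zero : combine τ (1 : Matrix (Fin n) (Fin n) k) 0 = 1 := by
  simp [combine]

theorem combine_inv {A B C D : Matrix (Fin n) (Fin n) k} (h₁ : A * C - τ • (B * D) = 1)
    (h₂ : A * D + B * C - B * D = 0) :
    IsUnit (combine τ A B) ∧ combine τ C D = (combine τ A B)⁻¹ := by
  have h : combine τ A B * combine τ C D = 1 := by
    rw [combine_mul, h₁, h₂, combine_one_zero]
  exact ⟨(Matrix.isUnit_iff_isUnit_det _).2 (Matrix.isUnit_det_of_right_inverse h),
    (Matrix.inv_eq_right_inv h).symm⟩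

theorem combine_mem_T₁ {A B : Matrix (Fin n) (Fin n) k} :
    combine τ A B ∈ T₁ τ n ↔ IsUnit (A - B) ∧ IsUnit (A + τ • (B * (A - B)⁻¹ * B)) := by
  constructor
  · rintro ⟨A', B', h, h'⟩
    obtain ⟨rfl, rfl⟩ := combine_injective h
    exact h'
  · exact fun h => ⟨A, B, rfl, h⟩

theorem combine_mem_T₂ {A B : Matrix (Fin n) (Fin n) k} :
    combine τ A B ∈ T₂ τ n ↔ IsUnit B ∧ IsUnit (A * B⁻¹ * A - A + τ • B) := by
  constructor
  · rintro ⟨A', B', h, h'⟩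
    obtain ⟨rfl, rfl⟩ := combine_injective h
    exact h'
  · exact fun h => ⟨A, B, rfl, h⟩

/-- The inverse of `A + ξ B` when `A - B` has inverse `R` and `A + τ B R B` has right inverse
`E`. -/
theorem combine_inv_T₁ {R E A B : Matrix (Fin n) (Fin n) k} (hR : (A - B) * R = 1)
    (hE : (A + τ • (B * R * B)) * E = 1) :
    IsUnit (combine τ A B) ∧ combine τ E (-(R * B * E)) = (combine τ A B)⁻¹ := by
  refine combine_inv ?_ ?_
  · refine Eq.trans ?_ hE
    simp only [add_mul, smul_mul_assoc, mul_neg, smul_neg, sub_neg_eq_add, mul_assoc]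
  · have h : (A - B) * R * (B * E) = B * E := by rw [hR, one_mul]
    simp only [sub_mul, mul_assoc] at h
    simp only [mul_neg, mul_assoc]
    linear_combination (norm := module) -h

/-- The inverse of `A + ξ B` when `B` has inverse `R` and `A R A - A + τ B` has right inverse
`E`. -/
theorem combine_inv_T₂ {R E A B : Matrix (Fin n) (Fin n) k} (hR : B * R = 1)
    (hE : (A * R * A - A + τ • B) * E = 1) :
    IsUnit (combine τ A B) ∧ combine τ ((R * A - 1) * E) (-E) = (combine τ A B)⁻¹ := by
  refine combine_inv ?_ ?_
  · refine Eq.trans ?_ hE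
    simp only [add_mul, sub_mul, mul_sub, smul_mul_assoc, mul_neg, smul_neg, mul_assoc, one_mul]
    module
  · have h : B * R * (A * E) = A * E := by rw [hR, one_mul]
    simp only [mul_assoc] at h
    simp only [mul_neg, mul_assoc, sub_mul, mul_sub, one_mul]
    linear_combination (norm := module) h

end Combine

/-! ### Correctness of the programs. -/

section Programs

variable {k : Type*} [Field k] {τ : k} {n : ℕ}

theorem progT₁_invertsOn (τ : k) : (progT₁ τ).InvertsOn τ (T₁ τ n) := by
  intro A B h
  obtain ⟨h₁, h₂⟩ := combine_mem_T₁.1 h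
  have hd := (Matrix.isUnit_iff_isUnit_det _).1 h₁
  have hd₂ := (Matrix.isUnit_iff_isUnit_det _).1 h₂
  obtain ⟨hu, hi⟩ := combine_inv_T₁ (τ := τ) (Matrix.mul_nonsing_inv _ hd)
    (Matrix.mul_nonsing_inv _ hd₂)
  refine ⟨hu, _, _, ?_, hi⟩
  have e₁ : A + (-1 : k) • B = A - B := by module
  have e₂ : A + τ • (B * ((A - B)⁻¹ * B)) = A + τ • (B * (A - B)⁻¹ * B) := by
    rw [mul_assoc]
  simp [SLP.eval, progT₁, runCode, Instr.exec, ← sub_eq_add_neg, h₁, e₂, h₂]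

theorem progT₂_invertsOn (τ : k) : (progT₂ τ).InvertsOn τ (T₂ τ n) := by
  intro A B h
  obtain ⟨h₁, h₂⟩ := combine_mem_T₂.1 h
  have hd := (Matrix.isUnit_iff_isUnit_det _).1 h₁
  have hd₂ := (Matrix.isUnit_iff_isUnit_det _).1 h₂
  obtain ⟨hu, hi⟩ := combine_inv_T₂ (τ := τ) (Matrix.mul_nonsing_inv _ hd)
    (Matrix.mul_nonsing_inv _ hd₂)
  refine ⟨hu, _, _, ?_, hi⟩
  have e₂ : A * (B⁻¹ * A) - A + τ • B = A * B⁻¹ * A - A + τ • B := by rw [mul_assoc]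
  simp [SLP.eval, progT₂, runCode, Instr.exec, ← sub_eq_add_neg, h₁, e₂, h₂]

theorem progT₂'_invertsOn (τ : k) : (progT₂' τ).InvertsOn τ (T₂ τ n) := by
  intro A B h
  obtain ⟨h₁, h₂⟩ := combine_mem_T₂.1 h
  have hd := (Matrix.isUnit_iff_isUnit_det _).1 h₁
  have hd₂ := (Matrix.isUnit_iff_isUnit_det _).1 h₂
  obtain ⟨hu, hi⟩ := combine_inv_T₂ (τ := τ) (Matrix.mul_nonsing_inv _ hd)
    (Matrix.mul_nonsing_inv _ hd₂)
  refine ⟨hu, _, _, ?_, hi⟩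
  have e₂ : A * (B⁻¹ * A - 1) + τ • B = A * B⁻¹ * A - A + τ • B := by
    rw [mul_sub, mul_one, mul_assoc]
  simp [SLP.eval, progT₂', runCode, Instr.exec, ← sub_eq_add_neg, h₁, e₂, h₂]

theorem frobeniusInversion_inverts (τ : k) : (frobeniusInversion τ).Inverts τ n := by
  intro A B h
  by_cases h₁ : combine τ A B ∈ T₁ τ n
  · simpa [BranchingSLP.eval, h₁, frobeniusInversion] using progT₁_invertsOn τ A B h₁
  · have h₂ : combine τ A B ∈ T₂ τ n := h.resolve_left h₁
    simpa [BranchingSLP.eval, h₁, h₂, frobeniusInversion] using progT₂_invertsOn τ A B h₂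

/-- This transfers the lower bound to branching algorithms: their first branch alone already has to
pay it. -/
theorem BranchingSLP.Inverts.onT₁ {P : BranchingSLP k} (hP : P.Inverts τ n) :
    P.onT₁.InvertsOn τ (T₁ τ n) := by
  intro A B h
  simpa [BranchingSLP.eval, h] using hP A B (Or.inl h)

end Programs

end FrobeniusInversion

end

noncomputable section

namespace FrobeniusInversion

/-! ### Runs in an arbitrary algebra and their lift to rings of functions. -/

section RunIn

variable {k : Type*} [Field k]

/-- `x` is the value of an instruction in the `k`-algebra `R` when the registers hold `s`. -/
def ExecIn {R : Type*} [Ring R] [Algebra k R] (s : List R) : Instr k → R → Prop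
  | .const c, x => x = c • 1
  | .smul c i, x => ∃ y, s[i]? = some y ∧ x = c • y
  | .add i j, x => ∃ y z, s[i]? = some y ∧ s[j]? = some z ∧ x = y + z
  | .mul i j, x => ∃ y z, s[i]? = some y ∧ s[j]? = some z ∧ x = y * z
  | .inv i, x => ∃ y, s[i]? = some y ∧ y * x = 1 ∧ x * y = 1

/-- Running the code in the `k`-algebra `R` leads from the registers `s` to the registers `t`. -/
inductive RunIn {R : Type*} [Ring R] [Algebra k R] :
    List (Instr k) → List R → List R → Prop
  | nil (s : List R) : RunIn [] s s
  | cons {op : Instr k} {ops : List (Instr k)} {s t : List R} {x : R} :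
      ExecIn s op x → RunIn ops (s ++ [x]) t → RunIn (op :: ops) s t

theorem ExecIn.map {R R' : Type*} [Ring R] [Algebra k R] [Ring R'] [Algebra k R']
    (ψ : R →ₐ[k] R') {s : List R} {op : Instr k} {x : R} (h : ExecIn s op x) :
    ExecIn (s.map ψ) op (ψ x) := by
  cases op with
  | const c => simp only [ExecIn] at h ⊢; simp [h]
  | smul c i =>
    obtain ⟨y, hy, rfl⟩ := h
    exact ⟨ψ y, by simp [hy], by simp⟩
  | add i j =>
    obtain ⟨y, z, hy, hz, rfl⟩ := h
    exact ⟨ψ y, ψ z, by simp [hy], by simp [hz], by simp⟩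
  | mul i j =>
    obtain ⟨y, z, hy, hz, rfl⟩ := h
    exact ⟨ψ y, ψ z, by simp [hy], by simp [hz], by simp⟩
  | inv i =>
    obtain ⟨y, hy, h₁, h₂⟩ := h
    exact ⟨ψ y, by simp [hy], by rw [← map_mul, h₁, map_one], by rw [← map_mul, h₂, map_one]⟩

theorem RunIn.map {R R' : Type*} [Ring R] [Algebra k R] [Ring R'] [Algebra k R']
    (ψ : R →ₐ[k] R') {code : List (Instr k)} {s t : List R} (h : RunIn code s t) :
    RunIn code (s.map ψ) (t.map ψ) := by
  induction h with
  | nil s => exact .nil _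
  | cons hx _ ih => exact .cons (hx.map ψ) (by simpa using ih)

variable {n : ℕ} {S : Type*} [Ring S] [Algebra k S] {Ω : Type*} [Nonempty Ω]

/-- All points execute the same instruction, so the values assemble to one function. They stay in
the image of `φ`: for an inverse this is the hypothesis that `φ` reflects units. Definedness at one
point guarantees that the registers that are read exist. -/
theorem exists_execIn (φ : S →ₐ[k] Matrix (Fin n) (Fin n) k)
    (hφ : ∀ x, IsUnit (φ x) → IsUnit x) (op : Instr k) (s : List (Ω → S))
    (h : ∀ ω, ∃ X, op.exec (s.map fun f => φ (f ω)) = some X) :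
    ∃ x : Ω → S, ExecIn s op x ∧ ∀ ω, op.exec (s.map fun f => φ (f ω)) = some (φ (x ω)) := by
  obtain ⟨ω₀⟩ := ‹Nonempty Ω›
  cases op with
  | const c => exact ⟨c • 1, rfl, fun ω => by simp [Instr.exec]⟩
  | smul c i =>
    cases hi : s[i]? with
    | none => simpa [Instr.exec, hi] using h ω₀
    | some y => exact ⟨c • y, ⟨y, hi, rfl⟩, fun ω => by simp [Instr.exec, hi]⟩
  | add i j =>
    cases hi : s[i]? with
    | none => simpa [Instr.exec, hi] using h ω₀
    | some y =>
      cases hj : s[j]? with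
      | none => simpa [Instr.exec, hi, hj] using h ω₀
      | some z => exact ⟨y + z, ⟨y, z, hi, hj, rfl⟩, fun ω => by simp [Instr.exec, hi, hj]⟩
  | mul i j =>
    cases hi : s[i]? with
    | none => simpa [Instr.exec, hi] using h ω₀
    | some y =>
      cases hj : s[j]? with
      | none => simpa [Instr.exec, hi, hj] using h ω₀
      | some z => exact ⟨y * z, ⟨y, z, hi, hj, rfl⟩, fun ω => by simp [Instr.exec, hi, hj]⟩
  | inv i =>
    cases hi : s[i]? with
    | none => simpa [Instr.exec, hi] using h ω₀
    | some y =>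
      have hu : ∀ ω, IsUnit (φ (y ω)) := by
        intro ω
        by_contra hc
        obtain ⟨X, hX⟩ := h ω
        simp [Instr.exec, hi, hc] at hX
      choose u hu' using fun ω => hφ _ (hu ω)
      refine ⟨fun ω => ((u ω)⁻¹ : Sˣ), ⟨y, hi, ?_, ?_⟩, ?_⟩
      · funext ω; simp [← hu' ω]
      · funext ω; simp [← hu' ω]
      · intro ω
        have : (φ (y ω))⁻¹ = φ ((u ω)⁻¹ : Sˣ) := by
          apply Matrix.inv_eq_right_inv
          rw [← map_mul, ← hu' ω, Units.mul_inv, map_one]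
        simp [Instr.exec, hi, hu ω, this]

theorem exists_runIn (φ : S →ₐ[k] Matrix (Fin n) (Fin n) k)
    (hφ : ∀ x, IsUnit (φ x) → IsUnit x) (code : List (Instr k)) (s : List (Ω → S))
    (h : ∀ ω, ∃ t, runCode code (s.map fun f => φ (f ω)) = some t) :
    ∃ t : List (Ω → S), RunIn code s t ∧
      ∀ ω, runCode code (s.map fun f => φ (f ω)) = some (t.map fun f => φ (f ω)) := by
  induction code generalizing s with
  | nil => exact ⟨s, .nil s, fun ω => rfl⟩
  | cons op ops ih =>
    obtain ⟨x, hx, hx'⟩ := exists_execIn φ hφ op s (by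
      intro ω
      obtain ⟨t, ht⟩ := h ω
      obtain ⟨X, hX, -⟩ := Option.bind_eq_some_iff.1 ht
      exact ⟨X, hX⟩)
    have key : ∀ ω, runCode (op :: ops) (s.map fun f => φ (f ω)) =
        runCode ops ((s ++ [x]).map fun f => φ (f ω)) := by
      intro ω
      simp [runCode, hx' ω]
    obtain ⟨t, ht, ht'⟩ := ih (s ++ [x]) (fun ω => by rw [← key]; exact h ω)
    exact ⟨t, .cons hx ht, fun ω => by rw [key, ht' ω]⟩

end RunIn

/-! ### Reduction to 2 × 2 blocks. -/

section Block

variable {k : Type*} [Field k] {S : Type*} [Ring S] [Algebra k S]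

/-- The block diagonal embedding of `S × M_m(k)` into `M_{2+m}(k)`, for `S` acting on `k²`. -/
def blockHom (ι : S →ₐ[k] Matrix (Fin 2) (Fin 2) k) (m : ℕ) :
    S × Matrix (Fin m) (Fin m) k →ₐ[k] Matrix (Fin (2 + m)) (Fin (2 + m)) k :=
  (Matrix.reindexAlgEquiv k k finSumFinEquiv).toAlgHom.comp
    (AlgHom.ofLinearMap
      { toFun := fun x => Matrix.fromBlocks (ι x.1) 0 0 x.2
        map_add' := fun x y => by simp [Matrix.fromBlocks_add]
        map_smul' := fun c x => by simp [Matrix.fromBlocks_smul] }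
      (by simp) (fun x y => by simp [Matrix.fromBlocks_multiply]))

theorem blockHom_injective {ι : S →ₐ[k] Matrix (Fin 2) (Fin 2) k}
    (hι : Function.Injective ι) (m : ℕ) : Function.Injective (blockHom ι m) := by
  intro x y h
  have h' : Matrix.fromBlocks (ι x.1) 0 0 x.2 = Matrix.fromBlocks (ι y.1) 0 0 y.2 :=
    (Matrix.reindexAlgEquiv k k finSumFinEquiv).injective h
  obtain ⟨h₁, -, -, h₂⟩ := Matrix.fromBlocks_inj.1 h'
  exact Prod.ext (hι h₁) h₂

theorem isUnit_of_isUnit_blockHom {ι : S →ₐ[k] Matrix (Fin 2) (Fin 2) k}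
    (hι : ∀ x, IsUnit (ι x) → IsUnit x) (m : ℕ) (x : S × Matrix (Fin m) (Fin m) k)
    (h : IsUnit (blockHom ι m x)) : IsUnit x := by
  have h' : IsUnit (Matrix.fromBlocks (ι x.1) 0 0 x.2) := by
    have := h.map (Matrix.reindexAlgEquiv k k (finSumFinEquiv (m := 2) (n := m))).symm
    simpa [blockHom] using this
  obtain ⟨h₁, h₂⟩ := Matrix.isUnit_fromBlocks_zero₂₁.1 h'
  exact Prod.isUnit_iff.2 ⟨hι _ h₁, h₂⟩

variable {τ : k} {m : ℕ} {Ω : Type*} [Nonempty Ω]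

/-- By uniqueness of the inverse the outputs at the block inputs are the images of `c` and `d`;
injectivity of `blockHom` identifies them as functions on Ω. The projection to the factor `S` is an
algebra homomorphism and carries the run along. -/
theorem SLP.InvertsOn.exists_runIn {Γ : SLP k}
    {T : Set (Matrix (Fin (2 + m)) (Fin (2 + m)) (QuadExt τ))} (hΓ : Γ.InvertsOn τ T)
    {ι : S →ₐ[k] Matrix (Fin 2) (Fin 2) k} (hinj : Function.Injective ι)
    (hι : ∀ x, IsUnit (ι x) → IsUnit x) (a b c d : Ω → S × Matrix (Fin m) (Fin m) k)
    (hmem : ∀ ω, combine τ (blockHom ι m (a ω)) (blockHom ι m (b ω)) ∈ T)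
    (h₁ : a * c - τ • (b * d) = 1) (h₂ : a * d + b * c - b * d = 0) :
    ∃ t : List (Ω → S), RunIn Γ.code [fun ω => (a ω).1, fun ω => (b ω).1] t ∧
      t[Γ.out₁]? = some (fun ω => (c ω).1) ∧ t[Γ.out₂]? = some (fun ω => (d ω).1) := by
  have main : ∀ ω, Γ.eval (blockHom ι m (a ω)) (blockHom ι m (b ω)) =
      some (blockHom ι m (c ω), blockHom ι m (d ω)) := by
    intro ω
    obtain ⟨-, C, D, hev, hCD⟩ := hΓ _ _ (hmem ω)
    have e₁ := congrArg (blockHom ι m) (congrFun h₁ ω)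
    have e₂ := congrArg (blockHom ι m) (congrFun h₂ ω)
    simp only [Pi.sub_apply, Pi.mul_apply, Pi.smul_apply, Pi.one_apply, Pi.add_apply,
      Pi.zero_apply, map_sub, map_mul, map_smul, map_add, map_one, map_zero] at e₁ e₂
    obtain ⟨hC, hD⟩ := combine_injective (hCD.trans (combine_inv e₁ e₂).2.symm)
    rw [hev, hC, hD]
  obtain ⟨t, ht, ht'⟩ := FrobeniusInversion.exists_runIn (blockHom ι m)
    (isUnit_of_isUnit_blockHom hι m) Γ.code [a, b] (by
      intro ω
      obtain ⟨t, ht, -⟩ := Option.bind_eq_some_iff.1 (main ω)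
      exact ⟨t, ht⟩)
  have hout : ∀ ω, ∃ f g, t[Γ.out₁]? = some f ∧ t[Γ.out₂]? = some g ∧ f ω = c ω ∧ g ω = d ω := by
    intro ω
    have h := main ω
    have ht'' := ht' ω
    simp only [List.map_cons, List.map_nil] at ht''
    simp only [SLP.eval, ht'', Option.bind_some, List.getElem?_map, Option.bind_map,
      Option.bind_eq_some_iff, Option.map_eq_some_iff, Function.comp, Option.map_map] at h
    obtain ⟨f, hf, g, hg, hfg⟩ := h
    exact ⟨f, g, hf, hg, blockHom_injective hinj m (Prod.ext_iff.1 hfg).1,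
      blockHom_injective hinj m (Prod.ext_iff.1 hfg).2⟩
  obtain ⟨ω₀⟩ := ‹Nonempty Ω›
  obtain ⟨f, g, hf, hg, -, -⟩ := hout ω₀
  have hfc : f = c := by
    funext ω
    obtain ⟨f', g', hf', -, h, -⟩ := hout ω
    rw [hf] at hf'
    rw [← h, Option.some.inj hf']
  have hgd : g = d := by
    funext ω
    obtain ⟨f', g', -, hg', -, h⟩ := hout ω
    rw [hg] at hg'
    rw [← h, Option.some.inj hg']
  subst hfc hgd
  let ψ : (Ω → S × Matrix (Fin m) (Fin m) k) →ₐ[k] (Ω → S) :=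
    (AlgHom.fst k S (Matrix (Fin m) (Fin m) k)).compLeft Ω
  exact ⟨t.map ψ, ht.map ψ, by rw [List.getElem?_map, hf]; rfl, by rw [List.getElem?_map, hg]; rfl⟩

end Block

end FrobeniusInversion

end

noncomputable section

namespace FrobeniusInversion

/-! ### Completion of 2 × 2 data to inputs in `T₁` and `T₂`. -/

section Restrict

variable {k : Type*} [Field k] {S : Type*} [Ring S] [Algebra k S]
  {τ : k} {n : ℕ} {Ω : Type*} [Nonempty Ω]

/-- The complementary block is `A = 1`, `B = 0`, that is `Z = 1`. -/
theorem SLP.InvertsOn.exists_runIn_T₁ {Γ : SLP k} (hΓ : Γ.InvertsOn τ (T₁ τ n)) (hn : 2 ≤ n)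
    {ι : S →ₐ[k] Matrix (Fin 2) (Fin 2) k} (hinj : Function.Injective ι)
    (hι : ∀ x, IsUnit (ι x) → IsUnit x) (a b r e : Ω → S)
    (h₁ : (a - b) * r = 1) (h₁' : r * (a - b) = 1)
    (h₂ : (a + τ • (b * r * b)) * e = 1) (h₂' : e * (a + τ • (b * r * b)) = 1) :
    ∃ t : List (Ω → S), RunIn Γ.code [a, b] t ∧
      t[Γ.out₁]? = some e ∧ t[Γ.out₂]? = some (-(r * b * e)) := by
  obtain ⟨m, rfl⟩ := Nat.exists_eq_add_of_le hn
  refine hΓ.exists_runIn hinj hι (fun ω => (a ω, 1)) (fun ω => (b ω, 0))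
    (fun ω => (e ω, 1)) (fun ω => (-(r ω * b ω * e ω), 0)) ?_ ?_ ?_
  · intro ω
    rw [combine_mem_T₁]
    have e₁ := congrFun h₁ ω
    have e₁' := congrFun h₁' ω
    have e₂ := congrFun h₂ ω
    have e₂' := congrFun h₂' ω
    simp only [Pi.sub_apply, Pi.mul_apply, Pi.smul_apply, Pi.one_apply, Pi.add_apply]
      at e₁ e₁' e₂ e₂'
    have hu : IsUnit (a ω - b ω) := ⟨⟨_, _, e₁, e₁'⟩, rfl⟩
    have hu₂ : IsUnit (a ω + τ • (b ω * r ω * b ω)) := ⟨⟨_, _, e₂, e₂'⟩, rfl⟩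
    have hinv : (blockHom ι m ((a ω - b ω), 1))⁻¹ = blockHom ι m (r ω, 1) := by
      apply Matrix.inv_eq_right_inv
      rw [← map_mul]
      simp [e₁, ← Prod.one_eq_mk]
    have hsub : blockHom ι m (a ω, 1) - blockHom ι m (b ω, 0) =
        blockHom ι m ((a ω - b ω), 1) := by rw [← map_sub]; simp
    rw [hsub, hinv, ← map_mul, ← map_mul, ← map_smul, ← map_add]
    refine ⟨IsUnit.map _ (Prod.isUnit_iff.2 ⟨hu, isUnit_one⟩),
      IsUnit.map _ (Prod.isUnit_iff.2 ⟨hu₂, ?_⟩)⟩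
    simp
  · funext ω
    have e₂ := congrFun h₂ ω
    simp only [Pi.mul_apply, Pi.smul_apply, Pi.one_apply, Pi.add_apply, add_mul,
      smul_mul_assoc] at e₂
    refine Prod.ext ?_ ?_
    · simpa [mul_assoc] using e₂
    · simp
  · funext ω
    have e₁ := congrArg (· * (b ω * e ω)) (congrFun h₁ ω)
    simp only [Pi.sub_apply, Pi.mul_apply, Pi.one_apply, sub_mul, mul_assoc, one_mul] at e₁
    refine Prod.ext ?_ ?_
    · simp only [Pi.add_apply, Pi.sub_apply, Pi.mul_apply, Pi.zero_apply, Prod.fst_add,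
        Prod.fst_sub, Prod.fst_mul, Prod.fst_zero, mul_neg, mul_assoc]
      linear_combination (norm := abel) -e₁
    · simp

/-- Here `B` must be invertible, so the complementary block is `A = 0`, `B = 1`, that is `Z = ξ`,
with inverse `-τ⁻¹ - τ⁻¹ξ`. -/
theorem SLP.InvertsOn.exists_runIn_T₂ {Γ : SLP k} (hΓ : Γ.InvertsOn τ (T₂ τ n)) (hn : 2 ≤ n)
    (hτ : τ ≠ 0) {ι : S →ₐ[k] Matrix (Fin 2) (Fin 2) k} (hinj : Function.Injective ι)
    (hι : ∀ x, IsUnit (ι x) → IsUnit x) (a b r e : Ω → S)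
    (h₁ : b * r = 1) (h₁' : r * b = 1)
    (h₂ : (a * r * a - a + τ • b) * e = 1) (h₂' : e * (a * r * a - a + τ • b) = 1) :
    ∃ t : List (Ω → S), RunIn Γ.code [a, b] t ∧
      t[Γ.out₁]? = some ((r * a - 1) * e) ∧ t[Γ.out₂]? = some (-e) := by
  obtain ⟨m, rfl⟩ := Nat.exists_eq_add_of_le hn
  refine hΓ.exists_runIn hinj hι (fun ω => (a ω, 0)) (fun ω => (b ω, 1))
    (fun ω => ((r ω * a ω - 1) * e ω, -(τ⁻¹ • 1))) (fun ω => (-e ω, -(τ⁻¹ • 1))) ?_ ?_ ?_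
  · intro ω
    rw [combine_mem_T₂]
    have e₁ := congrFun h₁ ω
    have e₁' := congrFun h₁' ω
    have e₂ := congrFun h₂ ω
    have e₂' := congrFun h₂' ω
    simp only [Pi.sub_apply, Pi.mul_apply, Pi.smul_apply, Pi.one_apply, Pi.add_apply]
      at e₁ e₁' e₂ e₂'
    have hu : IsUnit (b ω) := ⟨⟨_, _, e₁, e₁'⟩, rfl⟩
    have hu₂ : IsUnit (a ω * r ω * a ω - a ω + τ • b ω) := ⟨⟨_, _, e₂, e₂'⟩, rfl⟩
    have hinv : (blockHom ι m (b ω, 1))⁻¹ = blockHom ι m (r ω, 1) := by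
      apply Matrix.inv_eq_right_inv
      rw [← map_mul]
      simp [e₁, ← Prod.one_eq_mk]
    rw [hinv, ← map_mul, ← map_mul, ← map_smul, ← map_sub, ← map_add]
    refine ⟨IsUnit.map _ (Prod.isUnit_iff.2 ⟨hu, isUnit_one⟩),
      IsUnit.map _ (Prod.isUnit_iff.2 ⟨hu₂, ?_⟩)⟩
    simp only [Prod.mk_mul_mk, Prod.mk_sub_mk, Prod.smul_mk, Prod.mk_add_mk, mul_zero, zero_sub,
      neg_zero, zero_add]
    exact ⟨⟨τ • 1, τ⁻¹ • 1, by simp [hτ], by simp [hτ]⟩, rfl⟩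
  · funext ω
    have e₂ := congrFun h₂ ω
    simp only [Pi.mul_apply, Pi.smul_apply, Pi.one_apply, Pi.add_apply, Pi.sub_apply, add_mul,
      sub_mul, smul_mul_assoc, mul_assoc] at e₂
    refine Prod.ext ?_ ?_
    · simpa [mul_assoc, sub_mul, mul_sub] using e₂
    · simp [hτ]
  · funext ω
    have e₁ := congrArg (· * (a ω * e ω)) (congrFun h₁ ω)
    simp only [Pi.mul_apply, Pi.one_apply, mul_assoc, one_mul] at e₁
    refine Prod.ext ?_ ?_
    · simp [mul_assoc, sub_mul, mul_sub, e₁]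
      abel
    · simp

theorem tau_ne_zero (hf : Irreducible (quadPoly τ)) : τ ≠ 0 := by
  rintro rfl
  have h : quadPoly (0 : k) = Polynomial.X * (Polynomial.X + 1) := by
    simp [quadPoly]; ring
  rcases hf.isUnit_or_isUnit h with h' | h'
  · exact Polynomial.not_isUnit_X h'
  · have := Polynomial.natDegree_eq_zero_of_isUnit h'
    have h1 : (Polynomial.X + 1 : Polynomial k).natDegree = 1 := by compute_degree!
    omega

end Restrict

/-! ### Growth of the span of the registers. -/

section Reach

variable {k : Type*} [Field k] {R : Type*} [Ring R] [Algebra k R]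

/-- `Reach W₀ m W`: the submodule `W` arises from `W₀` by adjoining, `m` times in a row, a product
of two elements or the inverse of an element. -/
inductive Reach (W₀ : Submodule k R) : ℕ → Submodule k R → Prop
  | base : Reach W₀ 0 W₀
  | mul {m : ℕ} {W : Submodule k R} {x y : R} : Reach W₀ m W → x ∈ W → y ∈ W →
      Reach W₀ (m + 1) (W ⊔ Submodule.span k {x * y})
  | inv {m : ℕ} {W : Submodule k R} {x y : R} : Reach W₀ m W → x ∈ W → x * y = 1 → y * x = 1 →
      Reach W₀ (m + 1) (W ⊔ Submodule.span k {y})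

theorem Reach.le {W₀ W : Submodule k R} {m : ℕ} (h : Reach W₀ m W) : W₀ ≤ W := by
  induction h with
  | base => exact le_rfl
  | mul _ _ _ ih => exact ih.trans le_sup_left
  | inv _ _ _ _ ih => exact ih.trans le_sup_left

/-- Unused steps are filled with the product `1 * 1`. -/
theorem Reach.exists_ge {W₀ W : Submodule k R} {m m' : ℕ} (h : Reach W₀ m W) (h1 : 1 ∈ W₀)
    (hm : m ≤ m') : ∃ W', Reach W₀ m' W' ∧ W ≤ W' := by
  induction m', hm using Nat.le_induction with
  | base => exact ⟨W, h, le_rfl⟩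
  | succ m' _ ih =>
    obtain ⟨W', hW', hle⟩ := ih
    exact ⟨_, hW'.mul (hW'.le h1) (hW'.le h1), hle.trans le_sup_left⟩

/-- Constants, scalar multiples and sums stay in a subspace that contains 1, so only products and
inversions count as steps. -/
theorem RunIn.exists_reach {code : List (Instr k)} {s t : List R} (h : RunIn code s t)
    {W₀ W : Submodule k R} {m : ℕ} (hW : Reach W₀ m W) (h1 : 1 ∈ W₀) (hs : ∀ x ∈ s, x ∈ W) :
    ∃ W', Reach W₀ (m + (code.countP Instr.isInv + code.countP Instr.isMul)) W' ∧
      ∀ x ∈ t, x ∈ W' := by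
  induction h generalizing W m with
  | nil s => exact ⟨W, hW, hs⟩
  | @cons op ops s t x hx _ ih =>
    have key : ∀ {W' : Submodule k R}, W ≤ W' → x ∈ W' → ∀ y ∈ s ++ [x], y ∈ W' := by
      intro W' hle hxW y hy
      rcases List.mem_append.1 hy with hy | hy
      · exact hle (hs y hy)
      · rw [List.mem_singleton.1 hy]; exact hxW
    cases op with
    | const c =>
      have hx' : x = c • 1 := hx
      simpa [List.countP_cons, Instr.isInv, Instr.isMul] using
        ih hW (key le_rfl (hx' ▸ W.smul_mem c (hW.le h1)))
    | smul c i =>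
      obtain ⟨y, hy, rfl⟩ := hx
      simpa [List.countP_cons, Instr.isInv, Instr.isMul] using
        ih hW (key le_rfl (W.smul_mem c (hs y (List.mem_of_getElem? hy))))
    | add i j =>
      obtain ⟨y, z, hy, hz, rfl⟩ := hx
      simpa [List.countP_cons, Instr.isInv, Instr.isMul] using
        ih hW (key le_rfl (W.add_mem (hs y (List.mem_of_getElem? hy))
          (hs z (List.mem_of_getElem? hz))))
    | mul i j =>
      obtain ⟨y, z, hy, hz, rfl⟩ := hx
      obtain ⟨W', hW', ht⟩ := ih (hW.mul (hs y (List.mem_of_getElem? hy))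
          (hs z (List.mem_of_getElem? hz)))
          (key le_sup_left (Submodule.mem_sup_right (Submodule.mem_span_singleton_self _)))
      refine ⟨W', ?_, ht⟩
      convert hW' using 1
      simp [List.countP_cons, Instr.isInv, Instr.isMul]
      omega
    | inv i =>
      obtain ⟨y, hy, h₁, h₂⟩ := hx
      obtain ⟨W', hW', ht⟩ := ih (hW.inv (hs y (List.mem_of_getElem? hy)) h₁ h₂)
          (key le_sup_left (Submodule.mem_sup_right (Submodule.mem_span_singleton_self _)))
      refine ⟨W', ?_, ht⟩
      convert hW' using 1
      simp [List.countP_cons, Instr.isInv, Instr.isMul]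
      omega

theorem SLP.exists_reach {Γ : SLP k} {a b c d : R} {t : List R}
    (ht : RunIn Γ.code [a, b] t) (hc : t[Γ.out₁]? = some c) (hd : t[Γ.out₂]? = some d) :
    ∃ W, Reach (Submodule.span k {1, a, b}) Γ.cost W ∧ c ∈ W ∧ d ∈ W := by
  obtain ⟨W, hW, h⟩ := ht.exists_reach (Reach.base (W₀ := Submodule.span k {1, a, b}))
    (Submodule.subset_span (by simp)) (by
      intro x hx
      refine Submodule.subset_span ?_
      simp only [List.mem_cons, List.not_mem_nil, or_false] at hx
      rcases hx with rfl | rfl <;> simp)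
  refine ⟨W, ?_, h _ (List.mem_of_getElem? hc), h _ (List.mem_of_getElem? hd)⟩
  simpa [SLP.cost, SLP.numInv, SLP.numMul] using hW

/-- If `c` and `d` are reached in at most `m + 1` steps, a nontrivial combination of them is
reached in `m` steps. -/
theorem Reach.exists_smul_add_smul_mem {W₀ W : Submodule k R} {m m' : ℕ} (h : Reach W₀ m' W)
    (h1 : 1 ∈ W₀) (hm : m' ≤ m + 1) {c d : R} (hc : c ∈ W) (hd : d ∈ W) :
    ∃ (W' : Submodule k R) (α β : k), Reach W₀ m W' ∧ (α ≠ 0 ∨ β ≠ 0) ∧ α • c + β • d ∈ W' := by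
  obtain ⟨W₁, hW₁, hle⟩ := h.exists_ge h1 hm
  have key : ∃ (W' : Submodule k R) (z : R), Reach W₀ m W' ∧ W₁ = W' ⊔ Submodule.span k {z} := by
    cases hW₁ with
    | mul h' _ _ => exact ⟨_, _, h', rfl⟩
    | inv h' _ _ _ => exact ⟨_, _, h', rfl⟩
  obtain ⟨W', z, hW', rfl⟩ := key
  obtain ⟨w, hw, y, hy, rfl⟩ := Submodule.mem_sup.1 (hle hc)
  obtain ⟨w', hw', y', hy', rfl⟩ := Submodule.mem_sup.1 (hle hd)
  obtain ⟨p, rfl⟩ := Submodule.mem_span_singleton.1 hy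
  obtain ⟨q, rfl⟩ := Submodule.mem_span_singleton.1 hy'
  by_cases hp : p = 0
  · refine ⟨W', 1, 0, hW', Or.inl one_ne_zero, ?_⟩
    simpa [hp] using hw
  -- Elimination of the last adjoined `z` from `c = w + p z` and `d = w' + q z`.
  · refine ⟨W', -q, p, hW', Or.inr hp, ?_⟩
    have : -q • (w + p • z) + p • (w' + q • z) = -q • w + p • w' := by module
    have hz := W'.smul_mem p hw'
    rw [this]
    exact W'.add_mem (W'.smul_mem _ hw) hz

/-- `T` lies in the submodule obtained from `W` by adjoining one product or one inverse. -/
def StepMem (W : Submodule k R) (T : R) : Prop :=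
  (∃ w ∈ W, ∃ x ∈ W, ∃ y ∈ W, ∃ c : k, T = w + c • (x * y)) ∨
    ∃ w ∈ W, ∃ x ∈ W, ∃ (z : R) (c : k), x * z = 1 ∧ z * x = 1 ∧ T = w + c • z

/-- Monotonicity lets a reached subspace be replaced by a larger explicit one before the last step
is examined. -/
theorem StepMem.mono {W W' : Submodule k R} (h : W ≤ W') {T : R} (hT : StepMem W T) :
    StepMem W' T := by
  rcases hT with ⟨w, hw, x, hx, y, hy, hT⟩ | ⟨w, hw, x, hx, hT⟩
  · exact Or.inl ⟨w, h hw, x, h hx, y, h hy, hT⟩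
  · exact Or.inr ⟨w, h hw, x, h hx, hT⟩

theorem mem_sup_span_singleton {W : Submodule k R} {g z : R} :
    g ∈ W ⊔ Submodule.span k {z} ↔ ∃ w ∈ W, ∃ c : k, g = w + c • z := by
  simp only [Submodule.mem_sup, Submodule.mem_span_singleton]
  constructor
  · rintro ⟨w, hw, _, ⟨c, rfl⟩, rfl⟩
    exact ⟨w, hw, c, rfl⟩
  · rintro ⟨w, hw, c, rfl⟩
    exact ⟨w, hw, _, ⟨c, rfl⟩, rfl⟩

theorem Reach.exists_stepMem {W₀ W : Submodule k R} {m : ℕ} (h : Reach W₀ (m + 1) W) {T : R}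
    (hT : T ∈ W) : ∃ W', Reach W₀ m W' ∧ StepMem W' T := by
  cases h with
  | @mul _ W' x y h' hx hy =>
    obtain ⟨w, hw, c, rfl⟩ := mem_sup_span_singleton.1 hT
    exact ⟨W', h', Or.inl ⟨w, hw, x, hx, y, hy, c, rfl⟩⟩
  | @inv _ W' x y h' hx h₁ h₂ =>
    obtain ⟨w, hw, c, rfl⟩ := mem_sup_span_singleton.1 hT
    exact ⟨W', h', Or.inr ⟨w, hw, x, hx, y, c, h₁, h₂, rfl⟩⟩

end Reach

end FrobeniusInversion

end

noncomputable section

namespace FrobeniusInversion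

/-! ### Programs with at most one addition. -/

section Staged

variable {k : Type*} [Field k] {R : Type*} [Ring R] [Algebra k R]

/-- The predicate is stable under all instructions except additions. -/
structure StableWithoutAdd (k : Type*) [Field k] {R : Type*} [Ring R] [Algebra k R]
    (Q : R → Prop) : Prop where
  const (c : k) : Q (c • 1)
  mul {x y : R} : Q x → Q y → Q (x * y)
  inv {x y : R} : Q x → x * y = 1 → y * x = 1 → Q y

theorem ExecIn.of_stable {Q : R → Prop} (hQ : StableWithoutAdd k Q) {s : List R} {op : Instr k}
    {x : R} (h : ExecIn s op x) (hop : op.isAdd = false) (hs : ∀ y ∈ s, Q y) : Q x := by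
  cases op with
  | const c => have hx : x = c • 1 := h; exact hx ▸ hQ.const c
  | smul c i =>
    obtain ⟨y, hy, rfl⟩ := h
    have := hQ.mul (hQ.const c) (hs y (List.mem_of_getElem? hy))
    simpa using this
  | add i j => simp [Instr.isAdd] at hop
  | mul i j =>
    obtain ⟨y, z, hy, hz, rfl⟩ := h
    exact hQ.mul (hs y (List.mem_of_getElem? hy)) (hs z (List.mem_of_getElem? hz))
  | inv i =>
    obtain ⟨y, hy, h₁, h₂⟩ := h
    exact hQ.inv (hs y (List.mem_of_getElem? hy)) h₁ h₂

theorem RunIn.of_stable {Q : R → Prop} (hQ : StableWithoutAdd k Q) {code : List (Instr k)}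
    {s t : List R} (h : RunIn code s t) (hcode : code.countP Instr.isAdd = 0)
    (hs : ∀ y ∈ s, Q y) : ∀ y ∈ t, Q y := by
  induction h with
  | nil s => exact hs
  | @cons op ops s t x hx _ ih =>
    have hop : op.isAdd = false := by
      by_contra hc
      simp [List.countP_cons, hc] at hcode
    refine ih (by simpa [List.countP_cons, hop] using hcode) ?_
    intro y hy
    rcases List.mem_append.1 hy with hy | hy
    · exact hs y hy
    · rw [List.mem_singleton.1 hy]
      exact hx.of_stable hQ hop hs

/-- A program with at most one addition: the registers satisfy `Q₀` before the addition `x + y`,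
and `Q₁ (x + y)` after it. -/
theorem RunIn.of_stable_of_le_one {Q₀ : R → Prop} {Q₁ : R → R → Prop}
    (hQ₀ : StableWithoutAdd k Q₀) (hQ₁ : ∀ S, StableWithoutAdd k (Q₁ S))
    (hle : ∀ S z, Q₀ z → Q₁ S z) (hself : ∀ S, Q₁ S S) {code : List (Instr k)}
    {s t : List R} (h : RunIn code s t) (hcode : code.countP Instr.isAdd ≤ 1)
    (hs : ∀ y ∈ s, Q₀ y) : ∃ x y, Q₀ x ∧ Q₀ y ∧ ∀ z ∈ t, Q₁ (x + y) z := by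
  induction h with
  | nil s =>
    -- Without any addition, `0 + 0` plays the part of the sum.
    exact ⟨(0 : k) • 1, (0 : k) • 1, hQ₀.const 0, hQ₀.const 0, fun z hz => hle _ z (hs z hz)⟩
  | @cons op ops s t x hx hops ih =>
    by_cases hop : op.isAdd = true
    · cases op with
      | add i j =>
        obtain ⟨y, z, hy, hz, rfl⟩ := hx
        refine ⟨y, z, hs y (List.mem_of_getElem? hy), hs z (List.mem_of_getElem? hz), ?_⟩
        refine hops.of_stable (hQ₁ _) ?_ ?_
        · simp only [List.countP_cons, hop, if_true] at hcode
          omega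
        · intro v hv
          rcases List.mem_append.1 hv with hv | hv
          · exact hle _ _ (hs v hv)
          · rw [List.mem_singleton.1 hv]
            exact hself _
      | const c => simp [Instr.isAdd] at hop
      | smul c i => simp [Instr.isAdd] at hop
      | mul i j => simp [Instr.isAdd] at hop
      | inv i => simp [Instr.isAdd] at hop
    · refine ih (by simpa [List.countP_cons, hop] using hcode) ?_
      intro y hy
      rcases List.mem_append.1 hy with hy | hy
      · exact hs y hy
      · rw [List.mem_singleton.1 hy]
        exact hx.of_stable hQ₀ (by simpa using hop) hs

end Staged

/-! ### Two additions are needed on `T₂`. -/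

section AddT₂

variable {k : Type*} [Field k] {τ : k} {n : ℕ}

/-- The pairs `(A, B)` of `2 × 2` matrices with `A + ξ B ∈ T₂`. -/
abbrev PairT₂ (τ : k) : Type _ :=
  {p : Matrix (Fin 2) (Fin 2) k × Matrix (Fin 2) (Fin 2) k //
    IsUnit p.2 ∧ IsUnit (p.1 * p.2⁻¹ * p.1 - p.1 + τ • p.2)}

/-- Before the first addition on `T₂`: a register does not depend on `A` and is invertible, or it
vanishes for `A = 0`. -/
def PreAddT₂ (x : PairT₂ τ → Matrix (Fin 2) (Fin 2) k) : Prop :=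
  (IsUnit x ∧ ∀ ω ω' : PairT₂ τ, ω.1.2 = ω'.1.2 → x ω = x ω') ∨ ∀ ω : PairT₂ τ, ω.1.1 = 0 → x ω = 0

/-- After the addition with result `S` on `T₂`. -/
def PostAddT₂ (S x : PairT₂ τ → Matrix (Fin 2) (Fin 2) k) : Prop :=
  (IsUnit S → IsUnit x ∨ ∀ ω : PairT₂ τ, ω.1.1 = 0 → x ω = 0) ∧
  ∀ ω₀, ¬ IsUnit (S ω₀) → (∀ ω ω' : PairT₂ τ, ω.1.2 = ω'.1.2 → x ω = x ω') ∨
    (∀ ω : PairT₂ τ, ω.1.1 = 0 → x ω = 0) ∨ ¬ IsUnit (x ω₀)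

theorem not_isUnit_mul_left {x y : Matrix (Fin 2) (Fin 2) k} (h : ¬ IsUnit x) :
    ¬ IsUnit (x * y) := by
  rw [Matrix.isUnit_iff_isUnit_det] at h ⊢
  rw [Matrix.det_mul]
  exact fun h' => h (isUnit_of_mul_isUnit_left h')

theorem not_isUnit_mul_right {x y : Matrix (Fin 2) (Fin 2) k} (h : ¬ IsUnit y) :
    ¬ IsUnit (x * y) := by
  rw [Matrix.isUnit_iff_isUnit_det] at h ⊢
  rw [Matrix.det_mul]
  exact fun h' => h (isUnit_of_mul_isUnit_right h')

theorem isUnit_smul_one {R : Type*} [Ring R] [Algebra k R] {c : k} (hc : c ≠ 0) :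
    IsUnit (c • (1 : R)) :=
  ⟨⟨c • 1, c⁻¹ • 1, by simp [hc], by simp [hc]⟩, rfl⟩

theorem eq_of_mul_eq_one {R : Type*} [Ring R] {x y y' : R} (h : y * x = 1) (h' : x * y' = 1) :
    y = y' := by
  rw [← mul_one y, ← h', ← mul_assoc, h, one_mul]

/-- A function that vanishes for `A = 0` vanishes at `ω₀` and is not invertible; so only functions
of the first kind are ever inverted. -/
theorem preAddT₂_stable (ω₀ : PairT₂ τ) (hω₀ : ω₀.1.1 = 0) :
    StableWithoutAdd k (PreAddT₂ (τ := τ)) where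
  const c := by
    by_cases hc : c = 0
    · exact Or.inr fun ω _ => by simp [hc]
    · exact Or.inl ⟨isUnit_smul_one hc, fun _ _ _ => rfl⟩
  mul := by
    rintro x y (⟨hx, hx'⟩ | hx) (⟨hy, hy'⟩ | hy)
    · exact Or.inl ⟨hx.mul hy, fun ω ω' h => by simp [hx' ω ω' h, hy' ω ω' h]⟩
    · exact Or.inr fun ω h => by simp [hy ω h]
    · exact Or.inr fun ω h => by simp [hx ω h]
    · exact Or.inr fun ω h => by simp [hx ω h]
  inv := by
    rintro x y (⟨hx, hx'⟩ | hx) h₁ h₂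
    · refine Or.inl ⟨⟨⟨y, x, h₂, h₁⟩, rfl⟩, fun ω ω' h => ?_⟩
      have e₁ := congrFun h₂ ω
      have e₂ := congrFun h₁ ω'
      rw [Pi.mul_apply, Pi.one_apply] at e₁ e₂
      exact eq_of_mul_eq_one e₁ (hx' ω ω' h ▸ e₂)
    · have := congrFun h₁ ω₀
      simp [hx ω₀ hω₀] at this

theorem postAddT₂_stable (ω₀ : PairT₂ τ) (hω₀ : ω₀.1.1 = 0)
    (S : PairT₂ τ → Matrix (Fin 2) (Fin 2) k) : StableWithoutAdd k (PostAddT₂ S) where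
  const c := by
    refine ⟨fun _ => ?_, fun _ _ => Or.inl fun _ _ _ => rfl⟩
    by_cases hc : c = 0
    · exact Or.inr fun ω _ => by simp [hc]
    · exact Or.inl (isUnit_smul_one hc)
  mul := by
    rintro x y ⟨hx, hx'⟩ ⟨hy, hy'⟩
    constructor
    · intro hS
      rcases hx hS with hx | hx
      · rcases hy hS with hy | hy
        · exact Or.inl (hx.mul hy)
        · exact Or.inr fun ω h => by simp [hy ω h]
      · exact Or.inr fun ω h => by simp [hx ω h]
    · intro ω₁ hS
      rcases hx' ω₁ hS with hx | hx | hx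
      · rcases hy' ω₁ hS with hy | hy | hy
        · exact Or.inl fun ω ω' h => by simp [hx ω ω' h, hy ω ω' h]
        · exact Or.inr (Or.inl fun ω h => by simp [hy ω h])
        · exact Or.inr (Or.inr (not_isUnit_mul_right hy))
      · exact Or.inr (Or.inl fun ω h => by simp [hx ω h])
      · exact Or.inr (Or.inr (not_isUnit_mul_left hx))
  inv := by
    rintro x y ⟨hx, hx'⟩ h₁ h₂
    refine ⟨fun _ => Or.inl ⟨⟨y, x, h₂, h₁⟩, rfl⟩, fun ω₁ hS => ?_⟩
    rcases hx' ω₁ hS with hx | hx | hx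
    · refine Or.inl fun ω ω' h => ?_
      have e₁ := congrFun h₂ ω
      have e₂ := congrFun h₁ ω'
      rw [Pi.mul_apply, Pi.one_apply] at e₁ e₂
      exact eq_of_mul_eq_one e₁ (hx ω ω' h ▸ e₂)
    · have := congrFun h₁ ω₀
      simp [hx ω₀ hω₀] at this
    · exact absurd ⟨⟨x ω₁, y ω₁, congrFun h₁ ω₁, congrFun h₂ ω₁⟩, rfl⟩ hx

/-- A pair in `T₂` with `B = 1`, given by `A` and the inverse `E` of `A² - A + τ`. -/
def PairT₂.ofOne (A E : Matrix (Fin 2) (Fin 2) k) (h : (A * A - A + τ • 1) * E = 1) : PairT₂ τ :=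
  ⟨(A, 1), isUnit_one, by simpa using IsUnit.of_mul_eq_one E h⟩

/-- Let `N = A B⁻¹ A - A + τ B`, so that the outputs are `(B⁻¹ A - 1) N⁻¹` and `-N⁻¹`. The first is
singular at `A = B = 1` but nonzero at `A = 0`. The second is invertible everywhere and depends on
`A`. Whether or not the sum is a unit, one of them violates `PostAddT₂`. -/
theorem two_le_numAdd_of_invertsOn_T₂ (hτ : τ ≠ 0) (hn : 2 ≤ n) {Γ : SLP k}
    (hΓ : Γ.InvertsOn τ (T₂ τ n)) : 2 ≤ Γ.numAdd := by
  by_contra! hlt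
  let ω₀ : PairT₂ τ := .ofOne 0 (τ⁻¹ • 1) (by simp [hτ])
  let ω₁ : PairT₂ τ := .ofOne 1 (τ⁻¹ • 1) (by simp [hτ])
  -- `A` has square zero, so `N = τ - A` has inverse `τ⁻¹ + τ⁻² A`. This point and `ω₀` share `B =
  -- 1` but have different `N`.
  let ω₂ : PairT₂ τ := .ofOne !![0, 1; 0, 0] !![τ⁻¹, τ⁻¹ * τ⁻¹; 0, τ⁻¹] (by
    ext i j
    fin_cases i <;> fin_cases j <;> simp [Matrix.mul_apply, Fin.sum_univ_two, hτ])
  have : Nonempty (PairT₂ τ) := ⟨ω₀⟩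
  let N : PairT₂ τ → Matrix (Fin 2) (Fin 2) k :=
    fun ω => ω.1.1 * ω.1.2⁻¹ * ω.1.1 - ω.1.1 + τ • ω.1.2
  let E : PairT₂ τ → Matrix (Fin 2) (Fin 2) k := fun ω => (N ω)⁻¹
  have hNE : ∀ ω, N ω * E ω = 1 := fun ω =>
    Matrix.mul_nonsing_inv _ ((Matrix.isUnit_iff_isUnit_det _).1 ω.2.2)
  have hEN : ∀ ω, E ω * N ω = 1 := fun ω =>
    Matrix.nonsing_inv_mul _ ((Matrix.isUnit_iff_isUnit_det _).1 ω.2.2)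
  obtain ⟨t, ht, hC, hD⟩ := hΓ.exists_runIn_T₂ hn hτ (ι := AlgHom.id k _)
    Function.injective_id (fun _ h => h) (fun ω : PairT₂ τ => ω.1.1) (fun ω => ω.1.2)
    (fun ω => ω.1.2⁻¹) E
    (funext fun ω => Matrix.mul_nonsing_inv _ ((Matrix.isUnit_iff_isUnit_det _).1 ω.2.1))
    (funext fun ω => Matrix.nonsing_inv_mul _ ((Matrix.isUnit_iff_isUnit_det _).1 ω.2.1))
    (funext hNE) (funext hEN)
  obtain ⟨x, y, -, -, hQ⟩ := ht.of_stable_of_le_one (preAddT₂_stable ω₀ rfl)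
    (postAddT₂_stable ω₀ rfl)
    (by
      rintro S z (⟨hz, hz'⟩ | hz)
      · exact ⟨fun _ => Or.inl hz, fun _ _ => Or.inl hz'⟩
      · exact ⟨fun _ => Or.inr hz, fun _ _ => Or.inr (Or.inl hz)⟩)
    (fun S => ⟨Or.inl, fun _ h => Or.inr (Or.inr h)⟩) (Nat.le_of_lt_succ hlt) (by
      intro z hz
      simp only [List.mem_cons, List.not_mem_nil, or_false] at hz
      rcases hz with rfl | rfl
      · exact Or.inr fun ω h => h
      · exact Or.inl ⟨Pi.isUnit_iff.2 fun ω => ω.2.1, fun ω ω' h => h⟩)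
  have hE₀ : E ω₀ ≠ 0 := fun h => by simpa [h] using hNE ω₀
  by_cases hS : IsUnit (x + y)
  · rcases (hQ _ (List.mem_of_getElem? hC)).1 hS with h | h
    · have h₁ := Pi.isUnit_iff.1 h ω₁
      simp [ω₁, PairT₂.ofOne] at h₁
    · have h₀ := h ω₀ rfl
      apply hE₀
      simpa [ω₀, PairT₂.ofOne] using h₀
  -- The sum is singular at some point; the second output is now tested, since it is invertible
  -- there.
  · obtain ⟨ω, hω⟩ : ∃ ω, ¬ IsUnit ((x + y) ω) := by
      by_contra! h
      exact hS (Pi.isUnit_iff.2 h)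
    rcases (hQ _ (List.mem_of_getElem? hD)).2 ω hω with h | h | h
    · have hE : E ω₀ = E ω₂ := neg_injective (h ω₀ ω₂ rfl)
      have hN : N ω₀ = N ω₂ := eq_of_mul_eq_one (hNE ω₀) (hE ▸ hEN ω₂)
      have := congrFun (congrFun hN 0) 1
      simp [N, ω₀, ω₂, PairT₂.ofOne] at this
    · exact hE₀ (neg_eq_zero.1 (h ω₀ rfl))
    · exact h (IsUnit.neg ⟨⟨E ω, N ω, hEN ω, hNE ω⟩, rfl⟩)

end AddT₂

end FrobeniusInversion

end

noncomputable section

namespace FrobeniusInversion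

/-! ### Two additions are needed on `T₁`. -/

section AddT₁

variable {k : Type*} [Field k] {τ : k} {n : ℕ}

/-- The pairs `(A, B)` of `2 × 2` matrices with `A + ξ B ∈ T₁`. -/
abbrev PairT₁ (τ : k) : Type _ :=
  {p : Matrix (Fin 2) (Fin 2) k × Matrix (Fin 2) (Fin 2) k //
    IsUnit (p.1 - p.2) ∧ IsUnit (p.1 + τ • (p.2 * (p.1 - p.2)⁻¹ * p.2))}

/-- The matrix `A` as a function on `T₁`. -/
def fstT₁ : PairT₁ τ → Matrix (Fin 2) (Fin 2) k := fun ω => ω.1.1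

/-- The matrix `B` as a function on `T₁`. -/
def sndT₁ : PairT₁ τ → Matrix (Fin 2) (Fin 2) k := fun ω => ω.1.2

/-- Before the first addition on `T₁`: a register is a multiple of a power of `A` or of `B`, or it
vanishes whenever `A = 0` or `B = 0`. -/
def PreAddT₁ (x : PairT₁ τ → Matrix (Fin 2) (Fin 2) k) : Prop :=
  (∃ (α : k) (i : ℕ), x = α • fstT₁ ^ i) ∨ (∃ (α : k) (i : ℕ), x = α • sndT₁ ^ i) ∨
    ∀ ω : PairT₁ τ, ω.1.1 = 0 ∨ ω.1.2 = 0 → x ω = 0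

/-- After the addition with result `S` on `T₁`. -/
def PostAddT₁ (S x : PairT₁ τ → Matrix (Fin 2) (Fin 2) k) : Prop :=
  (∃ (c : k) (i : ℕ), x = c • S ^ i) ∨
    (∃ u : (PairT₁ τ → Matrix (Fin 2) (Fin 2) k)ˣ, ↑u = S ∧
      ∃ (c : k) (z : ℤ), x = c • ((u ^ z : _ˣ) : PairT₁ τ → Matrix (Fin 2) (Fin 2) k)) ∨
    (∀ ω : PairT₁ τ, ω.1.1 = 0 → x ω = 0) ∨ ∀ ω : PairT₁ τ, ω.1.2 = 0 → x ω = 0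

/-- A pair in `T₁`, given with a right inverse `R` of `A - B` and a right inverse `E` of
`A + τ B R B`. -/
def PairT₁.of (A B R E : Matrix (Fin 2) (Fin 2) k) (h : (A - B) * R = 1)
    (hE : (A + τ • (B * R * B)) * E = 1) : PairT₁ τ :=
  ⟨(A, B), .of_mul_eq_one R h, by
    rw [Matrix.inv_eq_right_inv h]; exact .of_mul_eq_one E hE⟩

/-- The pair `(A, 0)`, for `A` with right inverse `R`. -/
def PairT₁.ofZeroRight (A R : Matrix (Fin 2) (Fin 2) k) (h : A * R = 1) : PairT₁ τ :=
  .of A 0 R R (by simpa using h) (by simpa using h)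

/-- The pair `(0, B)`, for `B` with right inverse `R`. -/
def PairT₁.ofZeroLeft (hτ : τ ≠ 0) (B R : Matrix (Fin 2) (Fin 2) k) (h : B * R = 1) : PairT₁ τ :=
  .of 0 B (-R) (-(τ⁻¹ • R)) (by simpa using h) (by simp [h, hτ])

theorem smul_inv_of_mul_eq_one {R : Type*} [Ring R] [Algebra k R] [Nontrivial R] {c : k}
    {u : Rˣ} {y : R} (h : (c • (u : R)) * y = 1) : y = c⁻¹ • ((u⁻¹ : Rˣ) : R) := by
  have hc : c ≠ 0 := by
    rintro rfl
    simp at h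
  have : (c⁻¹ • ((u⁻¹ : Rˣ) : R)) * (c • (u : R)) = 1 := by simp [hc]
  exact (eq_of_mul_eq_one this h).symm

theorem smul_pow_mul_smul_pow {R : Type*} [Ring R] [Algebra k R] (c d : k) (x : R) (i j : ℕ) :
    (c • x ^ i) * (d • x ^ j) = (c * d) • x ^ (i + j) := by
  rw [smul_mul_smul_comm, pow_add]

/-- A product of positive powers of `A` and `B` vanishes as soon as one of them does. Positive
powers are never inverted: `A` vanishes at `ω₀` and `B` at `ω₁`. -/
theorem preAddT₁_stable (ω₀ ω₁ : PairT₁ τ) (hω₀ : ω₀.1.1 = 0) (hω₁ : ω₁.1.2 = 0) :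
    StableWithoutAdd k (PreAddT₁ (τ := τ)) where
  const c := Or.inl ⟨c, 0, by simp⟩
  mul := by
    have key : ∀ (α β : k) (i j : ℕ), PreAddT₁ (τ := τ) ((α • fstT₁ ^ i) * (β • sndT₁ ^ j)) ∧
        PreAddT₁ (τ := τ) ((β • sndT₁ ^ j) * (α • fstT₁ ^ i)) := by
      intro α β i j
      rcases Nat.eq_zero_or_pos i with rfl | hi
      · exact ⟨Or.inr (Or.inl ⟨α * β, j, by rw [smul_mul_smul_comm, pow_zero, one_mul]⟩),
          Or.inr (Or.inl ⟨β * α, j, by rw [smul_mul_smul_comm, pow_zero, mul_one]⟩)⟩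
      rcases Nat.eq_zero_or_pos j with rfl | hj
      · exact ⟨Or.inl ⟨α * β, i, by rw [smul_mul_smul_comm, pow_zero, mul_one]⟩,
          Or.inl ⟨β * α, i, by rw [smul_mul_smul_comm, pow_zero, one_mul]⟩⟩
      · constructor <;>
        · refine Or.inr (Or.inr fun ω h => ?_)
          rcases h with h | h
          · simp [fstT₁, h, zero_pow hi.ne']
          · simp [sndT₁, h, zero_pow hj.ne']
    rintro x y (⟨α, i, rfl⟩ | ⟨α, i, rfl⟩ | hx) (⟨β, j, rfl⟩ | ⟨β, j, rfl⟩ | hy)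
    · exact Or.inl ⟨α * β, i + j, smul_pow_mul_smul_pow _ _ _ _ _⟩
    · exact (key α β i j).1
    · exact Or.inr (Or.inr fun ω h => by simp [hy ω h])
    · exact (key β α j i).2
    · exact Or.inr (Or.inl ⟨α * β, i + j, smul_pow_mul_smul_pow _ _ _ _ _⟩)
    · exact Or.inr (Or.inr fun ω h => by simp [hy ω h])
    all_goals exact Or.inr (Or.inr fun ω h => by simp [hx ω h])
  inv := by
    have : Nonempty (PairT₁ τ) := ⟨ω₀⟩
    have key : ∀ (α : k) (y : PairT₁ τ → Matrix (Fin 2) (Fin 2) k), (α • 1) * y = 1 →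
        PreAddT₁ y := by
      intro α y h
      have := smul_inv_of_mul_eq_one (u := 1) (by simpa using h)
      exact Or.inl ⟨α⁻¹, 0, by simpa using this⟩
    rintro x y (⟨α, i, rfl⟩ | ⟨α, i, rfl⟩ | hx) h₁ -
    · rcases Nat.eq_zero_or_pos i with rfl | hi
      · exact key α y (by simpa using h₁)
      · have := congrFun h₁ ω₀
        simp [fstT₁, hω₀, zero_pow hi.ne'] at this
    · rcases Nat.eq_zero_or_pos i with rfl | hi
      · exact key α y (by simpa using h₁)
      · have := congrFun h₁ ω₁
        simp [sndT₁, hω₁, zero_pow hi.ne'] at this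
    · have := congrFun h₁ ω₀
      simp [hx ω₀ (Or.inl hω₀)] at this

/-- Inverting `c • S ^ i` with `i > 0` makes `S` a unit, after which integer powers are available.
Functions vanishing for `A = 0` or for `B = 0` are not invertible, because of `ω₀` and `ω₁`. -/
theorem postAddT₁_stable (ω₀ ω₁ : PairT₁ τ) (hω₀ : ω₀.1.1 = 0) (hω₁ : ω₁.1.2 = 0)
    (S : PairT₁ τ → Matrix (Fin 2) (Fin 2) k) : StableWithoutAdd k (PostAddT₁ S) where
  const c := Or.inl ⟨c, 0, by simp⟩
  mul := by
    rintro x y hx hy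
    rcases hx with hx | hx | hx | hx
    rotate_left 2
    · exact Or.inr (Or.inr (Or.inl fun ω h => by simp [hx ω h]))
    · exact Or.inr (Or.inr (Or.inr fun ω h => by simp [hx ω h]))
    all_goals rcases hy with hy | hy | hy | hy
    rotate_left 2
    · exact Or.inr (Or.inr (Or.inl fun ω h => by simp [hy ω h]))
    · exact Or.inr (Or.inr (Or.inr fun ω h => by simp [hy ω h]))
    rotate_left 2
    · exact Or.inr (Or.inr (Or.inl fun ω h => by simp [hy ω h]))
    · exact Or.inr (Or.inr (Or.inr fun ω h => by simp [hy ω h]))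
    · obtain ⟨c, i, rfl⟩ := hx
      obtain ⟨d, j, rfl⟩ := hy
      exact Or.inl ⟨c * d, i + j, smul_pow_mul_smul_pow _ _ _ _ _⟩
    · obtain ⟨c, i, rfl⟩ := hx
      obtain ⟨u, rfl, d, z, rfl⟩ := hy
      exact Or.inr (Or.inl ⟨u, rfl, c * d, i + z, by
        simp [zpow_add, smul_smul, mul_comm]⟩)
    · obtain ⟨u, rfl, c, z, rfl⟩ := hx
      obtain ⟨d, j, rfl⟩ := hy
      exact Or.inr (Or.inl ⟨u, rfl, c * d, z + j, by
        simp [zpow_add, smul_smul, mul_comm]⟩)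
    · obtain ⟨u, rfl, c, z, rfl⟩ := hx
      obtain ⟨v, hv, d, z', rfl⟩ := hy
      obtain rfl := Units.ext hv
      exact Or.inr (Or.inl ⟨v, rfl, c * d, z + z', by
        simp [zpow_add, smul_smul, mul_comm]⟩)
  inv := by
    have : Nonempty (PairT₁ τ) := ⟨ω₀⟩
    rintro x y (⟨c, i, rfl⟩ | ⟨u, hu, c, z, rfl⟩ | hx | hx) h₁ h₂
    · rcases Nat.eq_zero_or_pos i with rfl | hi
      · have := smul_inv_of_mul_eq_one (u := 1) (by simpa using h₁)
        exact Or.inl ⟨c⁻¹, 0, by simpa using this⟩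
      · have hunit : IsUnit (S ^ i) := by
          refine ⟨⟨S ^ i, c • y, ?_, ?_⟩, rfl⟩
          · simpa using h₁
          · simpa using h₂
        obtain ⟨u, rfl⟩ := (isUnit_pow_iff hi.ne').1 hunit
        have := smul_inv_of_mul_eq_one (u := u ^ i) (by simpa using h₁)
        exact Or.inr (Or.inl ⟨u, rfl, c⁻¹, -i, by simpa using this⟩)
    · have := smul_inv_of_mul_eq_one h₁
      exact Or.inr (Or.inl ⟨u, hu, c⁻¹, -z, by simpa using this⟩)
    · have := congrFun h₁ ω₀
      simp [hx ω₀ hω₀] at this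
    · have := congrFun h₁ ω₁
      simp [hx ω₁ hω₁] at this

/-- The first output `E = N⁻¹`, with `N = A + τ B (A - B)⁻¹ B`, is invertible everywhere and not
constant, so `PostAddT₁` makes it `c • S ^ z` for the sum `S`. As `E` separates two points with `B =
0` and two with `A = 0`, so does `S`, which forces `S = α A ^ i + β B ^ j` with `i, j > 0`. A point
with nilpotent `A` and `B` gives `i = j = 1`, and the parity of `z` leads to a contradiction. -/
theorem two_le_numAdd_of_invertsOn_T₁ [CharP k 2] (hτ : τ ≠ 0) (hn : 2 ≤ n) {Γ : SLP k}
    (hΓ : Γ.InvertsOn τ (T₁ τ n)) : 2 ≤ Γ.numAdd := by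
  by_contra! hlt
  have h2 : (1 : k) + 1 = 0 := CharTwo.add_self_eq_zero 1
  let v : Matrix (Fin 2) (Fin 2) k := !![0, 1; 0, 0]
  let w : Matrix (Fin 2) (Fin 2) k := !![1, 1; 0, 1]
  have hww : w * w = 1 := by
    ext i j
    fin_cases i <;> fin_cases j <;> simp [w, Matrix.mul_apply, Fin.sum_univ_two, h2]
  have hw1 : w ≠ 1 := fun h => by simpa [w] using congrFun (congrFun h 0) 1
  have hwv : w - v = 1 := by
    ext i j
    fin_cases i <;> fin_cases j <;> simp [w, v]
  have hvv : v * v = 0 := by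
    ext i j
    fin_cases i <;> fin_cases j <;> simp [v, Matrix.mul_apply, Fin.sum_univ_two]
  -- `p₁`, `p₂` have `B = 0` and `q₁`, `q₂` have `A = 0`, the other matrix being 1 or the involution
  -- `w`. At `g` one has `A = w`, `B = v`, and `v² = 0` gives `N = w` as at `p₂`. At `m` both `A`
  -- and `B` have square zero, yet the pair lies in `T₁`.
  let p₁ : PairT₁ τ := .ofZeroRight 1 1 (one_mul 1)
  let p₂ : PairT₁ τ := .ofZeroRight w w hww
  let q₁ : PairT₁ τ := .ofZeroLeft hτ 1 1 (one_mul 1)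
  let q₂ : PairT₁ τ := .ofZeroLeft hτ w w hww
  let g : PairT₁ τ := .of w v 1 w (by rw [hwv, one_mul]) (by rw [mul_one, hvv, smul_zero,
    add_zero, hww])
  let m : PairT₁ τ := .of v !![0, 0; 1, 0] !![0, -1; 1, 0] !![0, -τ⁻¹; 1, 0]
    (by
      ext i j
      fin_cases i <;> fin_cases j <;> simp [v, Matrix.mul_apply, Fin.sum_univ_two])
    (by
      ext i j
      fin_cases i <;> fin_cases j <;> simp [v, Matrix.mul_apply, Fin.sum_univ_two, hτ])
  have : Nonempty (PairT₁ τ) := ⟨p₁⟩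
  let N : PairT₁ τ → Matrix (Fin 2) (Fin 2) k :=
    fun ω => ω.1.1 + τ • (ω.1.2 * (ω.1.1 - ω.1.2)⁻¹ * ω.1.2)
  let E : PairT₁ τ → Matrix (Fin 2) (Fin 2) k := fun ω => (N ω)⁻¹
  have hNE : ∀ ω, N ω * E ω = 1 := fun ω =>
    Matrix.mul_nonsing_inv _ ((Matrix.isUnit_iff_isUnit_det _).1 ω.2.2)
  have hEN : ∀ ω, E ω * N ω = 1 := fun ω =>
    Matrix.nonsing_inv_mul _ ((Matrix.isUnit_iff_isUnit_det _).1 ω.2.2)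
  have hE0 : ∀ ω, E ω ≠ 0 := fun ω h => by simpa [h] using hNE ω
  have hN : ∀ ω ω', E ω = E ω' → N ω = N ω' := fun ω ω' h =>
    eq_of_mul_eq_one (hNE ω) (h ▸ hEN ω')
  have hNp₁ : N p₁ = 1 := by simp [N, p₁, PairT₁.ofZeroRight, PairT₁.of]
  have hNp₂ : N p₂ = w := by simp [N, p₂, PairT₁.ofZeroRight, PairT₁.of]
  have hNg : N g = w := by
    simp [N, g, PairT₁.of, hwv, hvv]
  have hEp : E p₁ ≠ E p₂ := fun h => hw1 (by rw [← hNp₁, ← hNp₂, hN _ _ h])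
  have hEq : E q₁ ≠ E q₂ := by
    intro h
    have hq₁ : N q₁ = -τ • 1 := by
      have : (-1 : Matrix (Fin 2) (Fin 2) k)⁻¹ = -1 := Matrix.inv_eq_right_inv (by simp)
      simp [N, q₁, PairT₁.ofZeroLeft, PairT₁.of, this]
    have hq₂ : N q₂ = -τ • w := by
      have : (-w)⁻¹ = -w := Matrix.inv_eq_right_inv (by simpa using hww)
      simp [N, q₂, PairT₁.ofZeroLeft, PairT₁.of, this, hww]
    have := hN _ _ h
    rw [hq₁, hq₂] at this
    exact hw1 (smul_right_injective _ (neg_ne_zero.2 hτ) this).symm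
  have hEg : E p₂ = E g := by simp only [E, hNp₂, hNg]
  obtain ⟨t, ht, hC, -⟩ := hΓ.exists_runIn_T₁ hn (ι := AlgHom.id k _)
    Function.injective_id (fun _ h => h) (fstT₁ (τ := τ)) sndT₁ (fun ω => (ω.1.1 - ω.1.2)⁻¹) E
    (funext fun ω => Matrix.mul_nonsing_inv _ ((Matrix.isUnit_iff_isUnit_det _).1 ω.2.1))
    (funext fun ω => Matrix.nonsing_inv_mul _ ((Matrix.isUnit_iff_isUnit_det _).1 ω.2.1))
    (funext hNE) (funext hEN)
  obtain ⟨x, y, hx, hy, hQ⟩ := ht.of_stable_of_le_one (preAddT₁_stable q₁ p₁ rfl rfl)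
    (postAddT₁_stable q₁ p₁ rfl rfl)
    (by
      rintro S z (⟨α, i, rfl⟩ | ⟨α, i, rfl⟩ | hz)
      · rcases Nat.eq_zero_or_pos i with rfl | hi
        · exact Or.inl ⟨α, 0, by simp only [pow_zero]⟩
        · exact Or.inr (Or.inr (Or.inl fun ω h => by simp [fstT₁, h, zero_pow hi.ne']))
      · rcases Nat.eq_zero_or_pos i with rfl | hi
        · exact Or.inl ⟨α, 0, by simp only [pow_zero]⟩
        · exact Or.inr (Or.inr (Or.inr fun ω h => by simp [sndT₁, h, zero_pow hi.ne']))
      · exact Or.inr (Or.inr (Or.inl fun ω h => hz ω (Or.inl h))))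
    (fun S => Or.inl ⟨1, 1, by rw [one_smul, pow_one]⟩) (Nat.le_of_lt_succ hlt) (by
      intro z hz
      simp only [List.mem_cons, List.not_mem_nil, or_false] at hz
      rcases hz with rfl | rfl
      · exact Or.inl ⟨1, 1, by rw [one_smul, pow_one]⟩
      · exact Or.inr (Or.inl ⟨1, 1, by rw [one_smul, pow_one]⟩))
  -- the first output is a multiple of a power of the unit `x + y`
  obtain ⟨u, hu, c, z, hE⟩ : ∃ u : (PairT₁ τ → Matrix (Fin 2) (Fin 2) k)ˣ, ↑u = x + y ∧
      ∃ (c : k) (z : ℤ), E = c • ((u ^ z : _ˣ) : PairT₁ τ → Matrix (Fin 2) (Fin 2) k) := by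
    rcases hQ _ (List.mem_of_getElem? hC) with ⟨c, i, h⟩ | h | h | h
    · rcases Nat.eq_zero_or_pos i with rfl | hi
      · rw [pow_zero] at h
        exact absurd (by rw [h]; rfl) hEp
      · have hunit : IsUnit ((x + y) ^ i) := by
          refine ⟨⟨(x + y) ^ i, c • N, ?_, ?_⟩, rfl⟩
          · rw [mul_smul_comm, ← smul_mul_assoc, ← h]; exact funext hEN
          · rw [smul_mul_assoc, ← mul_smul_comm, ← h]; exact funext hNE
        obtain ⟨u, hu⟩ := (isUnit_pow_iff hi.ne').1 hunit
        exact ⟨u, hu, c, i, by rw [h, ← hu, zpow_natCast, Units.val_pow_eq_pow_val]⟩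
    · exact h
    · exact absurd (h q₁ rfl) (hE0 _)
    · exact absurd (h p₁ rfl) (hE0 _)
  let ev : PairT₁ τ → (Matrix (Fin 2) (Fin 2) k)ˣ := fun ω =>
    Units.map (Pi.evalMonoidHom (fun _ => Matrix (Fin 2) (Fin 2) k) ω) u
  have hev : ∀ ω, ((ev ω : (Matrix (Fin 2) (Fin 2) k)ˣ) : Matrix (Fin 2) (Fin 2) k) =
      x ω + y ω := fun ω => congrFun hu ω
  have hEev : ∀ ω, E ω = c • ((ev ω ^ z : _ˣ) : Matrix (Fin 2) (Fin 2) k) := by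
    intro ω
    rw [← map_zpow]
    exact congrFun hE ω
  have hc : c ≠ 0 := by
    rintro rfl
    exact hE0 p₁ (by rw [hEev, zero_smul])
  have hSp : x p₁ + y p₁ ≠ x p₂ + y p₂ := fun h => hEp (by
    rw [hEev, hEev, show ev p₁ = ev p₂ from Units.ext (by rw [hev, hev, h])])
  have hSq : x q₁ + y q₁ ≠ x q₂ + y q₂ := fun h => hEq (by
    rw [hEev, hEev, show ev q₁ = ev q₂ from Units.ext (by rw [hev, hev, h])])
  have main : ∀ (α β : k) (i j : ℕ), x + y = α • fstT₁ ^ i + β • sndT₁ ^ j → False := by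
    intro α β i j h
    have hval : ∀ ω : PairT₁ τ, x ω + y ω = α • ω.1.1 ^ i + β • ω.1.2 ^ j :=
      fun ω => congrFun h ω
    have hi : i ≠ 0 := by
      rintro rfl
      exact hSp (by rw [hval, hval, pow_zero, pow_zero]; rfl)
    have hj : j ≠ 0 := by
      rintro rfl
      exact hSq (by rw [hval, hval, pow_zero, pow_zero]; rfl)
    -- At `m` an exponent of at least two kills its term and leaves a singular matrix.
    have hunit : IsUnit (α • v ^ i + β • !![0, 0; 1, 0] ^ j) := by
      have := hval m
      exact this ▸ hev m ▸ (ev m).isUnit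
    have hv : ∀ l, 2 ≤ l → v ^ l = 0 := fun l hl => by
      rw [← Nat.sub_add_cancel hl, pow_add, pow_two, hvv, mul_zero]
    have hv' : ∀ l, 2 ≤ l → (!![0, 0; 1, 0] : Matrix (Fin 2) (Fin 2) k) ^ l = 0 := fun l hl => by
      have : (!![0, 0; 1, 0] : Matrix (Fin 2) (Fin 2) k) * !![0, 0; 1, 0] = 0 := by
        ext i j
        fin_cases i <;> fin_cases j <;> simp [Matrix.mul_apply, Fin.sum_univ_two]
      rw [← Nat.sub_add_cancel hl, pow_add, pow_two, this, mul_zero]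
    have hi1 : i = 1 := by
      by_contra hne
      rw [hv i (by omega), smul_zero, zero_add, Matrix.isUnit_iff_isUnit_det, Matrix.det_smul,
        Matrix.det_pow] at hunit
      simp [Matrix.det_fin_two, zero_pow hj] at hunit
    have hj1 : j = 1 := by
      by_contra hne
      rw [hv' j (by omega), smul_zero, add_zero, Matrix.isUnit_iff_isUnit_det, Matrix.det_smul,
        Matrix.det_pow] at hunit
      simp [v, Matrix.det_fin_two, zero_pow hi] at hunit
    subst hi1 hj1
    simp only [pow_one] at hval
    have hp₁ : (ev p₁ : Matrix (Fin 2) (Fin 2) k) = α • 1 + β • 0 := (hev p₁).trans (hval p₁)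
    have hp₂ : (ev p₂ : Matrix (Fin 2) (Fin 2) k) = α • w + β • 0 := (hev p₂).trans (hval p₂)
    have hq₁ : (ev q₁ : Matrix (Fin 2) (Fin 2) k) = α • 0 + β • 1 := (hev q₁).trans (hval q₁)
    have hg : (ev g : Matrix (Fin 2) (Fin 2) k) = α • w + β • v := (hev g).trans (hval g)
    have hβ : β ≠ 0 := by
      rintro rfl
      have := (ev q₁).isUnit
      rw [hq₁] at this
      simp at this
    have hsq₁ : ev p₁ * ev p₁ = ev p₂ * ev p₂ := by
      apply Units.ext
      rw [Units.val_mul, Units.val_mul, hp₁, hp₂]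
      simp [hww]
    have hsq₂ : ev p₂ * ev p₂ = ev g * ev g := by
      apply Units.ext
      -- `(αw + βv)² = α² + αβ(wv + vw)`, and `wv + vw = 2v = 0` in characteristic two.
      have h2' : ∀ r s : k, r * s + s * r = 0 := fun r s => by
        rw [mul_comm s r]; exact CharTwo.add_self_eq_zero _
      rw [Units.val_mul, Units.val_mul, hp₂, hg]
      ext i j
      fin_cases i <;> fin_cases j <;>
        simp [w, v, Matrix.mul_apply, Fin.sum_univ_two, mul_add, add_mul, ← add_assoc]
      linear_combination -h2' α β
    have hpow : ∀ (a b : (Matrix (Fin 2) (Fin 2) k)ˣ), a * a = b * b → ∀ l : ℤ,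
        a ^ (l + l) = b ^ (l + l) := by
      intro a b hab l
      rw [← two_mul, zpow_mul, zpow_mul, zpow_two, zpow_two, hab]
    -- The squares of `S` agree at `p₁`, `p₂` and `g`. For even `z` this gives `E p₁ = E p₂`. For
    -- odd `z`, `E p₂ = E g` gives `S p₂ = S g`, that is `βv = 0`.
    rcases Int.even_or_odd' z with ⟨l, rfl | rfl⟩
    · refine hEp ?_
      rw [hEev, hEev, two_mul, hpow _ _ hsq₁]
    · have h' : ev p₂ ^ (2 * l + 1) = ev g ^ (2 * l + 1) := by
        apply Units.ext
        refine smul_right_injective _ hc ?_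
        change c • _ = c • _
        rw [← hEev, ← hEev, hEg]
      rw [zpow_add_one, zpow_add_one, two_mul, hpow _ _ hsq₂, mul_right_inj] at h'
      have h'' := congrArg Units.val h'
      rw [hp₂, hg] at h''
      have := congrFun (congrFun h'' 0) 1
      simp [v, w] at this
      exact hβ this
  have hconst : ∀ {x : PairT₁ τ → Matrix (Fin 2) (Fin 2) k},
      (∀ ω : PairT₁ τ, ω.1.1 = 0 ∨ ω.1.2 = 0 → x ω = 0) → x p₁ = x p₂ ∧ x q₁ = x q₂ := by
    intro x h
    exact ⟨by rw [h p₁ (Or.inr rfl), h p₂ (Or.inr rfl)],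
      by rw [h q₁ (Or.inl rfl), h q₂ (Or.inl rfl)]⟩
  -- Unless one summand is a multiple of a power of `A` and the other of a power of `B`, the sum
  -- fails to separate `p₁` from `p₂` or `q₁` from `q₂`.
  rcases hx with ⟨α, i, rfl⟩ | ⟨α, i, rfl⟩ | hx <;> rcases hy with ⟨β, j, rfl⟩ | ⟨β, j, rfl⟩ | hy
  · exact hSq rfl
  · exact main α β i j rfl
  · exact hSq (by rw [(hconst hy).2]; rfl)
  · exact main β α j i (add_comm _ _)
  · exact hSp rfl
  · exact hSp (by rw [(hconst hy).1]; rfl)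
  · exact hSq (by rw [(hconst hx).2]; rfl)
  · exact hSp (by rw [(hconst hx).1]; rfl)
  · exact hSp (by rw [(hconst hx).1, (hconst hy).1])

end AddT₁

end FrobeniusInversion

end

noncomputable section

namespace FrobeniusInversion

/-! ### The inverse at points of `K` and its poles. -/

section FieldPoints

open Polynomial

variable {k : Type*} [Field k] {K : Type*} [Field K] [Algebra k K]

/-- The pairs `(v, x)` in `K` with `v² - v + τ ≠ 0` and `x ≠ 0`; they stand for `A = v x` and
`B = x`. -/
abbrev FieldPoint (τ : k) (K : Type*) [Field K] [Algebra k K] : Type _ :=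
  {p : K × K // p.1 * p.1 - p.1 + algebraMap k K τ ≠ 0 ∧ p.2 ≠ 0}

variable {τ : k}

/-- The polynomial `X² - X + τ` over `K`. -/
def normPoly (τ : k) (K : Type*) [Field K] [Algebra k K] : K[X] :=
  X * X - X + C (algebraMap k K τ)

theorem normPoly_eval (v : K) :
    (normPoly τ K).eval v = v * v - v + algebraMap k K τ := by
  simp [normPoly]

theorem natDegree_normPoly : (normPoly τ K).natDegree = 2 := by
  unfold normPoly
  compute_degree!

theorem normPoly_ne_zero : normPoly τ K ≠ 0 := by
  intro h
  have := natDegree_normPoly (τ := τ) (K := K)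
  simp [h] at this

/-- The hypotheses on `K`: it has at least sixteen elements, and `θ` is a root of `X² - X + τ` which
is linearly independent of `1` over `k`. -/
structure QuadRoot (τ : k) (K : Type*) [Field K] [Algebra k K] (θ : K) : Prop where
  root : θ * θ - θ + algebraMap k K τ = 0
  indep : ∀ x y : k, algebraMap k K x + algebraMap k K y * θ = 0 → x = 0 ∧ y = 0
  card : ∃ s : Finset K, 16 ≤ s.card

variable {θ : K}

/-- Multiplication by `normPoly` also covers the excluded values of `v`; the degree is then at most
`13 + 2 < 16`. -/
theorem QuadRoot.eq_zero_of_eval (hθ : QuadRoot τ K θ) {G : K[X]} (hdeg : G.natDegree ≤ 13)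
    (h : ∀ v : K, v * v - v + algebraMap k K τ ≠ 0 → G.eval v = 0) : G = 0 := by
  obtain ⟨s, hs⟩ := hθ.card
  have h0 : G * normPoly τ K = 0 := by
    refine eq_zero_of_natDegree_lt_card_of_eval_eq_zero' _ s ?_ ?_
    · intro v _
      rw [eval_mul, normPoly_eval]
      by_cases hv : v * v - v + algebraMap k K τ = 0
      · rw [hv, mul_zero]
      · rw [h v hv, zero_mul]
    · have := natDegree_mul_le (p := G) (q := normPoly τ K)
      rw [natDegree_normPoly] at this
      omega
  exact (mul_eq_zero.1 h0).resolve_right normPoly_ne_zero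

theorem QuadRoot.eq_zero_of_eval_ne_zero (hθ : QuadRoot τ K θ) {G : K[X]}
    (hdeg : G.natDegree ≤ 13) (h : ∀ x : K, x ≠ 0 → G.eval x = 0) : G = 0 := by
  obtain ⟨s, hs⟩ := hθ.card
  have h0 : G * X = 0 := by
    refine eq_zero_of_natDegree_lt_card_of_eval_eq_zero' _ s ?_ ?_
    · intro v _
      rw [eval_mul, eval_X]
      by_cases hv : v = 0
      · rw [hv, mul_zero]
      · rw [h v hv, zero_mul]
    · have := natDegree_mul_le (p := G) (q := X)
      rw [natDegree_X] at this
      omega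
  exact (mul_eq_zero.1 h0).resolve_right X_ne_zero

/-- The roots `θ` and `1 - θ` lie outside `k`. Hence every `v` in `k` is admissible, which is what
prevents forms that involve `v` from being invertible. -/
theorem QuadRoot.algebraMap_ne (hθ : QuadRoot τ K θ) (v : k) :
    algebraMap k K v * algebraMap k K v - algebraMap k K v + algebraMap k K τ ≠ 0 := by
  intro h
  have h' : (θ - algebraMap k K v) * (θ - (1 - algebraMap k K v)) = 0 := by
    linear_combination hθ.root - h
  rcases mul_eq_zero.1 h' with h' | h'
  · have := hθ.indep (-v) 1 (by rw [map_neg, map_one]; linear_combination h')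
    exact one_ne_zero this.2
  · have := hθ.indep (v - 1) 1 (by rw [map_sub, map_one]; linear_combination h')
    exact one_ne_zero this.2

theorem QuadRoot.root' (hθ : QuadRoot τ K θ) :
    (1 - θ) * (1 - θ) - (1 - θ) + algebraMap k K τ = 0 := by
  linear_combination hθ.root

theorem QuadRoot.ne (hθ : QuadRoot τ K θ) : θ ≠ 1 - θ := by
  intro h
  have := hθ.indep 1 (-2) (by rw [map_neg, map_one, map_ofNat]; linear_combination -h)
  exact one_ne_zero this.1

/-- The numerator of `fieldT` cancels neither pole, since `1` and `θ` are independent over `k`. -/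
theorem QuadRoot.linear_ne (hθ : QuadRoot τ K θ) {α β : k} (h : α ≠ 0 ∨ β ≠ 0) :
    algebraMap k K α * θ + algebraMap k K β ≠ 0 ∧
      algebraMap k K α * (1 - θ) + algebraMap k K β ≠ 0 := by
  constructor
  · intro h0
    have := hθ.indep β α (by linear_combination h0)
    tauto
  · intro h0
    have := hθ.indep (β + α) (-α) (by rw [map_add, map_neg]; linear_combination h0)
    have h1 : α = 0 := neg_eq_zero.1 this.2
    have h2 : β = 0 := by simpa [h1] using this.1
    tauto

/-- The functions on the points that are, for every `x`, polynomials in `v` of degree at most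
`d`. -/
def polyFun (τ : k) (K : Type*) [Field K] [Algebra k K] (d : ℕ) :
    Submodule k (FieldPoint τ K → K) where
  carrier := {g | ∃ P : K → K[X], (∀ x, (P x).natDegree ≤ d) ∧
    ∀ ω : FieldPoint τ K, g ω = (P ω.1.2).eval ω.1.1}
  zero_mem' := ⟨0, by simp, by simp⟩
  add_mem' := by
    rintro g g' ⟨P, hP, hg⟩ ⟨P', hP', hg'⟩
    exact ⟨fun x => P x + P' x, fun x => natDegree_add_le_of_degree_le (hP x) (hP' x),
      fun ω => by simp [hg, hg']⟩
  smul_mem' := by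
    rintro c g ⟨P, hP, hg⟩
    exact ⟨fun x => C (algebraMap k K c) * P x, fun x => (natDegree_C_mul_le _ _).trans (hP x),
      fun ω => by simp [hg, Algebra.smul_def]⟩

theorem mul_mem_polyFun {d d' : ℕ} {g g' : FieldPoint τ K → K} (h : g ∈ polyFun τ K d)
    (h' : g' ∈ polyFun τ K d') : g * g' ∈ polyFun τ K (d + d') := by
  obtain ⟨P, hP, hg⟩ := h
  obtain ⟨P', hP', hg'⟩ := h'
  exact ⟨fun x => P x * P' x, fun x => natDegree_mul_le.trans (add_le_add (hP x) (hP' x)),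
    fun ω => by simp [hg, hg']⟩

theorem polyFun_mono {d d' : ℕ} (h : d ≤ d') : polyFun τ K d ≤ polyFun τ K d' := by
  rintro g ⟨P, hP, hg⟩
  exact ⟨P, fun x => (hP x).trans h, hg⟩

theorem mem_polyFun_of_snd (d : ℕ) (h : K → K) :
    (fun ω : FieldPoint τ K => h ω.1.2) ∈ polyFun τ K d :=
  ⟨fun x => C (h x), fun x => by simp, fun ω => by simp⟩

/-- The function `A = v x`. -/
def fieldA : FieldPoint τ K → K := fun ω => ω.1.1 * ω.1.2

/-- The function `B = x`. -/
def fieldB : FieldPoint τ K → K := fun ω => ω.1.2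

/-- The function `B⁻¹ = x⁻¹`. -/
def fieldR : FieldPoint τ K → K := fun ω => ω.1.2⁻¹

/-- The function `(α v + β) / ((v² - v + τ) x)`. -/
def fieldT (α β : k) : FieldPoint τ K → K := fun ω =>
  (algebraMap k K α * ω.1.1 + algebraMap k K β) /
    ((ω.1.1 * ω.1.1 - ω.1.1 + algebraMap k K τ) * ω.1.2)

theorem fieldA_mem {d : ℕ} (hd : 1 ≤ d) : fieldA ∈ polyFun τ K d :=
  ⟨fun x => X * C x, fun x => (natDegree_mul_C_le X x).trans (natDegree_X_le.trans hd),
    fun ω => by rw [eval_mul, eval_X, eval_C]; rfl⟩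

theorem fieldB_mem (d : ℕ) : fieldB ∈ polyFun τ K d := mem_polyFun_of_snd d id

theorem fieldR_mem (d : ℕ) : fieldR ∈ polyFun τ K d := mem_polyFun_of_snd d (·⁻¹)

theorem one_mem_polyFun (d : ℕ) : (1 : FieldPoint τ K → K) ∈ polyFun τ K d :=
  mem_polyFun_of_snd d fun _ => 1

/-- A polynomial has no pole: at `x = 1`, clearing the denominator and setting `v = θ` would make
the numerator vanish at `θ`. -/
theorem QuadRoot.fieldT_notMem (hθ : QuadRoot τ K θ) {α β : k} (hαβ : α ≠ 0 ∨ β ≠ 0) :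
    fieldT α β ∉ polyFun τ K 8 := by
  rintro ⟨P, hP, hT⟩
  have h : C (algebraMap k K α) * X + C (algebraMap k K β) - normPoly τ K * P 1 = 0 := by
    refine hθ.eq_zero_of_eval ?_ ?_
    · refine (natDegree_sub_le _ _).trans (max_le ?_ ?_)
      · compute_degree!
      · refine natDegree_mul_le.trans ?_
        rw [natDegree_normPoly]
        have := hP 1
        omega
    · intro v hv
      have := hT ⟨(v, 1), hv, one_ne_zero⟩
      simp only [fieldT, mul_one] at this
      rw [eval_sub, eval_mul, normPoly_eval, ← this, mul_div_cancel₀ _ hv]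
      simp
  have := congrArg (eval θ) h
  rw [eval_sub, eval_mul, normPoly_eval, hθ.root] at this
  exact (hθ.linear_ne hαβ).1 (by simpa using this)

/-- Write `F` for `normPoly` and `L` for the numerator `αv + β`. Clearing denominators gives `(L - F
x W) G = ε x F`. Since `L` vanishes at no root of `F`, `F` divides `G`, and the remaining factors
have a constant product. -/
theorem QuadRoot.eq_of_fieldT_sub_mul (hθ : QuadRoot τ K θ) {α β : k} (hαβ : α ≠ 0 ∨ β ≠ 0)
    {w g : FieldPoint τ K → K} (hw : w ∈ polyFun τ K 4) (hg : g ∈ polyFun τ K 4) {ε : K}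
    (hε : ε ≠ 0) (h : ∀ ω, (fieldT α β ω - w ω) * g ω = ε) :
    ∃ κ : K, κ ≠ 0 ∧ ∀ ω : FieldPoint τ K,
      g ω = κ * (ω.1.1 * ω.1.1 - ω.1.1 + algebraMap k K τ) * ω.1.2 := by
  obtain ⟨W, hW, hw⟩ := hw
  obtain ⟨G, hG, hg⟩ := hg
  have key : ∀ x : K, x ≠ 0 → α = 0 ∧
      G x = normPoly τ K * C (ε * x / algebraMap k K β) := by
    intro x hx
    set L : K[X] := C (algebraMap k K α) * X + C (algebraMap k K β) with hL
    have hLdeg : L.natDegree ≤ 1 := by rw [hL]; compute_degree!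
    have hFdeg := natDegree_normPoly (τ := τ) (K := K)
    have hid : (L - normPoly τ K * (C x * W x)) * G x - C (ε * x) * normPoly τ K = 0 := by
      refine hθ.eq_zero_of_eval ?_ ?_
      · have h1 : (C x * W x).natDegree ≤ 4 := (natDegree_C_mul_le _ _).trans (hW x)
        have h2 := hG x
        have h3 : (normPoly τ K * (C x * W x)).natDegree ≤ 6 := natDegree_mul_le.trans (by omega)
        have h4 : (L - normPoly τ K * (C x * W x)).natDegree ≤ 6 :=
          (natDegree_sub_le _ _).trans (max_le (by omega) h3)
        refine (natDegree_sub_le _ _).trans (max_le (natDegree_mul_le.trans (by omega)) ?_)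
        exact (natDegree_C_mul_le _ _).trans (by omega)
      · intro v hv
        have h1 := h ⟨(v, x), hv, hx⟩
        have h2 : fieldT α β ⟨(v, x), hv, hx⟩ * ((v * v - v + algebraMap k K τ) * x) =
            algebraMap k K α * v + algebraMap k K β := div_mul_cancel₀ _ (mul_ne_zero hv hx)
        rw [hw, hg] at h1
        simp only [eval_sub, eval_mul, normPoly_eval, eval_C, hL, eval_add, eval_X]
        linear_combination ((v * v - v + algebraMap k K τ) * x) * h1 - eval v (G x) * h2
    have hroot : ∀ ρ : K, ρ * ρ - ρ + algebraMap k K τ = 0 → L.eval ρ ≠ 0 → (G x).eval ρ = 0 := by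
      intro ρ hρ hLρ
      have := congrArg (eval ρ) hid
      simp only [eval_sub, eval_mul, normPoly_eval, hρ, eval_zero, zero_mul, sub_zero,
        mul_zero] at this
      exact (mul_eq_zero.1 this).resolve_left hLρ
    obtain ⟨Q, hQ⟩ := dvd_iff_isRoot.2 (hroot θ hθ.root (by simpa [hL] using (hθ.linear_ne hαβ).1))
    obtain ⟨U, hU⟩ : (X - C (1 - θ)) ∣ Q := by
      have h1 := hroot (1 - θ) hθ.root' (by simpa [hL] using (hθ.linear_ne hαβ).2)
      rw [hQ, eval_mul] at h1
      refine dvd_iff_isRoot.2 ((mul_eq_zero.1 h1).resolve_left ?_)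
      rw [eval_sub, eval_X, eval_C]
      exact sub_ne_zero.2 hθ.ne.symm
    have hF : normPoly τ K = (X - C θ) * (X - C (1 - θ)) := by
      have : C (algebraMap k K τ) = C (θ - θ * θ) := by
        congr 1
        linear_combination hθ.root
      rw [normPoly, this]
      simp only [map_sub, map_mul, map_one]
      ring
    have hGU : G x = normPoly τ K * U := by rw [hQ, hU, hF]; ring
    have hcancel : (L - normPoly τ K * (C x * W x)) * U = C (ε * x) := by
      apply mul_left_cancel₀ (normPoly_ne_zero (τ := τ) (K := K))
      rw [hGU] at hid
      linear_combination hid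
    have hunit : IsUnit ((L - normPoly τ K * (C x * W x)) * U) := by
      rw [hcancel]
      exact isUnit_C.2 (mul_ne_zero hε hx).isUnit
    obtain ⟨s, -, hs⟩ := isUnit_iff.1 (isUnit_of_mul_isUnit_left hunit)
    obtain ⟨u, -, hu⟩ := isUnit_iff.1 (isUnit_of_mul_isUnit_right hunit)
    -- `L - s` is a multiple of `F` of degree below two, so `L` is constant.
    have hLs : L - C s = 0 := by
      refine eq_zero_of_dvd_of_natDegree_lt (p := normPoly τ K) ⟨C x * W x, ?_⟩ ?_
      · rw [hs]; ring
      · rw [hFdeg]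
        refine lt_of_le_of_lt (natDegree_sub_le _ _) (max_lt (by omega) (by simp))
    have hα : algebraMap k K α = 0 := by
      have := congrArg (fun p => coeff p 1) hLs
      simpa [hL, coeff_C] using this
    have hβ : algebraMap k K β = s := by
      have := congrArg (fun p => coeff p 0) hLs
      simp [hL] at this
      linear_combination this
    have hα' : α = 0 := (map_eq_zero _).1 hα
    have hβ' : algebraMap k K β ≠ 0 := by
      rw [Ne, map_eq_zero]
      tauto
    refine ⟨hα', ?_⟩
    rw [hGU, ← hu]
    congr 2
    rw [← hs, ← hu, ← C_mul] at hcancel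
    have := C_injective hcancel
    rw [eq_div_iff hβ', hβ]
    linear_combination this
  have hα := (key 1 one_ne_zero).1
  have hβ : algebraMap k K β ≠ 0 := by
    rw [Ne, map_eq_zero]
    tauto
  refine ⟨ε / algebraMap k K β, div_ne_zero hε hβ, fun ω => ?_⟩
  rw [hg, (key _ ω.2.2).2, eval_mul, normPoly_eval, eval_C]
  ring

theorem QuadRoot.not_norm_of_mem_polyFun_one (hθ : QuadRoot τ K θ) {g : FieldPoint τ K → K}
    (hg : g ∈ polyFun τ K 1) {κ : K} (hκ : κ ≠ 0)
    (h : ∀ ω : FieldPoint τ K,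
      g ω = κ * (ω.1.1 * ω.1.1 - ω.1.1 + algebraMap k K τ) * ω.1.2) : False := by
  obtain ⟨G, hG, hg⟩ := hg
  have h0 : C κ * normPoly τ K - G 1 = 0 := by
    refine hθ.eq_zero_of_eval ?_ ?_
    · refine (natDegree_sub_le _ _).trans (max_le ?_ ((hG 1).trans (by norm_num)))
      refine (natDegree_C_mul_le _ _).trans ?_
      rw [natDegree_normPoly]
      norm_num
    · intro v hv
      have := h ⟨(v, 1), hv, one_ne_zero⟩
      rw [hg] at this
      rw [eval_sub, this]
      simp [normPoly_eval]
  have h1 : (C κ * normPoly τ K).natDegree ≤ 1 := by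
    rw [sub_eq_zero.1 h0]; exact hG 1
  rw [natDegree_C_mul hκ, natDegree_normPoly] at h1
  omega

end FieldPoints

end FrobeniusInversion

end

noncomputable section

namespace FrobeniusInversion

/-! ### Three operations do not reach the target at the points of `K`. -/

section FieldBound

open Polynomial Submodule

variable {k : Type*} [Field k] {K : Type*} [Field K] [Algebra k K] {τ : k} {θ : K}

theorem mem_span_one_a_b {g : FieldPoint τ K → K} :
    g ∈ span k {1, fieldA, fieldB} ↔ ∃ p₀ p₁ p₂ : k, g = p₀ • 1 + p₁ • fieldA + p₂ • fieldB := by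
  simp only [mem_span_insert, mem_span_singleton]
  constructor
  · rintro ⟨p₀, _, ⟨p₁, _, ⟨p₂, rfl⟩, rfl⟩, rfl⟩
    exact ⟨p₀, p₁, p₂, by abel⟩
  · rintro ⟨p₀, p₁, p₂, rfl⟩
    exact ⟨p₀, _, ⟨p₁, _, ⟨p₂, rfl⟩, rfl⟩, by abel⟩

theorem mem_span_one_a_b_y {g y : FieldPoint τ K → K} :
    g ∈ span k {1, fieldA, fieldB, y} ↔
      ∃ p₀ p₁ p₂ p₃ : k, g = p₀ • 1 + p₁ • fieldA + p₂ • fieldB + p₃ • y := by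
  simp only [mem_span_insert, mem_span_singleton]
  constructor
  · rintro ⟨p₀, _, ⟨p₁, _, ⟨p₂, _, ⟨p₃, rfl⟩, rfl⟩, rfl⟩, rfl⟩
    exact ⟨p₀, p₁, p₂, p₃, by abel⟩
  · rintro ⟨p₀, p₁, p₂, p₃, rfl⟩
    exact ⟨p₀, _, ⟨p₁, _, ⟨p₂, _, ⟨p₃, rfl⟩, rfl⟩, rfl⟩, by abel⟩

/-- `W` is contained in `span {1, A, B, B⁻¹}`, or in `span {1, A, B, L M}` with linear forms
`L, M` in `A` and `B`. -/
theorem QuadRoot.reach_one (hθ : QuadRoot τ K θ) {W : Submodule k (FieldPoint τ K → K)}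
    (h : Reach (span k {1, fieldA, fieldB}) 1 W) :
    W ≤ span k {1, fieldA, fieldB, fieldR} ∨
      ∃ l₁ l₂ m₁ m₂ : k, W ≤ span k {1, fieldA, fieldB,
        (l₁ • fieldA + l₂ • fieldB) * (m₁ • fieldA + m₂ • fieldB)} := by
  have hle : ∀ y : FieldPoint τ K → K,
      span k {1, fieldA, fieldB} ≤ span k {1, fieldA, fieldB, y} := fun y =>
    span_mono (by intro z hz; simp only [Set.mem_insert_iff, Set.mem_singleton_iff] at hz ⊢; tauto)
  have hy : ∀ y : FieldPoint τ K → K, y ∈ span k {1, fieldA, fieldB, y} := fun y =>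
    subset_span (by simp)
  cases h with
  | @mul _ _ P Q h hP hQ =>
    cases h
    right
    obtain ⟨p₀, p₁, p₂, rfl⟩ := mem_span_one_a_b.1 hP
    obtain ⟨q₀, q₁, q₂, rfl⟩ := mem_span_one_a_b.1 hQ
    refine ⟨p₁, p₂, q₁, q₂, sup_le (hle _) ((span_singleton_le_iff_mem _ _).2 ?_)⟩
    refine mem_span_one_a_b_y.2 ⟨p₀ * q₀, p₀ * q₁ + p₁ * q₀, p₀ * q₂ + p₂ * q₀, 1, ?_⟩
    funext ω
    simp only [Pi.mul_apply, Pi.add_apply, Pi.one_apply, Algebra.smul_def, map_add,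
      map_mul, map_one]
    ring
  | @inv _ _ P y h hP h₁ h₂ =>
    cases h
    left
    refine sup_le (hle _) ((span_singleton_le_iff_mem _ _).2 ?_)
    obtain ⟨p₀, p₁, p₂, rfl⟩ := mem_span_one_a_b.1 hP
    have hne : ∀ v x : K, (hv : v * v - v + algebraMap k K τ ≠ 0) → (hx : x ≠ 0) →
        (algebraMap k K p₀ + algebraMap k K p₁ * (v * x) + algebraMap k K p₂ * x) *
          y ⟨(v, x), hv, hx⟩ = 1 := by
      intro v x hv hx
      simpa [Algebra.smul_def, fieldA, fieldB] using congrFun h₁ ⟨(v, x), hv, hx⟩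
    have hp₁ : p₁ = 0 := by
      by_contra hp
      -- At `x = 1` the form `p₀ + p₁ v + p₂` has its zero in `k`, an admissible value of `v`.
      have := hne (algebraMap k K (-(p₀ + p₂) / p₁)) 1 (hθ.algebraMap_ne _) one_ne_zero
      have hz : algebraMap k K p₀ + algebraMap k K p₁ * (algebraMap k K (-(p₀ + p₂) / p₁) * 1) +
          algebraMap k K p₂ * 1 = 0 := by
        rw [mul_one, mul_one, ← map_mul, ← map_add, ← map_add, mul_div_cancel₀ _ hp]
        simp
      rw [hz, zero_mul] at this
      exact zero_ne_one this
    subst hp₁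
    by_cases hp₂ : p₂ = 0
    · subst hp₂
      have hp₀ : algebraMap k K p₀ ≠ 0 := by
        intro h0
        have := hne (algebraMap k K 0) 1 (hθ.algebraMap_ne _) one_ne_zero
        simp [h0] at this
      refine mem_span_one_a_b_y.2 ⟨p₀⁻¹, 0, 0, 0, ?_⟩
      funext ω
      have := hne ω.1.1 ω.1.2 ω.2.1 ω.2.2
      simp only [map_zero, zero_mul, add_zero] at this
      simp [Algebra.smul_def]
      exact eq_inv_of_mul_eq_one_right this
    · have hp₂' : algebraMap k K p₂ ≠ 0 := by simpa using hp₂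
      have hp₀ : p₀ = 0 := by
        by_contra hp₀
        -- At `v = 0` the form `p₀ + p₂ x` has a nonzero root `x`.
        have := hne (algebraMap k K 0) (algebraMap k K (-p₀ / p₂)) (hθ.algebraMap_ne _) (by
          rw [Ne, map_eq_zero]
          exact div_ne_zero (neg_ne_zero.2 hp₀) hp₂)
        have hz : algebraMap k K p₂ * algebraMap k K (-p₀ / p₂) = - algebraMap k K p₀ := by
          rw [← map_mul, mul_div_cancel₀ _ hp₂, map_neg]
        rw [hz] at this
        simp at this
      subst hp₀
      refine mem_span_one_a_b_y.2 ⟨0, 0, 0, p₂⁻¹, ?_⟩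
      funext ω
      have := hne ω.1.1 ω.1.2 ω.2.1 ω.2.2
      simp only [map_zero, zero_mul, zero_add] at this
      simp [Algebra.smul_def, fieldR]
      rw [eq_inv_of_mul_eq_one_right this, mul_inv]

/-- An invertible element of `span {1, A, B, B⁻¹}` does not depend on `v`. -/
theorem QuadRoot.inverse_of_mem_span_r (hθ : QuadRoot τ K θ) {P z : FieldPoint τ K → K}
    (hP : P ∈ span k {1, fieldA, fieldB, fieldR}) (h : P * z = 1) :
    ∃ f : K → K, z = fun ω => f ω.1.2 := by
  obtain ⟨p₀, p₁, p₂, p₃, rfl⟩ := mem_span_one_a_b_y.1 hP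
  have hne : ∀ ω : FieldPoint τ K, (algebraMap k K p₀ + algebraMap k K p₁ * (ω.1.1 * ω.1.2) +
      algebraMap k K p₂ * ω.1.2 + algebraMap k K p₃ * ω.1.2⁻¹) * z ω = 1 := by
    intro ω
    simpa [Algebra.smul_def, fieldA, fieldB, fieldR] using congrFun h ω
  have hp₁ : p₁ = 0 := by
    by_contra hp
    have := hne ⟨(algebraMap k K (-(p₀ + p₂ + p₃) / p₁), 1), hθ.algebraMap_ne _, one_ne_zero⟩
    have hz : algebraMap k K p₀ + algebraMap k K p₁ *
        (algebraMap k K (-(p₀ + p₂ + p₃) / p₁) * 1) +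
        algebraMap k K p₂ * 1 + algebraMap k K p₃ * 1⁻¹ = 0 := by
      rw [inv_one, mul_one, mul_one, mul_one, ← map_mul, ← map_add, ← map_add, ← map_add,
        mul_div_cancel₀ _ hp]
      convert map_zero (algebraMap k K) using 2
      ring
    rw [hz, zero_mul] at this
    exact zero_ne_one this
  subst hp₁
  refine ⟨fun x => (algebraMap k K p₀ + algebraMap k K p₂ * x + algebraMap k K p₃ * x⁻¹)⁻¹, ?_⟩
  funext ω
  have := hne ω
  simp only [map_zero, zero_mul, add_zero] at this
  exact eq_inv_of_mul_eq_one_right this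

/-- If `W` consists of polynomials in `v`, then reaching `(α v + β) / ((v² - v + τ) x)` from `W` in
one step requires that `W` contains a multiple of `(v² - v + τ) x`. -/
theorem QuadRoot.exists_norm_mem (hθ : QuadRoot τ K θ) {α β : k} (hαβ : α ≠ 0 ∨ β ≠ 0)
    {W : Submodule k (FieldPoint τ K → K)} (hW : W ≤ polyFun τ K 4)
    (h : StepMem W (fieldT α β)) :
    ∃ g ∈ W, ∃ κ : K, κ ≠ 0 ∧ ∀ ω : FieldPoint τ K,
      g ω = κ * (ω.1.1 * ω.1.1 - ω.1.1 + algebraMap k K τ) * ω.1.2 := by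
  rcases h with ⟨w, hw, P, hP, Q, hQ, c, hT⟩ | ⟨w, hw, P, hP, z, c, h₁, h₂, hT⟩
  · refine absurd ?_ (hθ.fieldT_notMem hαβ)
    rw [hT]
    exact add_mem (polyFun_mono (by norm_num) (hW hw))
      (smul_mem _ c (mul_mem_polyFun (hW hP) (hW hQ)))
  · by_cases hc : c = 0
    · refine absurd ?_ (hθ.fieldT_notMem hαβ)
      rw [hT, hc, zero_smul, add_zero]
      exact polyFun_mono (by norm_num) (hW hw)
    · obtain ⟨κ, hκ, hg⟩ := hθ.eq_of_fieldT_sub_mul hαβ (hW hw) (hW hP)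
        (ε := algebraMap k K c) (by simpa using hc) (by
          intro ω
          have : z ω * P ω = 1 := congrFun h₂ ω
          rw [hT]
          simp only [Pi.add_apply, Pi.mul_apply, Pi.algebraMap_apply, Algebra.smul_def]
          linear_combination algebraMap k K c * this)
      exact ⟨P, hP, κ, hκ, hg⟩

theorem QuadRoot.quadratic_coeff (hθ : QuadRoot τ K θ) {s₀ s₁ s₂ : K}
    (h : ∀ v : K, v * v - v + algebraMap k K τ ≠ 0 → s₀ + s₁ * v + s₂ * v ^ 2 = 0) : s₂ = 0 := by
  have h0 : C s₀ + C s₁ * X + C s₂ * X ^ 2 = 0 := by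
    refine hθ.eq_zero_of_eval ?_ fun v hv => by simpa using h v hv
    have : (C s₀ + C s₁ * X + C s₂ * X ^ 2).natDegree ≤ 2 := by compute_degree
    omega
  simpa [coeff_C, coeff_X] using congrArg (fun p => coeff p 2) h0

theorem QuadRoot.quartic_coeff (hθ : QuadRoot τ K θ) {s₀ s₁ s₂ s₃ s₄ : K}
    (h : ∀ x : K, x ≠ 0 → s₀ + s₁ * x + s₂ * x ^ 2 + s₃ * x ^ 3 + s₄ * x ^ 4 = 0) : s₁ = 0 := by
  have h0 : C s₀ + C s₁ * X + C s₂ * X ^ 2 + C s₃ * X ^ 3 + C s₄ * X ^ 4 = 0 := by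
    refine hθ.eq_zero_of_eval_ne_zero ?_ fun v hv => by simpa using h v hv
    have : (C s₀ + C s₁ * X + C s₂ * X ^ 2 + C s₃ * X ^ 3 + C s₄ * X ^ 4).natDegree ≤ 4 := by
      compute_degree
    omega
  simpa [coeff_C, coeff_X] using congrArg (fun p => coeff p 1) h0

theorem span_one_a_b_y_le {y : FieldPoint τ K → K} {d : ℕ} (hd : 1 ≤ d)
    (hy : y ∈ polyFun τ K d) : span k {1, fieldA, fieldB, y} ≤ polyFun τ K d := by
  rw [span_le]
  rintro z (rfl | rfl | rfl | rfl)
  · exact one_mem_polyFun d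
  · exact fieldA_mem hd
  · exact fieldB_mem d
  · exact hy

theorem linear_mul_linear_mem (l₁ l₂ m₁ m₂ : k) :
    (l₁ • fieldA + l₂ • fieldB) * (m₁ • fieldA + m₂ • fieldB) ∈ polyFun τ K 2 :=
  mul_mem_polyFun (d := 1) (d' := 1)
    (add_mem (smul_mem _ _ (fieldA_mem le_rfl)) (smul_mem _ _ (fieldB_mem 1)))
    (add_mem (smul_mem _ _ (fieldA_mem le_rfl)) (smul_mem _ _ (fieldB_mem 1)))

/-- No program that starts with `B⁻¹` and continues with an inversion. -/
theorem QuadRoot.not_stepMem_inv_inv (hθ : QuadRoot τ K θ) {α β : k} (hαβ : α ≠ 0 ∨ β ≠ 0)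
    {P z : FieldPoint τ K → K} (hP : P ∈ span k {1, fieldA, fieldB, fieldR}) (hz : P * z = 1) :
    ¬ StepMem (span k {1, fieldA, fieldB, fieldR} ⊔ span k {z}) (fieldT α β) := by
  intro h
  obtain ⟨f, rfl⟩ := hθ.inverse_of_mem_span_r hP hz
  have hle : span k {1, fieldA, fieldB, fieldR} ⊔ span k {fun ω : FieldPoint τ K => f ω.1.2} ≤
      polyFun τ K 1 :=
    sup_le (span_one_a_b_y_le le_rfl (fieldR_mem 1))
      ((span_singleton_le_iff_mem _ _).2 (mem_polyFun_of_snd 1 f))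
  obtain ⟨g, hg, κ, hκ, hgκ⟩ := hθ.exists_norm_mem hαβ
    (hle.trans (polyFun_mono (by norm_num))) h
  exact hθ.not_norm_of_mem_polyFun_one (hle hg) hκ hgκ

/-- No program that starts with `B⁻¹` and continues with a product. -/
theorem QuadRoot.not_stepMem_inv_mul (hθ : QuadRoot τ K θ) {α β : k} (hαβ : α ≠ 0 ∨ β ≠ 0)
    {P Q : FieldPoint τ K → K} (hP : P ∈ span k {1, fieldA, fieldB, fieldR})
    (hQ : Q ∈ span k {1, fieldA, fieldB, fieldR}) :
    ¬ StepMem (span k {1, fieldA, fieldB, fieldR} ⊔ span k {P * Q}) (fieldT α β) := by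
  intro h
  have hle := span_one_a_b_y_le (τ := τ) (K := K) le_rfl (fieldR_mem 1)
  obtain ⟨g, hg, κ, hκ, hgκ⟩ := hθ.exists_norm_mem hαβ
    (sup_le (hle.trans (polyFun_mono (by norm_num))) ((span_singleton_le_iff_mem _ _).2
      (polyFun_mono (by norm_num) (mul_mem_polyFun (hle hP) (hle hQ))))) h
  obtain ⟨w, hw, c, rfl⟩ := mem_sup_span_singleton.1 hg
  obtain ⟨w₀, w₁, w₂, w₃, rfl⟩ := mem_span_one_a_b_y.1 hw
  obtain ⟨p₀, p₁, p₂, p₃, rfl⟩ := mem_span_one_a_b_y.1 hP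
  obtain ⟨q₀, q₁, q₂, q₃, rfl⟩ := mem_span_one_a_b_y.1 hQ
  let φ := algebraMap k K
  -- Coefficients of `v²`: only `c P Q` contributes to the left side, the right side has `κ x`.
  have key : ∀ x : K, x ≠ 0 → φ c * φ p₁ * φ q₁ * x ^ 2 - κ * x = 0 := by
    intro x hx
    refine hθ.quadratic_coeff (s₀ := φ w₀ + φ w₂ * x + φ w₃ * x⁻¹ +
      φ c * (φ p₀ + φ p₂ * x + φ p₃ * x⁻¹) * (φ q₀ + φ q₂ * x + φ q₃ * x⁻¹) - κ * φ τ * x)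
      (s₁ := φ w₁ * x + φ c * ((φ p₀ + φ p₂ * x + φ p₃ * x⁻¹) * φ q₁ * x +
        φ p₁ * x * (φ q₀ + φ q₂ * x + φ q₃ * x⁻¹)) + κ * x) fun v hv => ?_
    have h1 := hgκ ⟨(v, x), hv, hx⟩
    simp only [Pi.add_apply, Pi.mul_apply, Pi.one_apply, Pi.algebraMap_apply, Algebra.smul_def, fieldA,
      fieldB, fieldR] at h1
    linear_combination h1
  have h1 := key 1 one_ne_zero
  have hθ0 : θ ≠ 0 := by
    rintro rfl
    exact one_ne_zero (hθ.indep 0 1 (by simp)).2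
  have hθ1 : θ ≠ 1 := by
    rintro rfl
    exact one_ne_zero (hθ.indep (-1) 1 (by simp)).2
  -- A constant multiple of `x²` equals `κ x` at `x = 1` and at `x = θ`, with `θ` neither 0 nor 1.
  have h2 : κ * (θ * (θ - 1)) = 0 := by linear_combination key θ hθ0 - θ ^ 2 * h1
  simp [hκ, hθ0, sub_eq_zero, hθ1] at h2

/-- No program that starts with two products. -/
theorem QuadRoot.not_stepMem_mul_mul (hθ : QuadRoot τ K θ) {α β : k} (hαβ : α ≠ 0 ∨ β ≠ 0)
    (l₁ l₂ m₁ m₂ : k) {P Q : FieldPoint τ K → K}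
    (hP : P ∈ span k {1, fieldA, fieldB,
      (l₁ • fieldA + l₂ • fieldB) * (m₁ • fieldA + m₂ • fieldB)})
    (hQ : Q ∈ span k {1, fieldA, fieldB,
      (l₁ • fieldA + l₂ • fieldB) * (m₁ • fieldA + m₂ • fieldB)}) :
    ¬ StepMem (span k {1, fieldA, fieldB,
      (l₁ • fieldA + l₂ • fieldB) * (m₁ • fieldA + m₂ • fieldB)} ⊔ span k {P * Q})
      (fieldT α β) := by
  intro h
  have hle := span_one_a_b_y_le (τ := τ) (K := K) (d := 2) (by norm_num)
    (linear_mul_linear_mem l₁ l₂ m₁ m₂)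
  obtain ⟨g, hg, κ, hκ, hgκ⟩ := hθ.exists_norm_mem hαβ
    (sup_le (hle.trans (polyFun_mono (by norm_num))) ((span_singleton_le_iff_mem _ _).2
      (mul_mem_polyFun (hle hP) (hle hQ)))) h
  obtain ⟨w, hw, c, rfl⟩ := mem_sup_span_singleton.1 hg
  obtain ⟨w₀, w₁, w₂, w₃, rfl⟩ := mem_span_one_a_b_y.1 hw
  obtain ⟨p₀, p₁, p₂, p₃, rfl⟩ := mem_span_one_a_b_y.1 hP
  obtain ⟨q₀, q₁, q₂, q₃, rfl⟩ := mem_span_one_a_b_y.1 hQ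
  let φ := algebraMap k K
  -- Coefficients of `x`: the products of forms contribute only through a constant term times a
  -- linear form, hence at most linearly in `v`, whereas `κ (v² - v + τ)` is quadratic.
  have key : ∀ v : K, v * v - v + φ τ ≠ 0 →
      φ w₁ * v + φ w₂ + φ c * (φ p₀ * (φ q₁ * v + φ q₂) + φ q₀ * (φ p₁ * v + φ p₂)) -
        κ * (v * v - v + φ τ) = 0 := by
    intro v hv
    let y : K := (φ l₁ * v + φ l₂) * (φ m₁ * v + φ m₂)
    let p : K := φ p₁ * v + φ p₂
    let q : K := φ q₁ * v + φ q₂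
    refine hθ.quartic_coeff (s₀ := φ w₀ + φ c * φ p₀ * φ q₀)
      (s₂ := φ w₃ * y + φ c * (φ p₀ * φ q₃ * y + p * q + φ q₀ * φ p₃ * y))
      (s₃ := φ c * (p * φ q₃ * y + q * φ p₃ * y)) (s₄ := φ c * φ p₃ * φ q₃ * y ^ 2)
      fun x hx => ?_
    have h1 := hgκ ⟨(v, x), hv, hx⟩
    simp only [Pi.add_apply, Pi.mul_apply, Pi.one_apply, Pi.algebraMap_apply, Algebra.smul_def, fieldA,
      fieldB] at h1
    simp only [y, p, q]
    linear_combination h1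
  refine hκ (neg_eq_zero.1 (hθ.quadratic_coeff
    (s₀ := φ w₂ + φ c * (φ p₀ * φ q₂ + φ q₀ * φ p₂) - κ * φ τ)
    (s₁ := φ w₁ + φ c * (φ p₀ * φ q₁ + φ q₀ * φ p₁) + κ) fun v hv => ?_))
  linear_combination key v hv

/-- The element `p₀ + p₁ A + p₂ B + p₃ L M` as a polynomial in `v`, where `L = l₁ A + l₂ B` and
`M = m₁ A + m₂ B`. -/
def formPoly (K : Type*) [Field K] [Algebra k K] (l₁ l₂ m₁ m₂ p₀ p₁ p₂ p₃ : k) (x : K) : K[X] :=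
  C (algebraMap k K p₀) + (C (algebraMap k K p₁) * X + C (algebraMap k K p₂)) * C x +
    C (algebraMap k K p₃) * ((C (algebraMap k K l₁) * X + C (algebraMap k K l₂)) *
      (C (algebraMap k K m₁) * X + C (algebraMap k K m₂))) * C (x ^ 2)

theorem natDegree_formPoly_le (l₁ l₂ m₁ m₂ p₀ p₁ p₂ p₃ : k) (x : K) :
    (formPoly K l₁ l₂ m₁ m₂ p₀ p₁ p₂ p₃ x).natDegree ≤ 2 := by
  unfold formPoly
  compute_degree

theorem form_apply (l₁ l₂ m₁ m₂ p₀ p₁ p₂ p₃ : k) (ω : FieldPoint τ K) :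
    (p₀ • (1 : FieldPoint τ K → K) + p₁ • fieldA + p₂ • fieldB +
      p₃ • ((l₁ • fieldA + l₂ • fieldB) * (m₁ • fieldA + m₂ • fieldB)) : FieldPoint τ K → K) ω =
      (formPoly K l₁ l₂ m₁ m₂ p₀ p₁ p₂ p₃ ω.1.2).eval ω.1.1 := by
  simp only [Pi.add_apply, Pi.mul_apply, Pi.one_apply, Pi.algebraMap_apply, Algebra.smul_def,
    fieldA, fieldB, formPoly, eval_add, eval_mul, eval_C, eval_X]
  ring

/-- The restriction of `p₀ + p₁ A + p₂ B + p₃ L M` to the line `v = θ`, as a polynomial in `x`. -/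
def formLine (θ : K) (l₁ l₂ m₁ m₂ p₀ p₁ p₂ p₃ : k) : K[X] :=
  C (algebraMap k K p₀) + C (algebraMap k K p₁ * θ + algebraMap k K p₂) * X +
    C (algebraMap k K p₃ * ((algebraMap k K l₁ * θ + algebraMap k K l₂) *
      (algebraMap k K m₁ * θ + algebraMap k K m₂))) * X ^ 2

theorem natDegree_formLine_le (l₁ l₂ m₁ m₂ p₀ p₁ p₂ p₃ : k) :
    (formLine θ l₁ l₂ m₁ m₂ p₀ p₁ p₂ p₃).natDegree ≤ 2 := by
  unfold formLine
  compute_degree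

theorem formLine_eval (l₁ l₂ m₁ m₂ p₀ p₁ p₂ p₃ : k) (x : K) :
    (formLine θ l₁ l₂ m₁ m₂ p₀ p₁ p₂ p₃).eval x =
      (formPoly K l₁ l₂ m₁ m₂ p₀ p₁ p₂ p₃ x).eval θ := by
  simp only [formLine, formPoly, eval_add, eval_mul, eval_C, eval_X, eval_pow]

theorem coeffs_of_quadratic_eq_C {a b c s : K} (h : C a + C b * X + C c * X ^ 2 = C s) :
    a = s ∧ b = 0 ∧ c = 0 := by
  have h0 := congrArg (fun p => coeff p 0) h
  have h1 := congrArg (fun p => coeff p 1) h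
  have h2 := congrArg (fun p => coeff p 2) h
  simp [coeff_C, coeff_X] at h0 h1 h2
  exact ⟨h0, h1, h2⟩

/-- A form that is constant on the line `v = θ` is constant. -/
theorem QuadRoot.form_const (hθ : QuadRoot τ K θ) {l₁ l₂ m₁ m₂ p₀ p₁ p₂ p₃ : k} {s : K}
    (h : formLine θ l₁ l₂ m₁ m₂ p₀ p₁ p₂ p₃ = C s) (v x : K) :
    (formPoly K l₁ l₂ m₁ m₂ p₀ p₁ p₂ p₃ x).eval v = s := by
  obtain ⟨h0, h1, h2⟩ := coeffs_of_quadratic_eq_C h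
  obtain ⟨hp₂, hp₁⟩ := hθ.indep p₂ p₁ (by linear_combination h1)
  have hlin : ∀ a b : k, algebraMap k K a * θ + algebraMap k K b = 0 → a = 0 ∧ b = 0 := by
    intro a b hab
    exact (hθ.indep b a (by linear_combination hab)).symm
  simp only [formPoly, eval_add, eval_mul, eval_C, eval_X, hp₁, hp₂, map_zero, zero_mul, add_zero,
    h0]
  rcases mul_eq_zero.1 h2 with h2 | h2
  · simp [h2]
  rcases mul_eq_zero.1 h2 with h2 | h2
  · simp [hlin _ _ h2]
  · simp [hlin _ _ h2]

/-- No program that starts with a product and continues with an inversion. -/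
theorem QuadRoot.not_stepMem_mul_inv (hθ : QuadRoot τ K θ) {α β : k} (hαβ : α ≠ 0 ∨ β ≠ 0)
    (l₁ l₂ m₁ m₂ : k) {P z : FieldPoint τ K → K}
    (hP : P ∈ span k {1, fieldA, fieldB,
      (l₁ • fieldA + l₂ • fieldB) * (m₁ • fieldA + m₂ • fieldB)}) (hz : P * z = 1) :
    ¬ StepMem (span k {1, fieldA, fieldB,
      (l₁ • fieldA + l₂ • fieldB) * (m₁ • fieldA + m₂ • fieldB)} ⊔ span k {z})
      (fieldT α β) := by
  intro h
  let φ := algebraMap k K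
  have hform : ∀ g ∈ span k {1, fieldA, fieldB,
      (l₁ • fieldA + l₂ • fieldB) * (m₁ • fieldA + m₂ • fieldB)}, ∃ (G : K → K[X]) (g' : K[X]),
      (∀ x, (G x).natDegree ≤ 2) ∧ (∀ ω : FieldPoint τ K, g ω = (G ω.1.2).eval ω.1.1) ∧
      g'.natDegree ≤ 2 ∧ (∀ x, g'.eval x = (G x).eval θ) ∧
      ∀ s, g' = C s → ∀ ω, g ω = s := by
    intro g hg
    obtain ⟨p₀, p₁, p₂, p₃, rfl⟩ := mem_span_one_a_b_y.1 hg
    refine ⟨formPoly K l₁ l₂ m₁ m₂ p₀ p₁ p₂ p₃, formLine θ l₁ l₂ m₁ m₂ p₀ p₁ p₂ p₃,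
      natDegree_formPoly_le _ _ _ _ _ _ _ _, form_apply _ _ _ _ _ _ _ _,
      natDegree_formLine_le _ _ _ _ _ _ _ _, formLine_eval _ _ _ _ _ _ _ _, ?_⟩
    intro s hs ω
    rw [form_apply]
    exact hθ.form_const hs _ _
  obtain ⟨Pp, P', hPdeg, hPval, hP'deg, hP', hPconst⟩ := hform P hP
  have hPz : ∀ ω, P ω * z ω = 1 := fun ω => congrFun hz ω
  obtain ⟨ω₀⟩ : Nonempty (FieldPoint τ K) :=
    ⟨⟨(algebraMap k K 0, 1), hθ.algebraMap_ne 0, one_ne_zero⟩⟩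
  have hP'0 : P' ≠ 0 := by
    intro h0
    have h1 := hPz ω₀
    rw [hPconst 0 (by rw [h0, C_0]), zero_mul] at h1
    exact zero_ne_one h1
  set Lp : K[X] := C (φ α) * X + C (φ β) with hLp
  have hLdeg : Lp.natDegree ≤ 1 := by rw [hLp]; compute_degree!
  have hLθ : Lp.eval θ ≠ 0 := by simpa [hLp, φ] using (hθ.linear_ne hαβ).1
  have hFdeg := natDegree_normPoly (τ := τ) (K := K)
  have hFθ : (normPoly τ K).eval θ = 0 := by rw [normPoly_eval, hθ.root]
  have hTval : ∀ (v x : K) (hv : v * v - v + algebraMap k K τ ≠ 0) (hx : x ≠ 0),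
      fieldT α β ⟨(v, x), hv, hx⟩ * ((normPoly τ K).eval v * x) = Lp.eval v := by
    intro v x hv hx
    rw [normPoly_eval]
    simp only [hLp, eval_add, eval_mul, eval_C, eval_X]
    exact div_mul_cancel₀ (φ α * v + φ β) (mul_ne_zero hv hx)
  have hprod : ∀ w ∈ span k {1, fieldA, fieldB,
      (l₁ • fieldA + l₂ • fieldB) * (m₁ • fieldA + m₂ • fieldB)} ⊔ span k {z},
      ∀ Q ∈ span k {1, fieldA, fieldB,
      (l₁ • fieldA + l₂ • fieldB) * (m₁ • fieldA + m₂ • fieldB)} ⊔ span k {z},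
      ∀ Q' ∈ span k {1, fieldA, fieldB,
      (l₁ • fieldA + l₂ • fieldB) * (m₁ • fieldA + m₂ • fieldB)} ⊔ span k {z},
      ∀ c : k, fieldT α β ≠ w + c • (Q * Q') := by
    intro w hw Q hQ Q' hQ' c hT
    obtain ⟨w₁, hw₁, e, rfl⟩ := mem_sup_span_singleton.1 hw
    obtain ⟨Q₁, hQ₁, d, rfl⟩ := mem_sup_span_singleton.1 hQ
    obtain ⟨Q₂, hQ₂, d', rfl⟩ := mem_sup_span_singleton.1 hQ'
    obtain ⟨Wp, -, hWdeg, hWval, -⟩ := hform w₁ hw₁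
    obtain ⟨Qp, -, hQdeg, hQval, -⟩ := hform Q₁ hQ₁
    obtain ⟨Qp', -, hQdeg', hQval', -⟩ := hform Q₂ hQ₂
    refine hP'0 (hθ.eq_zero_of_eval_ne_zero (hP'deg.trans (by norm_num)) fun x hx => ?_)
    -- The target multiplied by `P² (v² - v + τ) x`, with `z = 1 / P`. At the pole `v = θ` only `L
    -- P²` survives, so `P` vanishes on that line.
    have hid : Lp * Pp x ^ 2 - normPoly τ K * (C x * (Wp x * Pp x ^ 2 + C (φ e) * Pp x +
        C (φ c) * ((Qp x * Pp x + C (φ d)) * (Qp' x * Pp x + C (φ d'))))) = 0 := by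
      refine hθ.eq_zero_of_eval ?_ fun v hv => ?_
      · have e1 := hPdeg x
        have e2 := hWdeg x
        have e3 := hQdeg x
        have e4 := hQdeg' x
        have f1 : (Pp x ^ 2).natDegree ≤ 4 := natDegree_pow_le.trans (by omega)
        have f2 : (Wp x * Pp x ^ 2).natDegree ≤ 8 := natDegree_mul_le.trans (by omega)
        have f3 : (C (φ e) * Pp x).natDegree ≤ 8 := (natDegree_C_mul_le _ _).trans (by omega)
        have f4 : (Qp x * Pp x + C (φ d)).natDegree ≤ 4 :=
          natDegree_add_le_of_degree_le (natDegree_mul_le.trans (by omega)) (by simp)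
        have f5 : (Qp' x * Pp x + C (φ d')).natDegree ≤ 4 :=
          natDegree_add_le_of_degree_le (natDegree_mul_le.trans (by omega)) (by simp)
        have f6 : (C (φ c) * ((Qp x * Pp x + C (φ d)) * (Qp' x * Pp x + C (φ d')))).natDegree ≤
            8 := (natDegree_C_mul_le _ _).trans (natDegree_mul_le.trans (by omega))
        have f7 := natDegree_add_le_of_degree_le (natDegree_add_le_of_degree_le f2 f3) f6
        have f8 := (natDegree_C_mul_le x _).trans f7
        exact (natDegree_sub_le _ _).trans
          (max_le (natDegree_mul_le.trans (by omega)) (natDegree_mul_le.trans (by omega)))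
      · have h1 := congrFun hT ⟨(v, x), hv, hx⟩
        have h2 := hTval v x hv hx
        have h3 := hPz ⟨(v, x), hv, hx⟩
        simp only [Pi.add_apply, Pi.mul_apply, Pi.algebraMap_apply, Algebra.smul_def, hWval, hQval,
          hQval'] at h1
        simp only [hPval] at h3
        simp only [eval_sub, eval_mul, eval_add, eval_pow, eval_C]
        rw [← h2, h1]
        linear_combination (exp := 1) (eval v (normPoly τ K) * x) * ((φ e) * (Pp x).eval v +
          φ c * (φ d * (Qp' x).eval v * (Pp x).eval v + φ d' * (Qp x).eval v * (Pp x).eval v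
            + φ d * φ d' * ((Pp x).eval v * z ⟨(v, x), hv, hx⟩ + 1))) * h3
    have := congrArg (eval θ) hid
    rw [eval_sub, eval_mul, eval_mul, hFθ, zero_mul, sub_zero, eval_zero, eval_pow] at this
    rw [hP' x]
    exact pow_eq_zero_iff two_ne_zero |>.1 ((mul_eq_zero.1 this).resolve_left hLθ)
  rcases h with ⟨w, hw, Q, hQ, Q', hQ', c, hT⟩ | ⟨w, hw, Q, hQ, y, c, -, hy, hT⟩
  · exact hprod w hw Q hQ Q' hQ' c hT
  by_cases hc : c = 0
  -- With coefficient zero the inverse is absent, and a product with coefficient zero serves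
  -- instead.
  · refine hprod w hw w hw w hw 0 ?_
    rw [hT, hc, zero_smul, zero_smul]
  have hy' : ∀ ω, y ω * Q ω = 1 := fun ω => congrFun hy ω
  obtain ⟨w₁, hw₁, e, rfl⟩ := mem_sup_span_singleton.1 hw
  obtain ⟨Q₁, hQ₁, d, rfl⟩ := mem_sup_span_singleton.1 hQ
  obtain ⟨Wp, -, hWdeg, hWval, -⟩ := hform w₁ hw₁
  obtain ⟨Qp, Q', hQdeg, hQval, hQ'deg, hQ', hQconst⟩ := hform Q₁ hQ₁
  -- Denominators are cleared in `T = W + e / P + c / (Q + d / P)` and `v` is set to `θ`, where `L`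
  -- is nonzero.
  have hline : P' * (Q' * P' + C (φ d)) = 0 := by
    refine hθ.eq_zero_of_eval_ne_zero ?_ fun x hx => ?_
    · have f1 : (Q' * P' + C (φ d)).natDegree ≤ 4 :=
        natDegree_add_le_of_degree_le (natDegree_mul_le.trans (by omega)) (by simp)
      exact natDegree_mul_le.trans (by omega)
    have hid : (Lp * Pp x - normPoly τ K * (C x * (Wp x * Pp x + C (φ e)))) *
        (Qp x * Pp x + C (φ d)) - normPoly τ K * (C (φ c * x) * Pp x ^ 2) = 0 := by
      refine hθ.eq_zero_of_eval ?_ fun v hv => ?_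
      · have e1 := hPdeg x
        have e2 := hWdeg x
        have e3 := hQdeg x
        have f1 : (Pp x ^ 2).natDegree ≤ 4 := natDegree_pow_le.trans (by omega)
        have f2 : (Wp x * Pp x + C (φ e)).natDegree ≤ 4 :=
          natDegree_add_le_of_degree_le (natDegree_mul_le.trans (by omega)) (by simp)
        have f3 := (natDegree_C_mul_le x _).trans f2
        have f4 : (Qp x * Pp x + C (φ d)).natDegree ≤ 4 :=
          natDegree_add_le_of_degree_le (natDegree_mul_le.trans (by omega)) (by simp)
        have f5 := (natDegree_C_mul_le (φ c * x) _).trans f1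
        have f6 : (Lp * Pp x - normPoly τ K * (C x * (Wp x * Pp x + C (φ e)))).natDegree ≤ 6 :=
          (natDegree_sub_le _ _).trans
            (max_le (natDegree_mul_le.trans (by omega)) (natDegree_mul_le.trans (by omega)))
        exact (natDegree_sub_le _ _).trans
          (max_le (natDegree_mul_le.trans (by omega)) (natDegree_mul_le.trans (by omega)))
      · have h1 := congrFun hT ⟨(v, x), hv, hx⟩
        have h2 := hTval v x hv hx
        have h3 := hPz ⟨(v, x), hv, hx⟩
        have h4 := hy' ⟨(v, x), hv, hx⟩
        simp only [Pi.add_apply, Pi.mul_apply, Pi.algebraMap_apply, Algebra.smul_def, hWval,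
          hQval] at h1 h4
        simp only [hPval] at h3
        simp only [eval_sub, eval_mul, eval_add, eval_pow, eval_C]
        rw [← h2, h1]
        set p := (Pp x).eval v
        set ζ := z ⟨(v, x), hv, hx⟩
        set η := y ⟨(v, x), hv, hx⟩
        set q := (Qp x).eval v
        set n := (normPoly τ K).eval v
        linear_combination (exp := 1) n * x * (φ e + φ c * η * p * 0) * (q * p + φ d) * h3
          - φ c * η * n * x * p * φ d * h3 + φ c * n * x * p ^ 2 * h4
    have := congrArg (eval θ) hid
    simp only [eval_sub, eval_mul, eval_add, eval_C, hFθ, zero_mul, sub_zero, eval_zero,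
      mul_assoc] at this
    rw [eval_mul, eval_add, eval_mul, hP' x, hQ' x, eval_C]
    exact (mul_eq_zero.1 this).resolve_left hLθ
  have hQP : Q' * P' + C (φ d) = 0 := (mul_eq_zero.1 hline).resolve_left hP'0
  -- On the line, `Q P = -d`. For `d = 0` the form `Q` vanishes on the line, hence everywhere, and
  -- nothing is left to invert. Otherwise both factors are constant on the line, hence everywhere.
  have hconst : ∃ s t : K, P' = C s ∧ Q' = C t := by
    by_cases hd : φ d = 0
    · rw [hd, C_0, add_zero] at hQP
      have hQ0 : Q' = 0 := (mul_eq_zero.1 hQP).resolve_right hP'0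
      have h1 := hy' ω₀
      have hd' : d = 0 := by simpa [φ] using hd
      rw [hd', zero_smul, add_zero, hQconst 0 (by rw [hQ0, C_0]), mul_zero] at h1
      exact absurd h1 zero_ne_one
    · have hunit : IsUnit (Q' * P') := by
        rw [eq_neg_of_add_eq_zero_left hQP]
        exact (isUnit_C.2 (isUnit_iff_ne_zero.2 hd)).neg
      obtain ⟨t, -, ht⟩ := isUnit_iff.1 (isUnit_of_mul_isUnit_left hunit)
      obtain ⟨s, -, hs⟩ := isUnit_iff.1 (isUnit_of_mul_isUnit_right hunit)
      exact ⟨s, t, hs.symm, ht.symm⟩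
  obtain ⟨s, t, hs, ht⟩ := hconst
  rw [hs, ht, ← C_mul, ← C_add] at hQP
  have hst : t * s + φ d = 0 := C_eq_zero.1 hQP
  have h1 := hPz ω₀
  have h2 := hy' ω₀
  simp only [Pi.add_apply, Pi.mul_apply, Pi.algebraMap_apply, Algebra.smul_def] at h2
  rw [hPconst s hs] at h1
  rw [hQconst t ht] at h2
  -- With `P = s` and `Q = t` everywhere, the inverted element `t + d / s` is zero.
  have h3 : (1 : K) = 0 := by
    linear_combination -(t * y ω₀) * h1 - h2 + y ω₀ * z ω₀ * hst
  exact one_ne_zero h3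

/-- Three operations do not suffice to compute a nontrivial combination of the two components of
the inverse at the points of `K`. -/
theorem QuadRoot.fieldT_notMem_of_reach (hθ : QuadRoot τ K θ) {α β : k} (hαβ : α ≠ 0 ∨ β ≠ 0)
    {W : Submodule k (FieldPoint τ K → K)} (h : Reach (span k {1, fieldA, fieldB}) 3 W) :
    fieldT α β ∉ W := by
  intro hT
  obtain ⟨W₂, h₂, hstep⟩ := h.exists_stepMem hT
  cases h₂ with
  | @mul _ W₁ P Q h₁ hP hQ =>
    rcases hθ.reach_one h₁ with hle | ⟨l₁, l₂, m₁, m₂, hle⟩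
    · exact hθ.not_stepMem_inv_mul hαβ (hle hP) (hle hQ) (hstep.mono (sup_le_sup_right hle _))
    · exact hθ.not_stepMem_mul_mul hαβ l₁ l₂ m₁ m₂ (hle hP) (hle hQ)
        (hstep.mono (sup_le_sup_right hle _))
  | @inv _ W₁ P z h₁ hP hz _ =>
    rcases hθ.reach_one h₁ with hle | ⟨l₁, l₂, m₁, m₂, hle⟩
    · exact hθ.not_stepMem_inv_inv hαβ (hle hP) hz (hstep.mono (sup_le_sup_right hle _))
    · exact hθ.not_stepMem_mul_inv hαβ l₁ l₂ m₁ m₂ (hle hP) hz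
        (hstep.mono (sup_le_sup_right hle _))

end FieldBound

end FrobeniusInversion

end

noncomputable section

namespace FrobeniusInversion

open Submodule

/-! ### One target for `T₁` and `T₂`. -/

section Combination

variable {k : Type*} [Field k] {S : Type*} [Ring S] [Algebra k S]
  {τ : k} {n : ℕ} {Ω : Type*} [Nonempty Ω]

/-- A program of cost at most four that inverts `T₁` or `T₂` yields, in three steps, a nontrivial
combination of the components of the inverse of `a + ξ b`. -/
theorem SLP.exists_reach_three {Γ : SLP k}
    (hΓ : Γ.InvertsOn τ (T₁ τ n) ∨ Γ.InvertsOn τ (T₂ τ n)) (hn : 2 ≤ n) (hτ : τ ≠ 0)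
    (hcost : Γ.cost ≤ 4) {ι : S →ₐ[k] Matrix (Fin 2) (Fin 2) k} (hinj : Function.Injective ι)
    (hι : ∀ x, IsUnit (ι x) → IsUnit x) {a b r e : Ω → S}
    (h₁ : b * r = 1) (h₁' : r * b = 1)
    (h₂ : (a * r * a - a + τ • b) * e = 1) (h₂' : e * (a * r * a - a + τ • b) = 1) :
    ∃ (W : Submodule k (Ω → S)) (α β : k), Reach (span k {1, a, b}) 3 W ∧ (α ≠ 0 ∨ β ≠ 0) ∧
      α • ((r * a - 1) * e) + β • e ∈ W := by
  suffices h : ∃ W : Submodule k (Ω → S), Reach (span k {1, a, b}) Γ.cost W ∧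
      (r * a - 1) * e ∈ W ∧ e ∈ W by
    obtain ⟨W, hW, hc, hd⟩ := h
    exact hW.exists_smul_add_smul_mem (subset_span (by simp)) hcost hc hd
  rcases hΓ with hΓ | hΓ
  -- As `ξ⁻¹ = -τ⁻¹(1 + ξ)`, the pair `(b - τ⁻¹ a, -τ⁻¹ a)` represents `ξ⁻¹(a + ξ b)`. It has the
  -- same span with 1 as `(a, b)`.
  · have hsub : (b - τ⁻¹ • a) - (-(τ⁻¹ • a)) = b := by abel
    have hsum : (b - τ⁻¹ • a) + τ • ((-(τ⁻¹ • a)) * r * (-(τ⁻¹ • a))) =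
        τ⁻¹ • (a * r * a - a + τ • b) := by
      simp only [neg_mul, mul_neg, neg_neg, smul_neg, smul_mul_assoc, mul_smul_comm, smul_smul,
        smul_add, smul_sub, inv_mul_cancel₀ hτ, one_smul, mul_inv_cancel_left₀ hτ]
      abel
    obtain ⟨t, ht, hc, hd⟩ := hΓ.exists_runIn_T₁ hn hinj hι (b - τ⁻¹ • a) (-(τ⁻¹ • a)) r (τ • e)
      (by rw [hsub, h₁]) (by rw [hsub, h₁'])
      (by rw [hsum, smul_mul_smul_comm, h₂, inv_mul_cancel₀ hτ, one_smul])
      (by rw [hsum, smul_mul_smul_comm, h₂', mul_inv_cancel₀ hτ, one_smul])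
    obtain ⟨W, hW, hc, hd⟩ := SLP.exists_reach ht hc hd
    have hspan : span k {1, b - τ⁻¹ • a, -(τ⁻¹ • a)} = span k {1, a, b} := by
      apply le_antisymm <;> rw [span_le] <;> rintro x (rfl | rfl | rfl)
      · exact subset_span (by simp)
      · exact sub_mem (subset_span (by simp)) (smul_mem _ _ (subset_span (by simp)))
      · exact neg_mem (smul_mem _ _ (subset_span (by simp)))
      · exact subset_span (by simp)
      · have := smul_mem (span k {1, b - τ⁻¹ • x, -(τ⁻¹ • x)}) (-τ) (subset_span
          (show -(τ⁻¹ • x) ∈ _ by simp))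
        rwa [smul_neg, neg_smul, neg_neg, smul_smul, mul_inv_cancel₀ hτ, one_smul] at this
      · have := sub_mem (subset_span (R := k) (s := {1, x - τ⁻¹ • a, -(τ⁻¹ • a)})
          (show x - τ⁻¹ • a ∈ _ by simp)) (subset_span (show -(τ⁻¹ • a) ∈ _ by simp))
        rwa [hsub] at this
    rw [hspan] at hW
    have he : e ∈ W := by
      have := W.smul_mem τ⁻¹ hc
      rwa [smul_smul, inv_mul_cancel₀ hτ, one_smul] at this
    refine ⟨W, hW, ?_, he⟩
    have : (r * a - 1) * e = -(r * -(τ⁻¹ • a) * (τ • e)) - e := by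
      simp [smul_smul, hτ, sub_mul]
    rw [this]
    exact W.sub_mem hd he
  · obtain ⟨t, ht, hc, hd⟩ := hΓ.exists_runIn_T₂ hn hτ hinj hι a b r e h₁ h₁' h₂ h₂'
    obtain ⟨W, hW, hc, hd⟩ := SLP.exists_reach ht hc hd
    exact ⟨W, hW, hc, by simpa using W.neg_mem hd⟩

end Combination

/-! ### Cost over fields with at least four elements. -/

section LargeField

variable {k : Type*} [Field k] {τ : k} {n : ℕ}

theorem quadRoot_neg_xi [Fact (Irreducible (quadPoly τ))] {s : Finset k} (hs : 4 ≤ s.card) :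
    QuadRoot τ (QuadExt τ) (-xi τ) where
  root := by
    have := xi_mul_xi τ
    linear_combination this
  indep x y h := by
    have := xi_coord_injective τ (x := x) (y := -y) (x' := 0) (y' := 0) (by
      simp only [map_neg, map_zero]; linear_combination h)
    simpa using this
  card := by
    classical
    refine ⟨(s ×ˢ s).image fun p => algebraMap k (QuadExt τ) p.1 +
      xi τ * algebraMap k (QuadExt τ) p.2, ?_⟩
    rw [Finset.card_image_of_injective, Finset.card_product]
    · nlinarith
    · rintro ⟨x, y⟩ ⟨x', y'⟩ h
      exact Prod.ext_iff.2 (xi_coord_injective τ h)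

/-- The field acts on itself, a plane over `k`, by multiplication. -/
theorem exists_quadExt_algHom (hf : Irreducible (quadPoly τ)) :
    ∃ ι : QuadExt τ →ₐ[k] Matrix (Fin 2) (Fin 2) k, Function.Injective ι := by
  have h0 : quadPoly τ ≠ 0 := hf.ne_zero
  let B := (AdjoinRoot.powerBasis h0).basis.reindex (finCongr (by
    rw [AdjoinRoot.powerBasis_dim]; exact natDegree_quadPoly τ : _ = 2))
  exact ⟨Algebra.leftMulMatrix B, Algebra.leftMulMatrix_injective B⟩

theorem five_le_cost_of_four_le_card (hf : Irreducible (quadPoly τ)) {s : Finset k}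
    (hs : 4 ≤ s.card) (hn : 2 ≤ n) {Γ : SLP k}
    (hΓ : Γ.InvertsOn τ (T₁ τ n) ∨ Γ.InvertsOn τ (T₂ τ n)) : 5 ≤ Γ.cost := by
  by_contra! hcost
  have : Fact (Irreducible (quadPoly τ)) := ⟨hf⟩
  have hθ := quadRoot_neg_xi (τ := τ) hs
  obtain ⟨ι, hι⟩ := exists_quadExt_algHom hf
  have : Nonempty (FieldPoint τ (QuadExt τ)) :=
    ⟨⟨(algebraMap k _ 0, 1), hθ.algebraMap_ne 0, one_ne_zero⟩⟩
  let e : FieldPoint τ (QuadExt τ) → QuadExt τ := fun ω =>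
    ((ω.1.1 * ω.1.1 - ω.1.1 + algebraMap k _ τ) * ω.1.2)⁻¹
  have hval : fieldA * fieldR * fieldA - fieldA + τ • fieldB = fun ω : FieldPoint τ (QuadExt τ) =>
      (ω.1.1 * ω.1.1 - ω.1.1 + algebraMap k _ τ) * ω.1.2 := by
    funext ω
    have := ω.2.2
    simp only [fieldA, fieldB, fieldR, Pi.add_apply, Pi.sub_apply, Pi.mul_apply, Pi.algebraMap_apply,
      Algebra.smul_def]
    field_simp
  have h₁ : (fieldB : FieldPoint τ (QuadExt τ) → QuadExt τ) * fieldR = 1 := by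
    funext ω
    exact mul_inv_cancel₀ ω.2.2
  have h₂ : (fieldA * fieldR * fieldA - fieldA + τ • fieldB) * e = 1 := by
    rw [hval]
    funext ω
    exact mul_inv_cancel₀ (mul_ne_zero ω.2.1 ω.2.2)
  obtain ⟨W, α, β, hW, hαβ, hmem⟩ := SLP.exists_reach_three hΓ hn (tau_ne_zero hf) (by omega) hι
    (fun x hx => by
      rw [isUnit_iff_ne_zero]
      rintro rfl
      rw [map_zero] at hx
      exact not_isUnit_zero hx) h₁ (by rw [mul_comm, h₁]) h₂ (by rw [mul_comm, h₂])
  -- Since `B⁻¹ A = v`, the numerator is `α(v - 1) + β`; whence the coefficient `β - α`.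
  have hT : α • ((fieldR * fieldA - 1) * e) + β • e = fieldT α (β - α) := by
    funext ω
    have h1 := ω.2.1
    have h2 := ω.2.2
    simp only [fieldA, fieldR, fieldT, e, Pi.add_apply, Pi.sub_apply, Pi.mul_apply, Pi.algebraMap_apply,
      Pi.one_apply, Algebra.smul_def, map_sub]
    field_simp
    ring
  rw [hT] at hmem
  refine hθ.fieldT_notMem_of_reach ?_ hW hmem
  by_cases hα : α = 0
  · right; simpa [hα] using hαβ
  · exact Or.inl hα

end LargeField

end FrobeniusInversion

end

noncomputable section

namespace FrobeniusInversion

/-! ### Linear algebra over the field with two elements on bit vectors. -/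

section Echelon

/-- `force n f = f n`; the kernel evaluates `n` before it unfolds `f`. -/
def force {α : Type} (n : ℕ) (f : ℕ → α) : α := Nat.rec (f 0) (fun m _ => f (Nat.succ m)) n

theorem force_eq {α : Type} (n : ℕ) (f : ℕ → α) : force n f = f n := by cases n <;> rfl

/-- `allTrue f l`: the test `f` succeeds on all of `l`. -/
def allTrue {α : Type} (f : α → Bool) (l : List α) : Bool :=
  List.rec true (fun x _ ih => Bool.rec false ih (f x)) l

theorem of_allTrue {α : Type} {f : α → Bool} {l : List α} (h : allTrue f l = true) {x : α}
    (hx : x ∈ l) : f x = true := by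
  induction l with
  | nil => simp at hx
  | cons y l ih =>
    have hrec : allTrue f (y :: l) = Bool.rec false (allTrue f l) (f y) := rfl
    rw [hrec] at h
    cases hy : f y with
    | false => rw [hy] at h; exact absurd h (by simp)
    | true =>
      rw [hy] at h
      rcases List.mem_cons.1 hx with rfl | hx
      · exact hy
      · exact ih h hx

/-- Reduction of a bit vector modulo the vectors `e.2` with pivots `e.1`, for `e` in the list. -/
def reduce (l : List (ℕ × ℕ)) : ℕ → ℕ :=
  List.rec (fun z => z) (fun e _ ih z =>
    force (Nat.xor z (Nat.mul e.2 (Nat.land (Nat.shiftRight z e.1) 1))) ih) l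

theorem reduce_cons (e : ℕ × ℕ) (l : List (ℕ × ℕ)) (z : ℕ) :
    reduce (e :: l) z = reduce l (z ^^^ e.2 * ((z >>> e.1) &&& 1)) := force_eq _ _

theorem mul_and_one_xor (v x y p : ℕ) : v * (((x ^^^ y) >>> p) &&& 1) =
    (v * ((x >>> p) &&& 1)) ^^^ (v * ((y >>> p) &&& 1)) := by
  rw [Nat.shiftRight_xor_distrib, Nat.and_xor_distrib_right]
  rcases Nat.mod_two_eq_zero_or_one (x >>> p) with hx | hx <;>
    rcases Nat.mod_two_eq_zero_or_one (y >>> p) with hy | hy <;>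
    simp [Nat.and_one_is_mod, hx, hy]

/-- Additivity is half of the soundness: an additive map that kills a set of vectors and not `t`
certifies that `t` lies outside their span. Nothing about the pivots has to be verified for this. -/
theorem reduce_xor (l : List (ℕ × ℕ)) (x y : ℕ) :
    reduce l (x ^^^ y) = reduce l x ^^^ reduce l y := by
  induction l generalizing x y with
  | nil => rfl
  | cons e l ih =>
    rw [reduce_cons, reduce_cons, reduce_cons, ← ih, mul_and_one_xor]
    congr 1
    simp only [Nat.xor_assoc, Nat.xor_left_comm]

theorem reduce_zero (l : List (ℕ × ℕ)) : reduce l 0 = 0 := by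
  have := reduce_xor l 0 0
  simpa using this

theorem reduce_concat (l : List (ℕ × ℕ)) (e : ℕ × ℕ) (z : ℕ) : reduce (l ++ [e]) z =
    reduce l z ^^^ e.2 * ((reduce l z >>> e.1) &&& 1) := by
  induction l generalizing z with
  | nil => exact reduce_cons e [] z
  | cons e' l ih => rw [List.cons_append, reduce_cons, reduce_cons, ih]

/-- Extension of an echelon system by further vectors; the result is passed to a continuation. -/
def echelon {α : Type} (vs : List ℕ) : List (ℕ × ℕ) → (List (ℕ × ℕ) → α) → α :=
  List.rec (fun l f => f l) (fun v _ ih l f => force (reduce l v) fun w =>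
    force (Nat.log2 w) fun p => ih (List.rec [(p, w)] (fun e _ t => e :: t) l) f) vs

/-- The bit of `w` at `log2 w` is 1 unless `w = 0`, in which case the new entry acts trivially. -/
theorem reduce_concat_log2 (l : List (ℕ × ℕ)) (v : ℕ) :
    reduce (l ++ [(Nat.log2 (reduce l v), reduce l v)]) v = 0 := by
  rw [reduce_concat]
  set w := reduce l v
  by_cases hw : w = 0
  · simp [hw]
  · have h : w >>> w.log2 = 1 := by
      rw [Nat.shiftRight_eq_div_pow]
      have h1 := Nat.log2_self_le hw
      have h2 : w < 2 ^ (w.log2 + 1) := Nat.lt_log2_self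
      rw [pow_succ] at h2
      exact Nat.div_eq_of_lt_le (by omega) (by omega)
    simp [h]

theorem exists_echelon_eq {α : Type} (vs : List ℕ) (l : List (ℕ × ℕ))
    (f : List (ℕ × ℕ) → α) : ∃ l', echelon vs l f = f l' ∧
      (∀ z, reduce l z = 0 → reduce l' z = 0) ∧ ∀ v ∈ vs, reduce l' v = 0 := by
  induction vs generalizing l with
  | nil => exact ⟨l, rfl, fun _ h => h, by simp⟩
  | cons v vs ih =>
    have happ : ∀ (e : ℕ × ℕ) (l : List (ℕ × ℕ)),
        (List.rec [e] (fun e' _ t => e' :: t) l : List (ℕ × ℕ)) = l ++ [e] := by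
      intro e l
      induction l with
      | nil => rfl
      | cons e' l ih => rw [List.cons_append, ← ih]
    have hrec : echelon (v :: vs) l f =
        echelon vs (l ++ [(Nat.log2 (reduce l v), reduce l v)]) f := by
      have h : echelon (v :: vs) l f = force (reduce l v) fun w => force (Nat.log2 w) fun p =>
          echelon vs (List.rec [(p, w)] (fun e _ t => e :: t) l) f := rfl
      rw [h, force_eq, force_eq, happ]
    obtain ⟨l', h, h₁, h₂⟩ := ih (l ++ [(Nat.log2 (reduce l v), reduce l v)])
    refine ⟨l', hrec.trans h, fun z hz => h₁ z ?_, fun u hu => ?_⟩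
    · rw [reduce_concat, hz]; simp
    · rcases List.mem_cons.1 hu with rfl | hu
      · exact h₁ _ (reduce_concat_log2 l _)
      · exact h₂ u hu

end Echelon

/-! ### The exhaustive check on packed matrices. -/

section Packed

/-- Seventeen `2 × 2` matrices over the field with two elements. The bits of `a`, `b`, `c`, `d` are
the entries of the rows `(a, b)` and `(c, d)`. -/
structure PackedMatrix where
  a : ℕ
  b : ℕ
  c : ℕ
  d : ℕ

namespace PackedMatrix

/-- The entrywise sum. -/
def add (x y : PackedMatrix) : PackedMatrix :=
  ⟨Nat.xor x.a y.a, Nat.xor x.b y.b, Nat.xor x.c y.c, Nat.xor x.d y.d⟩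

/-- The upper left entries of the products. -/
def mulA (x y : PackedMatrix) : ℕ := Nat.xor (Nat.land x.a y.a) (Nat.land x.b y.c)

/-- The products. -/
def mul (x y : PackedMatrix) : PackedMatrix :=
  ⟨Nat.xor (Nat.land x.a y.a) (Nat.land x.b y.c), Nat.xor (Nat.land x.a y.b) (Nat.land x.b y.d),
    Nat.xor (Nat.land x.c y.a) (Nat.land x.d y.c), Nat.xor (Nat.land x.c y.b) (Nat.land x.d y.d)⟩

/-- The adjugates. -/
def adj (x : PackedMatrix) : PackedMatrix := ⟨x.d, x.b, x.c, x.a⟩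

/-- The determinants. -/
def det (x : PackedMatrix) : ℕ := Nat.xor (Nat.land x.a x.d) (Nat.land x.b x.c)

/-- `x.forced f = f x`; the kernel evaluates the entries of `x` before it unfolds `f`. -/
def forced {α : Type} (x : PackedMatrix) (f : PackedMatrix → α) : α :=
  force x.a fun a => force x.b fun b => force x.c fun c => force x.d fun d => f ⟨a, b, c, d⟩

theorem forced_eq {α : Type} (x : PackedMatrix) (f : PackedMatrix → α) : x.forced f = f x := by
  simp only [forced, force_eq]

/-- The entries are bit vectors of length seventeen. -/
def Bounded (x : PackedMatrix) : Prop :=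
  x.a < 2 ^ 17 ∧ x.b < 2 ^ 17 ∧ x.c < 2 ^ 17 ∧ x.d < 2 ^ 17

theorem Bounded.add {x y : PackedMatrix} (hx : x.Bounded) (hy : y.Bounded) : (x.add y).Bounded :=
  ⟨Nat.xor_lt_two_pow hx.1 hy.1, Nat.xor_lt_two_pow hx.2.1 hy.2.1,
    Nat.xor_lt_two_pow hx.2.2.1 hy.2.2.1, Nat.xor_lt_two_pow hx.2.2.2 hy.2.2.2⟩

theorem Bounded.mul {x y : PackedMatrix} (hy : y.Bounded) : (x.mul y).Bounded :=
  ⟨Nat.xor_lt_two_pow (Nat.and_lt_two_pow _ hy.1) (Nat.and_lt_two_pow _ hy.2.2.1),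
    Nat.xor_lt_two_pow (Nat.and_lt_two_pow _ hy.2.1) (Nat.and_lt_two_pow _ hy.2.2.2),
    Nat.xor_lt_two_pow (Nat.and_lt_two_pow _ hy.1) (Nat.and_lt_two_pow _ hy.2.2.1),
    Nat.xor_lt_two_pow (Nat.and_lt_two_pow _ hy.2.1) (Nat.and_lt_two_pow _ hy.2.2.2)⟩

theorem Bounded.adj {x : PackedMatrix} (hx : x.Bounded) : x.adj.Bounded :=
  ⟨hx.2.2.2, hx.2.1, hx.2.2.1, hx.1⟩

theorem Bounded.det_lt {x : PackedMatrix} (hx : x.Bounded) : x.det < 2 ^ 17 :=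
  Nat.xor_lt_two_pow (Nat.and_lt_two_pow _ hx.2.2.2) (Nat.and_lt_two_pow _ hx.2.2.1)

/-- The identity matrices. -/
def one : PackedMatrix := ⟨131071, 0, 0, 131071⟩

theorem bounded_one : one.Bounded := by simp [Bounded, one]

/-- The sums of the nonempty sublists. -/
def nzSums : List PackedMatrix → List PackedMatrix
  | [] => []
  | b :: bs => b :: (nzSums bs ++ (nzSums bs).map b.add)

theorem bounded_of_mem_nzSums {bs : List PackedMatrix} (h : ∀ x ∈ bs, x.Bounded)
    {p : PackedMatrix} (hp : p ∈ nzSums bs) : p.Bounded := by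
  induction bs generalizing p with
  | nil => simp [nzSums] at hp
  | cons b bs ih =>
    have hb := h b (by simp)
    have ih := fun {p} => ih (fun x hx => h x (by simp [hx])) (p := p)
    simp only [nzSums, List.mem_cons, List.mem_append, List.mem_map] at hp
    rcases hp with rfl | hp | ⟨q, hq, rfl⟩
    · exact hb
    · exact ih hp
    · exact hb.add (ih hq)

theorem reduce_eq_zero_of_mem_nzSums {F : PackedMatrix → ℕ}
    (hF : ∀ x y, F (x.add y) = F x ^^^ F y) {l : List (ℕ × ℕ)} {bs : List PackedMatrix}
    (h : ∀ x ∈ bs, reduce l (F x) = 0) {p : PackedMatrix} (hp : p ∈ nzSums bs) :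
    reduce l (F p) = 0 := by
  induction bs generalizing p with
  | nil => simp [nzSums] at hp
  | cons b bs ih =>
    have hb := h b (by simp)
    have ih := fun {p} => ih (fun x hx => h x (by simp [hx])) (p := p)
    simp only [nzSums, List.mem_cons, List.mem_append, List.mem_map] at hp
    rcases hp with rfl | hp | ⟨q, hq, rfl⟩
    · exact hb
    · exact ih hp
    · rw [hF, reduce_xor, hb, ih hq, Nat.xor_self]

theorem mulA_add (p x y : PackedMatrix) : p.mulA (x.add y) = p.mulA x ^^^ p.mulA y := by
  change (p.a &&& (x.a ^^^ y.a)) ^^^ (p.b &&& (x.c ^^^ y.c)) =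
    ((p.a &&& x.a) ^^^ (p.b &&& x.c)) ^^^ ((p.a &&& y.a) ^^^ (p.b &&& y.c))
  simp only [Nat.and_xor_distrib_left, Nat.xor_assoc, Nat.xor_left_comm]

/-- The products of two nonempty sums. -/
def prods (bs : List PackedMatrix) : List PackedMatrix :=
  (nzSums bs).flatMap fun p => (nzSums bs).map fun q => p.mul q

/-- The inverses of the nonempty sums of `1` and the elements of `bs`. -/
def invs (bs : List PackedMatrix) : List PackedMatrix :=
  ((nzSums (one :: bs)).filter fun p => Nat.beq p.det 131071).map adj

theorem one_mem_invs (bs : List PackedMatrix) : one ∈ invs bs :=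
  List.mem_map.2 ⟨one, List.mem_filter.2 ⟨by simp [nzSums], rfl⟩, rfl⟩

/-- No element of `ts`, translated by `z`, reduces to zero. -/
def avoids (l : List (ℕ × ℕ)) (z : ℕ) (ts : List ℕ) : Bool :=
  allTrue (fun t => Bool.rec true false (Nat.beq (reduce l (Nat.xor z t)) 0)) ts

theorem reduce_ne_zero_of_avoids {l : List (ℕ × ℕ)} {z t : ℕ} {ts : List ℕ}
    (h : avoids l z ts = true) (ht : t ∈ ts) : reduce l (z ^^^ t) ≠ 0 := by
  intro h0
  have hrec : (Bool.rec true false (Nat.beq (reduce l (z ^^^ t)) 0) : Bool) = true :=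
    of_allTrue h ht
  rw [h0] at hrec
  exact Bool.false_ne_true hrec

/-- The upper left entries in `ts` are not reached by adjoining a product or an inverse to the span
of `1` and `bs`. -/
def stepAvoids (ts : List ℕ) (bs : List PackedMatrix) : Bool :=
  echelon ((one :: bs).map a) [] fun l =>
    Bool.rec false (allTrue (fun p => avoids l p.a ts) (invs bs))
      (allTrue (fun p => p.forced fun p => echelon (bs.map p.mulA) l fun l' => avoids l' 0 ts)
        (nzSums bs))

/-- For a product, the left factor `p` is enumerated and the right one is treated linearly: `p * g`
runs through the span of the `p * x`. The identity is not needed in the factors, as it contributes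
only elements of the span itself. -/
theorem exists_reduce_of_stepAvoids {ts : List ℕ} {bs : List PackedMatrix}
    (h : stepAvoids ts bs = true) {t : ℕ} (ht : t ∈ ts) :
    (∃ l, (∀ x ∈ one :: bs, reduce l x.a = 0) ∧ ∀ p ∈ invs bs, reduce l (p.a ^^^ t) ≠ 0) ∧
      ∀ p ∈ nzSums bs, ∃ l, (∀ x ∈ one :: bs, reduce l x.a = 0) ∧
        (∀ x ∈ bs, reduce l (p.mulA x) = 0) ∧ reduce l t ≠ 0 := by
  obtain ⟨l, hl, -, hkill⟩ := exists_echelon_eq ((one :: bs).map a) [] fun l =>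
    (Bool.rec false (allTrue (fun p => avoids l p.a ts) (invs bs))
      (allTrue (fun p => p.forced fun p => echelon (bs.map p.mulA) l fun l' => avoids l' 0 ts)
        (nzSums bs)) : Bool)
  have hkill' : ∀ x ∈ one :: bs, reduce l x.a = 0 := fun x hx => hkill _ (List.mem_map_of_mem hx)
  rw [stepAvoids, hl] at h
  cases hp : allTrue (fun p => p.forced fun p => echelon (bs.map p.mulA) l fun l' =>
    avoids l' 0 ts) (nzSums bs) with
  | false => rw [hp] at h; exact absurd h Bool.false_ne_true
  | true =>
    rw [hp] at h
    refine ⟨⟨l, hkill', fun p hp => reduce_ne_zero_of_avoids (of_allTrue h hp) ht⟩,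
      fun p hp' => ?_⟩
    have h1 := of_allTrue hp hp'
    rw [forced_eq] at h1
    obtain ⟨l', hl', hmono, hkill₂⟩ := exists_echelon_eq (bs.map p.mulA) l
      fun l' => avoids l' 0 ts
    rw [hl'] at h1
    refine ⟨l', fun x hx => hmono _ (hkill' x hx), fun x hx => hkill₂ _ (List.mem_map_of_mem hx),
      ?_⟩
    simpa using reduce_ne_zero_of_avoids h1 ht

/-- Let `a`, `b` be the inputs. The upper left entries in `ts` are not reached in three steps. -/
def threeStepsAvoid (ts : List ℕ) (a b : PackedMatrix) : Bool :=
  allTrue (fun x => x.forced fun x => allTrue (fun y => y.forced fun y =>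
    stepAvoids ts [y, x, a, b]) (prods [x, a, b] ++ invs [x, a, b])) (prods [a, b] ++ invs [a, b])

theorem stepAvoids_of_threeStepsAvoid {ts : List ℕ} {a b x y : PackedMatrix}
    (h : threeStepsAvoid ts a b = true) (hx : x ∈ prods [a, b] ++ invs [a, b])
    (hy : y ∈ prods [x, a, b] ++ invs [x, a, b]) : stepAvoids ts [y, x, a, b] = true := by
  have h1 := of_allTrue h hx
  rw [forced_eq] at h1
  have h2 := of_allTrue h1 hy
  rwa [forced_eq] at h2

end PackedMatrix

end Packed

end FrobeniusInversion

end

noncomputable section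

namespace FrobeniusInversion

open Submodule

namespace PackedMatrix

/-! ### Packed matrices as functions on seventeen points. -/

section Unpack

variable (k : Type*) [Field k]

/-- Bit `i` of `z` as an element of `k`. -/
def bitVal (z i : ℕ) : k := if z.testBit i then 1 else 0

/-- The seventeen matrices over `k` given by a packed matrix. -/
def unpack (x : PackedMatrix) : Fin 17 → Matrix (Fin 2) (Fin 2) k := fun i =>
  !![bitVal k x.a i, bitVal k x.b i; bitVal k x.c i, bitVal k x.d i]

theorem bitVal_and (x y i : ℕ) : bitVal k (Nat.land x y) i = bitVal k x i * bitVal k y i := by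
  change bitVal k (x &&& y) i = _
  simp only [bitVal, Nat.testBit_and]
  cases x.testBit i <;> cases y.testBit i <;> simp

theorem bitVal_mask (i : Fin 17) : bitVal k 131071 i = 1 := by
  have : (131071 : ℕ).testBit i = true := by revert i; decide
  simp [bitVal, this]

theorem bitVal_zero (i : ℕ) : bitVal k 0 i = 0 := by simp [bitVal]

variable {k} in
theorem eq_of_bitVal_eq {x y : ℕ} (hx : x < 2 ^ 17) (hy : y < 2 ^ 17)
    (h : ∀ i : Fin 17, bitVal k x i = bitVal k y i) : x = y := by
  refine Nat.eq_of_testBit_eq fun i => ?_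
  by_cases hi : i < 17
  · have := h ⟨i, hi⟩
    simp only [bitVal] at this
    cases hx' : x.testBit i <;> cases hy' : y.testBit i <;> simp_all
  · have h2 : 2 ^ 17 ≤ 2 ^ i := Nat.pow_le_pow_right (by norm_num) (by omega)
    rw [Nat.testBit_lt_two_pow (hx.trans_le h2), Nat.testBit_lt_two_pow (hy.trans_le h2)]

variable {k} in
theorem a_eq_of_unpack_eq {x y : PackedMatrix} (hx : x.Bounded) (hy : y.Bounded)
    (h : unpack k x = unpack k y) : x.a = y.a :=
  eq_of_bitVal_eq hx.1 hy.1 fun i => by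
    simpa [unpack] using congrFun (congrFun (congrFun h i) 0) 0

theorem unpack_one : unpack k one = 1 := by
  funext i
  simp only [unpack, one, bitVal_mask, bitVal_zero, Pi.one_apply, Matrix.one_fin_two]

variable [CharP k 2]

theorem bitVal_xor (x y i : ℕ) : bitVal k (Nat.xor x y) i = bitVal k x i + bitVal k y i := by
  change bitVal k (x ^^^ y) i = _
  simp only [bitVal, Nat.testBit_xor]
  cases x.testBit i <;> cases y.testBit i <;> simp [CharTwo.add_self_eq_zero]

theorem unpack_add (x y : PackedMatrix) : unpack k (x.add y) = unpack k x + unpack k y := by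
  funext i
  simp only [unpack, add, bitVal_xor, Pi.add_apply]
  ext p q
  fin_cases p <;> fin_cases q <;> rfl

theorem unpack_mul (x y : PackedMatrix) : unpack k (x.mul y) = unpack k x * unpack k y := by
  funext i
  simp only [unpack, mul, bitVal_xor, bitVal_and, Pi.mul_apply, Matrix.mul_fin_two]

variable {k} in
theorem sub_eq_add_of_charTwo (f g : Fin 17 → Matrix (Fin 2) (Fin 2) k) : f - g = f + g := by
  funext i
  ext p q
  simp [CharTwo.sub_eq_add]

variable {k} in
/-- The inverse of a unit is given by the adjugates. -/
theorem eq_unpack_adj {x : PackedMatrix} (hx : x.Bounded)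
    {z : Fin 17 → Matrix (Fin 2) (Fin 2) k} (h : unpack k x * z = 1) :
    x.det = 131071 ∧ z = unpack k x.adj := by
  have hdet : ∀ i : Fin 17, (unpack k x i).det = bitVal k x.det i := by
    intro i
    simp only [unpack, Matrix.det_fin_two_of, det, bitVal_xor, bitVal_and, CharTwo.sub_eq_add]
  have hne : ∀ i : Fin 17, bitVal k x.det i ≠ 0 := by
    intro i hi
    have h1 := congrArg Matrix.det (congrFun h i)
    rw [Pi.mul_apply, Matrix.det_mul, hdet, hi, zero_mul, Pi.one_apply, Matrix.det_one] at h1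
    exact zero_ne_one h1
  -- A nonzero bit is 1, so the inverse is the adjugate, without signs in characteristic two.
  have hone : ∀ i : Fin 17, bitVal k x.det i = 1 := by
    intro i
    have h1 := hne i
    unfold bitVal at h1 ⊢
    split_ifs at h1 ⊢ with h2
    · rfl
    · exact absurd rfl h1
  refine ⟨eq_of_bitVal_eq (k := k) hx.det_lt (by norm_num) fun i => by
    rw [hone, bitVal_mask], ?_⟩
  have hadj : unpack k x.adj * unpack k x = 1 := by
    funext i
    have h1 := hone i
    simp only [det, bitVal_xor, bitVal_and] at h1
    simp only [unpack, adj, Pi.mul_apply, Matrix.mul_fin_two, Pi.one_apply, Matrix.one_fin_two]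
    congr 1
    ext p q
    fin_cases p <;> fin_cases q <;> simp
    · linear_combination h1
    · rw [mul_comm]; exact CharTwo.add_self_eq_zero _
    · rw [mul_comm]; exact CharTwo.add_self_eq_zero _
    · linear_combination h1
  rw [← one_mul z, ← hadj, mul_assoc, h, mul_one]

end Unpack

/-! ### Soundness of the exhaustive check. -/

section Span

theorem bounded_of_mem_invs {bs : List PackedMatrix} (hbs : ∀ x ∈ bs, x.Bounded)
    {p : PackedMatrix} (hp : p ∈ invs bs) : p.Bounded := by
  obtain ⟨q, hq, rfl⟩ := List.mem_map.1 hp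
  refine (bounded_of_mem_nzSums (bs := one :: bs) ?_ (List.mem_filter.1 hq).1).adj
  intro x hx
  rcases List.mem_cons.1 hx with rfl | hx
  · exact bounded_one
  · exact hbs x hx

variable (k : Type*) [Field k]

/-- The span of the unpacked matrices. -/
def packedSpan : List PackedMatrix → Submodule k (Fin 17 → Matrix (Fin 2) (Fin 2) k)
  | [] => ⊥
  | b :: bs => packedSpan bs ⊔ span k {unpack k b}

variable {k}

theorem mem_packedSpan_one_cons {bs : List PackedMatrix}
    {g : Fin 17 → Matrix (Fin 2) (Fin 2) k} (h : g ∈ packedSpan k (one :: bs)) :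
    ∃ g' ∈ packedSpan k bs, ∃ c : k, g = g' + c • 1 := by
  rw [packedSpan, mem_sup_span_singleton, unpack_one] at h
  exact h

/-- Up to the span of `1` and `bs`, a product of two elements of it is a product of two elements of
the span of `bs`. -/
theorem exists_mul_eq {bs : List PackedMatrix} {f g : Fin 17 → Matrix (Fin 2) (Fin 2) k}
    (hf : f ∈ packedSpan k (one :: bs)) (hg : g ∈ packedSpan k (one :: bs)) :
    ∃ f' ∈ packedSpan k bs, ∃ g' ∈ packedSpan k bs, ∃ w ∈ packedSpan k (one :: bs),
      f * g = w + f' * g' := by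
  obtain ⟨f', hf', c, rfl⟩ := mem_packedSpan_one_cons hf
  obtain ⟨g', hg', d, rfl⟩ := mem_packedSpan_one_cons hg
  have h1 : (1 : Fin 17 → Matrix (Fin 2) (Fin 2) k) ∈ packedSpan k (one :: bs) := by
    rw [← unpack_one]
    exact mem_sup_right (mem_span_singleton_self _)
  refine ⟨f', hf', g', hg', d • f' + c • g' + (c * d) • 1,
    add_mem (add_mem (smul_mem _ _ (mem_sup_left hf')) (smul_mem _ _ (mem_sup_left hg')))
      (smul_mem _ _ h1), ?_⟩
  simp only [add_mul, mul_add, smul_mul_assoc, mul_smul_comm, one_mul, mul_one, smul_add,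
    smul_smul]
  rw [mul_comm d c]
  abel

variable [CharP k 2]

/-- With scalars 0 and 1 only, a span is a finite set of subset sums. -/
theorem mem_packedSpan (hk : ∀ x : k, x = 0 ∨ x = 1) {bs : List PackedMatrix}
    {g : Fin 17 → Matrix (Fin 2) (Fin 2) k} (h : g ∈ packedSpan k bs) :
    g = 0 ∨ ∃ p ∈ nzSums bs, g = unpack k p := by
  induction bs generalizing g with
  | nil => exact Or.inl (by simpa [packedSpan] using h)
  | cons b bs ih =>
    obtain ⟨w, hw, c, rfl⟩ := mem_sup_span_singleton.1 h
    simp only [nzSums, List.mem_cons, List.mem_append, List.mem_map]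
    rcases hk c with rfl | rfl
    · rw [zero_smul, add_zero]
      rcases ih hw with rfl | ⟨p, hp, rfl⟩
      · exact Or.inl rfl
      · exact Or.inr ⟨p, Or.inr (Or.inl hp), rfl⟩
    · rw [one_smul]
      rcases ih hw with rfl | ⟨p, hp, rfl⟩
      · exact Or.inr ⟨b, Or.inl rfl, zero_add _⟩
      · exact Or.inr ⟨b.add p, Or.inr (Or.inr ⟨p, hp, rfl⟩), by rw [unpack_add, add_comm]⟩

/-- The inverse of an element of the span is listed. -/
theorem exists_mem_invs (hk : ∀ x : k, x = 0 ∨ x = 1) {bs : List PackedMatrix}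
    (hbs : ∀ x ∈ bs, x.Bounded)
    {g z : Fin 17 → Matrix (Fin 2) (Fin 2) k} (hg : g ∈ packedSpan k (one :: bs))
    (h : g * z = 1) : ∃ p ∈ invs bs, z = unpack k p := by
  have hbs' : ∀ x ∈ one :: bs, x.Bounded := by
    intro x hx
    rcases List.mem_cons.1 hx with rfl | hx
    · exact bounded_one
    · exact hbs x hx
  rcases mem_packedSpan hk hg with rfl | ⟨p, hp, rfl⟩
  · rw [zero_mul] at h
    exact absurd h zero_ne_one
  · obtain ⟨hdet, rfl⟩ := eq_unpack_adj (bounded_of_mem_nzSums hbs' hp) h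
    exact ⟨p.adj, List.mem_map.2 ⟨p, List.mem_filter.2 ⟨hp, by rw [hdet]; rfl⟩, rfl⟩, rfl⟩

/-- Adjoining a product or an inverse amounts to adjoining a listed one. -/
theorem exists_le_packedSpan (hk : ∀ x : k, x = 0 ∨ x = 1)
    {W₀ W : Submodule k (Fin 17 → Matrix (Fin 2) (Fin 2) k)} {m : ℕ} (h : Reach W₀ (m + 1) W) :
    ∃ W', Reach W₀ m W' ∧ ∀ bs : List PackedMatrix, (∀ x ∈ bs, x.Bounded) →
      W' ≤ packedSpan k (one :: bs) →
      ∃ y ∈ prods bs ++ invs bs, y.Bounded ∧ W ≤ packedSpan k (one :: y :: bs) := by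
  have hle : ∀ bs y, packedSpan k (one :: bs) ≤ packedSpan k (one :: y :: bs) := fun bs y =>
    sup_le_sup_right le_sup_left _
  have hmem : ∀ bs y, unpack k y ∈ packedSpan k (one :: y :: bs) := fun bs y =>
    mem_sup_left (mem_sup_right (mem_span_singleton_self _))
  cases h with
  | @mul _ W' f g h' hf hg =>
    refine ⟨W', h', fun bs hbs hW => ?_⟩
    obtain ⟨f', hf', g', hg', w, hw, hfg⟩ := exists_mul_eq (hW hf) (hW hg)
    have key : ∀ y, f' * g' ∈ packedSpan k (one :: y :: bs) →
        W' ⊔ span k {f * g} ≤ packedSpan k (one :: y :: bs) := by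
      intro y hy
      refine sup_le (hW.trans (hle bs y)) ((span_singleton_le_iff_mem _ _).2 ?_)
      rw [hfg]
      exact add_mem (hle bs y hw) hy
    -- A zero product needs no new element; the identity, always listed in `invs`, fills the slot.
    have hzero : f' * g' = 0 → ∃ y ∈ prods bs ++ invs bs, y.Bounded ∧
        W' ⊔ span k {f * g} ≤ packedSpan k (one :: y :: bs) := fun h0 =>
      ⟨one, List.mem_append_right _ (one_mem_invs bs), bounded_one, key _ (h0 ▸ zero_mem _)⟩
    rcases mem_packedSpan hk hf' with rfl | ⟨p, hp, rfl⟩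
    · exact hzero (zero_mul _)
    rcases mem_packedSpan hk hg' with rfl | ⟨q, hq, rfl⟩
    · exact hzero (mul_zero _)
    refine ⟨p.mul q, List.mem_append_left _ (List.mem_flatMap.2 ⟨p, hp, List.mem_map.2
      ⟨q, hq, rfl⟩⟩), (bounded_of_mem_nzSums hbs hq).mul, key _ ?_⟩
    rw [← unpack_mul]
    exact hmem _ _
  | @inv _ W' f z h' hf h₁ h₂ =>
    refine ⟨W', h', fun bs hbs hW => ?_⟩
    obtain ⟨p, hp, rfl⟩ := exists_mem_invs hk hbs (hW hf) h₁
    exact ⟨p, List.mem_append_right _ hp, bounded_of_mem_invs hbs hp,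
      sup_le (hW.trans (hle bs p)) ((span_singleton_le_iff_mem _ _).2 (hmem bs p))⟩

/-- Upper left entries followed by `reduce l` form an additive map that kills the span. In the
product case it also kills all `p * g` but not `t`; in the inverse case it does not kill the sum of
`t` and the inverse. -/
theorem not_stepMem_of_stepAvoids (hk : ∀ x : k, x = 0 ∨ x = 1) {ts : List ℕ}
    {b : PackedMatrix} {bs : List PackedMatrix} (hbs : ∀ x ∈ b :: bs, x.Bounded)
    (h : stepAvoids ts (b :: bs) = true) {t : PackedMatrix} (ht : t.Bounded) (hts : t.a ∈ ts) :
    ¬ StepMem (packedSpan k (one :: b :: bs)) (unpack k t) := by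
  obtain ⟨⟨l, hl, hinv⟩, hprod⟩ := exists_reduce_of_stepAvoids h hts
  have hbs' : ∀ x ∈ one :: b :: bs, x.Bounded := by
    intro x hx
    rcases List.mem_cons.1 hx with rfl | hx
    · exact bounded_one
    · exact hbs x hx
  have hzero : (⟨0, 0, 0, 0⟩ : PackedMatrix).Bounded := by simp [Bounded]
  have hunpack : unpack k ⟨0, 0, 0, 0⟩ = 0 := by
    funext i
    ext p q
    fin_cases p <;> fin_cases q <;> exact bitVal_zero k i
  have hspan : ∀ {l : List (ℕ × ℕ)}, (∀ x ∈ one :: b :: bs, reduce l x.a = 0) →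
      ∀ w ∈ packedSpan k (one :: b :: bs),
      ∃ p : PackedMatrix, p.Bounded ∧ w = unpack k p ∧ reduce l p.a = 0 := by
    intro l hl w hw
    rcases mem_packedSpan hk hw with rfl | ⟨p, hp, rfl⟩
    · exact ⟨_, hzero, hunpack.symm, reduce_zero l⟩
    · exact ⟨p, bounded_of_mem_nzSums hbs' hp, rfl,
        reduce_eq_zero_of_mem_nzSums (F := a) (fun _ _ => rfl) hl hp⟩
  have hnot : ∀ w ∈ packedSpan k (one :: b :: bs), ∀ p ∈ nzSums (b :: bs),
      ∀ g ∈ packedSpan k (b :: bs), unpack k t ≠ w + unpack k p * g := by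
    intro w hw p hp g hg heq
    obtain ⟨l, hl, hmul, hne⟩ := hprod p hp
    obtain ⟨w, hwb, rfl, hw0⟩ := hspan hl w hw
    obtain ⟨q, hqb, rfl, hq0⟩ : ∃ q : PackedMatrix, q.Bounded ∧ g = unpack k q ∧
        reduce l (p.mulA q) = 0 := by
      rcases mem_packedSpan hk hg with rfl | ⟨q, hq, rfl⟩
      · refine ⟨_, hzero, hunpack.symm, ?_⟩
        have : p.mulA ⟨0, 0, 0, 0⟩ = 0 := by
          change (p.a &&& 0) ^^^ (p.b &&& 0) = 0
          simp
        rw [this, reduce_zero]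
      · exact ⟨q, bounded_of_mem_nzSums hbs hq, rfl,
          reduce_eq_zero_of_mem_nzSums (mulA_add p) hmul hq⟩
    rw [← unpack_mul, ← unpack_add] at heq
    have : t.a = w.a ^^^ p.mulA q := a_eq_of_unpack_eq ht (hwb.add hqb.mul) heq
    rw [this, reduce_xor, hw0, hq0] at hne
    exact hne rfl
  have hmem : unpack k t ∉ packedSpan k (one :: b :: bs) := fun hT =>
    hnot _ hT b (by simp [nzSums]) 0 (zero_mem _) (by rw [mul_zero, add_zero])
  rintro (⟨w, hw, f, hf, g, hg, c, hT⟩ | ⟨w, hw, f, hf, z, c, hz, -, hT⟩)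
  · rcases hk c with rfl | rfl
    · rw [zero_smul, add_zero] at hT
      exact hmem (hT ▸ hw)
    obtain ⟨f', hf', g', hg', w', hw', hfg⟩ := exists_mul_eq hf hg
    rw [one_smul, hfg, ← add_assoc] at hT
    rcases mem_packedSpan hk hf' with rfl | ⟨p, hp, rfl⟩
    · rw [zero_mul, add_zero] at hT
      exact hmem (hT ▸ add_mem hw hw')
    · exact hnot _ (add_mem hw hw') p hp g' hg' hT
  · rcases hk c with rfl | rfl
    · rw [zero_smul, add_zero] at hT
      exact hmem (hT ▸ hw)
    obtain ⟨p, hp, rfl⟩ := exists_mem_invs hk hbs hf hz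
    obtain ⟨w, hwb, rfl, hw0⟩ := hspan hl w hw
    rw [one_smul, ← unpack_add] at hT
    have : t.a = w.a ^^^ p.a := a_eq_of_unpack_eq ht (hwb.add (bounded_of_mem_invs hbs hp)) hT
    refine hinv p hp ?_
    rw [this, Nat.xor_left_comm, Nat.xor_self, Nat.xor_zero, hw0]

/-- If the check succeeds, then no upper left entry in `ts` is reached in three steps. -/
theorem unpack_notMem_of_threeStepsAvoid (hk : ∀ x : k, x = 0 ∨ x = 1) {ts : List ℕ}
    {a b : PackedMatrix} (ha : a.Bounded) (hb : b.Bounded) (h : threeStepsAvoid ts a b = true)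
    {W : Submodule k (Fin 17 → Matrix (Fin 2) (Fin 2) k)}
    (hW : Reach (span k {1, unpack k a, unpack k b}) 3 W) {t : PackedMatrix} (ht : t.Bounded)
    (hts : t.a ∈ ts) : unpack k t ∉ W := by
  intro hmem
  obtain ⟨W₂, hW₂, hstep⟩ := hW.exists_stepMem hmem
  have hab : ∀ x ∈ [a, b], x.Bounded := by simp [ha, hb]
  have hspan : span k {1, unpack k a, unpack k b} ≤ packedSpan k [one, a, b] := by
    rw [span_le]
    rintro x (rfl | rfl | rfl)
    · rw [← unpack_one]
      exact mem_sup_right (mem_span_singleton_self _)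
    · exact mem_sup_left (mem_sup_right (mem_span_singleton_self _))
    · exact mem_sup_left (mem_sup_left (mem_sup_right (mem_span_singleton_self _)))
  obtain ⟨W₁, hW₁, h₂⟩ := exists_le_packedSpan hk hW₂
  obtain ⟨W₀, hW₀, h₁⟩ := exists_le_packedSpan hk hW₁
  cases hW₀
  obtain ⟨x, hx, hxb, hle₁⟩ := h₁ [a, b] hab hspan
  have hxab : ∀ z ∈ [x, a, b], z.Bounded := by simp [ha, hb, hxb]
  obtain ⟨y, hy, hyb, hle₂⟩ := h₂ [x, a, b] hxab hle₁
  exact not_stepMem_of_stepAvoids hk (by simp [ha, hb, hxb, hyb])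
    (stepAvoids_of_threeStepsAvoid h hx hy) ht hts (hstep.mono hle₂)

end Span

/-! ### The seventeen sample pairs. -/

section Points

/-- The first components of the inputs. -/
def pointA : PackedMatrix := ⟨72650, 12050, 120606, 118115⟩

/-- The second components of the inputs. -/
def pointB : PackedMatrix := ⟨47624, 90103, 131071, 123946⟩

/-- The inverses of the second components. -/
def pointR : PackedMatrix := ⟨123946, 90103, 131071, 47624⟩

/-- The inverses of `A B⁻¹ A - A + B`. -/
def pointE : PackedMatrix := ⟨126283, 24247, 128703, 113608⟩

/-- The first components `(B⁻¹ A - 1) (A B⁻¹ A - A + B)⁻¹` of the outputs. -/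
def pointC : PackedMatrix := ((pointR.mul pointA).add one).mul pointE

/-- The targets are the upper left entries of `pointE`, of `pointC` and of their sum: the nonzero
combinations over the field with two elements. -/
theorem threeStepsAvoid_points :
    threeStepsAvoid [126283, 51298, Nat.xor 126283 51298] pointA pointB = true := by
  decide +kernel

end Points

end PackedMatrix

/-! ### Cost over the field with two elements. -/

section SmallField

open PackedMatrix

variable {k : Type*} [Field k] [CharP k 2] {τ : k} {n : ℕ}

/-- Here `τ = 1`, and `S` is the full algebra of 2 × 2 matrices. The three nontrivial pairs `(α, β)`
are the three targets of the check. -/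
theorem five_le_cost_of_forall_eq (hk : ∀ x : k, x = 0 ∨ x = 1) (hτ : τ ≠ 0) (hn : 2 ≤ n)
    {Γ : SLP k} (hΓ : Γ.InvertsOn τ (T₁ τ n) ∨ Γ.InvertsOn τ (T₂ τ n)) : 5 ≤ Γ.cost := by
  by_contra! hcost
  obtain rfl : τ = 1 := (hk τ).resolve_left hτ
  have hval : ∀ {x y : PackedMatrix}, x.mul y = one → unpack k x * unpack k y = 1 := by
    intro x y h
    rw [← unpack_mul, h, unpack_one]
  have hnorm : unpack k pointA * unpack k pointR * unpack k pointA - unpack k pointA +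
      (1 : k) • unpack k pointB =
      unpack k ((((pointA.mul pointR).mul pointA).add pointA).add pointB) := by
    rw [sub_eq_add_of_charTwo, one_smul, unpack_add, unpack_add, unpack_mul, unpack_mul]
  obtain ⟨W, α, β, hW, hαβ, hmem⟩ := SLP.exists_reach_three hΓ hn hτ (by omega)
    (ι := AlgHom.id k (Matrix (Fin 2) (Fin 2) k)) Function.injective_id (fun _ h => h)
    (hval (x := pointB) (y := pointR) (by rfl)) (hval (x := pointR) (y := pointB) (by rfl))
    (by rw [hnorm]; exact hval (y := pointE) (by rfl))
    (by rw [hnorm]; exact hval (x := pointE) (by rfl))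
  have hC : (unpack k pointR * unpack k pointA - 1) * unpack k pointE = unpack k pointC := by
    rw [sub_eq_add_of_charTwo, pointC, unpack_mul, unpack_add, unpack_mul, unpack_one]
  rw [hC] at hmem
  have hE : pointE.Bounded := by simp [Bounded, pointE]
  have hnot : ∀ {t : PackedMatrix}, t.Bounded →
      t.a ∈ [126283, 51298, Nat.xor 126283 51298] → unpack k t ∉ W := fun ht hts =>
    unpack_notMem_of_threeStepsAvoid hk (by simp [Bounded, pointA]) (by simp [Bounded, pointB])
      threeStepsAvoid_points hW ht hts
  rcases hk α with rfl | rfl <;> rcases hk β with rfl | rfl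
  · simp at hαβ
  · rw [zero_smul, one_smul, zero_add] at hmem
    exact hnot hE (List.mem_cons_self ..) hmem
  · rw [zero_smul, one_smul, add_zero] at hmem
    exact hnot (Bounded.mul hE) (List.mem_cons_of_mem _ (List.mem_cons_self ..)) hmem
  · rw [one_smul, one_smul, add_comm, ← unpack_add] at hmem
    exact hnot (hE.add (Bounded.mul hE))
      (List.mem_cons_of_mem _ (List.mem_cons_of_mem _ (List.mem_cons_self ..))) hmem

end SmallField

end FrobeniusInversion

end

noncomputable section

namespace FrobeniusInversion

/-! ### The lower bound for the cost. -/

section Cost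

variable {k : Type*} [Field k] [CharP k 2] {τ : k} {n : ℕ}

/-- An element `x` other than 0 and 1 yields the four distinct elements `0, 1, x, x + 1`. -/
theorem five_le_cost (hf : Irreducible (quadPoly τ)) (hn : 2 ≤ n) {Γ : SLP k}
    (hΓ : Γ.InvertsOn τ (T₁ τ n) ∨ Γ.InvertsOn τ (T₂ τ n)) : 5 ≤ Γ.cost := by
  classical
  by_cases hk : ∀ x : k, x = 0 ∨ x = 1
  · exact five_le_cost_of_forall_eq hk (tau_ne_zero hf) hn hΓ
  · push Not at hk
    obtain ⟨x, hx0, hx1⟩ := hk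
    refine five_le_cost_of_four_le_card hf (s := {0, 1, x, x + 1}) ?_ hn hΓ
    have h : x + 1 ≠ 0 := fun h => hx1 (CharTwo.add_eq_zero.1 h)
    rw [Finset.card_insert_of_notMem, Finset.card_insert_of_notMem,
      Finset.card_insert_of_notMem, Finset.card_singleton]
    · simp
    · simp [hx1.symm, hx0]
    · simp [hx0.symm, h.symm]

end Cost

end FrobeniusInversion

end

open FrobeniusInversion in
theorem mainTheorem6 {k : Type*} [Field k] [CharP k 2] (τ : k)
    (hf : Irreducible (quadPoly τ)) (n : ℕ) (hn : 2 ≤ n) :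
    -- the algorithm inverts every matrix in `T₁ ∪ T₂`, each branch being correct on all of `Tᵢ`,
    -- with two inversions and three multiplications
    ((frobeniusInversion τ).Inverts τ n ∧
      (progT₁ τ).InvertsOn τ (T₁ τ n) ∧ (progT₂ τ).InvertsOn τ (T₂ τ n) ∧
      (progT₁ τ).numInv = 2 ∧ (progT₁ τ).numMul = 3 ∧
      (progT₂ τ).numInv = 2 ∧ (progT₂ τ).numMul = 3) ∧
    -- five is the least total number of inversions and multiplications, for algorithms with the
    -- same branching and for straight-line programs on `T₁` alone and on `T₂` alone
    IsLeast {c : ℕ | ∃ P : BranchingSLP k, P.Inverts τ n ∧ P.cost = c} 5 ∧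
    IsLeast {c : ℕ | ∃ Γ : SLP k, Γ.InvertsOn τ (T₁ τ n) ∧ Γ.cost = c} 5 ∧
    IsLeast {c : ℕ | ∃ Γ : SLP k, Γ.InvertsOn τ (T₂ τ n) ∧ Γ.cost = c} 5 ∧
    -- two is the least number of additions; on `T₂` it is attained, with two inversions and three
    -- multiplications, when the common term `X₂ - 1` is computed only once
    IsLeast {c : ℕ | ∃ Γ : SLP k, Γ.InvertsOn τ (T₁ τ n) ∧ Γ.numAdd = c} 2 ∧
    IsLeast {c : ℕ | ∃ Γ : SLP k, Γ.InvertsOn τ (T₂ τ n) ∧ Γ.numAdd = c} 2 ∧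
    (progT₁ τ).numAdd = 2 ∧
    ((progT₂' τ).InvertsOn τ (T₂ τ n) ∧
      (progT₂' τ).numInv = 2 ∧ (progT₂' τ).numMul = 3 ∧ (progT₂' τ).numAdd = 2) := by
  have hτ := tau_ne_zero hf
  refine ⟨⟨frobeniusInversion_inverts τ, progT₁_invertsOn τ, progT₂_invertsOn τ, rfl, rfl, rfl,
    rfl⟩, ⟨⟨frobeniusInversion τ, frobeniusInversion_inverts τ, rfl⟩, ?_⟩,
    ⟨⟨progT₁ τ, progT₁_invertsOn τ, rfl⟩, ?_⟩, ⟨⟨progT₂ τ, progT₂_invertsOn τ, rfl⟩, ?_⟩,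
    ⟨⟨progT₁ τ, progT₁_invertsOn τ, rfl⟩, ?_⟩, ⟨⟨progT₂' τ, progT₂'_invertsOn τ, rfl⟩, ?_⟩, rfl,
    progT₂'_invertsOn τ, rfl, rfl, rfl⟩
  · rintro _ ⟨P, hP, rfl⟩
    exact (five_le_cost hf hn (Or.inl hP.onT₁)).trans (le_max_left _ _)
  · rintro _ ⟨Γ, hΓ, rfl⟩
    exact five_le_cost hf hn (Or.inl hΓ)
  · rintro _ ⟨Γ, hΓ, rfl⟩
    exact five_le_cost hf hn (Or.inr hΓ)
  · rintro _ ⟨Γ, hΓ, rfl⟩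
    exact two_le_numAdd_of_invertsOn_T₁ hτ hn hΓ
  · rintro _ ⟨Γ, hΓ, rfl⟩
    exact two_le_numAdd_of_invertsOn_T₂ hτ hn hΓ
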